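/- Let $M\subseteq\mathbb N$. Then there exist a standard Borel space $X$ with a $\sigma$-finite non-atomic measure $\mu$, $\mu(X)=\infty$, and an automorphism $T$ of $(X,\mu)$ (an invertible bimeasurable $\mu$-preserving map) such that for every integer $m\ge 2$ the following holds for the unitary operator $T\otimes T^m$ on $L_2(X,\mu)\otimes L_2(X,\mu)=L_2(X\times X,\mu\times\mu)$, $F(x,y)\mapsto F(Tx,T^my)$: (i) if $m\in M$, then $T\otimes T^m$ has simple singular spectrum, i.e. it has a cyclic vector, and the spectral measure of every vector is singular with respect to Lebesgue measure on the circle; (ii) if $m\notin M$, then $T\otimes T^m$ has Lebesgue spectrum of countably infinite multiplicity, i.e. it is unitarily equivalent to the direct sum of countably infinitely many copies of the operator of multiplication by the coordinate $z$ on $L_2$ of the unit circle with Lebesgue measure. -/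

import Mathlib

open MeasureTheory

noncomputable section

namespace SpectralTensor

section Spectrum

variable {H : Type*} [NormedAddCommGroup H] [InnerProductSpace ℂ H]

/-- The finite Borel measure `σ` on the circle `ℝ/ℤ` is the spectral measure of the vector `f`
with respect to the unitary operator `U`: `∫ e^{2πint} dσ(t) = ⟨Uⁿ f, f⟩` for all `n ∈ ℤ`.
(Mathlib's inner product is linear in the second argument.) -/
def IsSpectralMeasure (U : H ≃ₗᵢ[ℂ] H) (f : H) (σ : Measure UnitAddCircle) : Prop :=
  IsFiniteMeasure σ ∧ ∀ n : ℤ, ∫ t, fourier n t ∂σ = inner ℂ f ((U ^ n) f)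

/-- The spectrum of `U` is singular: every spectral measure is singular with respect to
the Lebesgue (normalized Haar) measure of the circle. -/
def HasSingularSpectrum (U : H ≃ₗᵢ[ℂ] H) : Prop :=
  ∀ f : H, ∃ σ : Measure UnitAddCircle,
    IsSpectralMeasure U f σ ∧ σ.MutuallySingular AddCircle.haarAddCircle

/-- The spectrum of `U` is simple: there is a cyclic vector. -/
def HasSimpleSpectrum (U : H ≃ₗᵢ[ℂ] H) : Prop :=
  ∃ f : H, (Submodule.span ℂ (Set.range fun n : ℤ => (U ^ n) f)).topologicalClosure = ⊤

/-- The spectrum of `U` is Lebesgue of countably infinite multiplicity: `U` is unitarily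
equivalent to the direct sum of countably infinitely many copies of the operator of
multiplication by `e^{2πit}` on `L²` of the circle with Lebesgue measure. -/
def HasCountableLebesgueSpectrum (U : H ≃ₗᵢ[ℂ] H) : Prop :=
  ∃ W : H ≃ₗᵢ[ℂ]
      lp (fun _ : ℕ => Lp ℂ 2 (AddCircle.haarAddCircle : Measure UnitAddCircle)) 2,
    ∀ (f : H) (k : ℕ),
      (W (U f) k : UnitAddCircle → ℂ) =ᵐ[AddCircle.haarAddCircle]
        fun t => fourier 1 t * (W f k : UnitAddCircle → ℂ) t

end Spectrum

section Koopman

variable {X : Type*} [MeasurableSpace X] {μ : Measure X}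

/-- The unitary operator `f ↦ f ∘ T` on `L²(μ)` of an automorphism `T` of `(X, μ)`. -/
def koopman (T : X ≃ᵐ X) (hT : MeasurePreserving T μ μ) : Lp ℂ 2 μ ≃ₗᵢ[ℂ] Lp ℂ 2 μ :=
  LinearIsometryEquiv.ofSurjective (Lp.compMeasurePreservingₗᵢ ℂ T hT) (by
    intro f
    have hS : MeasurePreserving T.symm μ μ := hT.symm T
    refine ⟨Lp.compMeasurePreserving T.symm hS f, ?_⟩
    apply Lp.ext
    refine (Lp.coeFn_compMeasurePreserving _ hT).trans ?_
    have h := hT.quasiMeasurePreserving.ae_eq_comp (Lp.coeFn_compMeasurePreserving f hS)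
    refine h.trans (Filter.Eventually.of_forall fun x => ?_)
    simp)

/-- The map `(x, y) ↦ (T x, Tᵐ y)` of `X × X`. -/
def tensorPow (T : X ≃ᵐ X) (m : ℕ) : X × X ≃ᵐ X × X where
  toEquiv := Equiv.prodCongr T.toEquiv (T.toEquiv ^ m)
  measurable_toFun := by
    have h : Measurable (⇑T)^[m] := T.measurable.iterate m
    have h2 : ⇑(T.toEquiv ^ m) = (⇑T)^[m] := Equiv.Perm.iterate_eq_pow T.toEquiv m |>.symm
    exact (T.measurable.comp measurable_fst).prodMk ((h2 ▸ h).comp measurable_snd)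
  measurable_invFun := by
    have h : Measurable (⇑T.symm)^[m] := T.symm.measurable.iterate m
    have h2 : ⇑(T.toEquiv ^ m).symm = (⇑T.symm)^[m] := by
      change ⇑((T.toEquiv ^ m)⁻¹ : Equiv.Perm X) = _
      rw [← inv_pow]
      exact Equiv.Perm.iterate_eq_pow _ m |>.symm
    exact (T.symm.measurable.comp measurable_fst).prodMk ((h2 ▸ h).comp measurable_snd)

theorem tensorPow_apply (T : X ≃ᵐ X) (m : ℕ) (p : X × X) :
    tensorPow T m p = (T p.1, (⇑T)^[m] p.2) := by
  have h2 : ⇑(T.toEquiv ^ m) = (⇑T)^[m] := Equiv.Perm.iterate_eq_pow T.toEquiv m |>.symm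
  rw [← h2]; rfl

theorem measurePreserving_tensorPow [SFinite μ] (T : X ≃ᵐ X) (hT : MeasurePreserving T μ μ)
    (m : ℕ) : MeasurePreserving (tensorPow T m) (μ.prod μ) (μ.prod μ) := by
  have h : ⇑(tensorPow T m) = Prod.map T (⇑T)^[m] := funext fun p => tensorPow_apply T m p
  rw [h]
  exact hT.prod (hT.iterate m)

/-- The operator `T ⊗ Tᵐ` on `L²(μ) ⊗ L²(μ) = L²(μ × μ)`, that is `F(x, y) ↦ F(T x, Tᵐ y)`. -/
def tensorKoopman [SFinite μ] (T : X ≃ᵐ X) (hT : MeasurePreserving T μ μ) (m : ℕ) :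
    Lp ℂ 2 (μ.prod μ) ≃ₗᵢ[ℂ] Lp ℂ 2 (μ.prod μ) :=
  koopman (tensorPow T m) (measurePreserving_tensorPow T hT m)

end Koopman

end SpectralTensor

end

/-! The automorphism is a rank-one map of infinite measure, built by cutting and stacking. Tower `l`
is cut into four columns, placed in tower `l + 1` at the positions 0, R - s, S, S + aR - t, where a
≥ 2, s, t and the rapidly growing R, S depend on `l`. Of the 16 differences of positions exactly one
is close to R and exactly one is close to aR. Hence along stages with prescribed a, s, t the powers
U^R and U^(aR) of the Koopman operator U of T converge weakly to U^s / 4 and U^t / 4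
(`IsCorrelation.eventually_shift`). The data are arranged so that every triple (m, s, t) with m ∈ M,
m ≥ 2 occurs at infinitely many stages, while a number m ∉ M can equal a only at stages below m
(`exists_data`).

If m ∈ M, then T ⊗ T^m has all the operators (1/16) T^s ⊗ T^t as weak limits of powers. The case s =
t = 0 is a nonzero scalar, which excludes an absolutely continuous spectral component by the
Riemann–Lebesgue lemma (`hasSingularSpectrum_of_tendsto`). For arbitrary s, t, the cyclic space of
the indicator of (base of tower j) × (base of tower j) contains the indicators of all products of
two levels of tower j. These cyclic spaces increase with j and have dense union, and a Baire
category argument then yields one cyclic vector (`hasSimpleSpectrum_of_increasing`).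

If m ∉ M, a level of tower 0 meets its translate only at times close to a difference of positions
(`IsCorrelation.exists_near`), and at high stages no two such differences have ratio close to m
(`lt_abs_mul_positions_sub`). So products of two levels of tower 0 have bounded return times under T
× T^m (`correlation_mul_eq_zero`). The product map is therefore dissipative: almost all of the space
is the disjoint union of the translates of a wandering set W. An orthonormal basis of the
infinite-dimensional space L²(W), moved by the powers of the operator, exhibits the Lebesgue
spectrum (`hasCountableLebesgueSpectrum_of_bounded_returns`).

Points are coded by itineraries, which record the times of visits to the bases of all towers, so
that T becomes a shift on the standard Borel space ℕ → ℤ → Bool. -/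

open MeasureTheory
noncomputable section
namespace SpectralTensor

/-! ### Spectral measures, and singularity of the spectrum from weak limits of powers. -/

section SpectralMeasure
open Filter Topology
variable {H : Type*} [NormedAddCommGroup H] [InnerProductSpace ℂ H]

theorem zpow_add_apply (U : H ≃ₗᵢ[ℂ] H) (f : H) (k l : ℤ) :
    (U ^ (k + l)) f = (U ^ k) ((U ^ l) f) := by
  rw [zpow_add]; rfl

theorem inner_zpow_zpow (U : H ≃ₗᵢ[ℂ] H) (f g : H) (k l : ℤ) :
    inner ℂ ((U ^ k) f) ((U ^ l) g) = inner ℂ f ((U ^ (l - k)) g) := by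
  have h : (U ^ l) g = (U ^ k) ((U ^ (l - k)) g) := by
    rw [← zpow_add_apply]; congr 2; ring
  rw [h, LinearIsometryEquiv.inner_map_map]

theorem integral_fourier (n : ℤ) :
    ∫ t : UnitAddCircle, fourier n t ∂AddCircle.haarAddCircle = if n = 0 then 1 else 0 := by
  have := fourierCoeff_fourier (T := 1) n
  have := congrFun this 0
  simpa [fourierCoeff, Pi.single_apply, eq_comm] using this

theorem integrable_fourier (σ : Measure UnitAddCircle) [IsFiniteMeasure σ] (n : ℤ) :
    Integrable (fun t => fourier n t) σ :=
  BoundedContinuousFunction.integrable σ (BoundedContinuousFunction.mkOfCompact (fourier n))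

/-- The number of pairs `k, l < N` with `l - k = n`. -/
def shiftCount (N : ℕ) (n : ℤ) : ℕ :=
  ∑ k ∈ Finset.range N, ∑ l ∈ Finset.range N, if n + (k - l) = (0 : ℤ) then 1 else 0

theorem shiftCount_eq (N : ℕ) (n : ℤ) :
    shiftCount N n = (min (N : ℤ) (N - n)).toNat - (max 0 (-n)).toNat := by
  have h : shiftCount N n =
      ∑ k ∈ Finset.range N, if 0 ≤ n + (k : ℤ) ∧ n + (k : ℤ) < N then 1 else 0 := by
    refine Finset.sum_congr rfl fun k _ => ?_
    split_ifs with hk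
    · rw [Finset.sum_eq_single (n + k).toNat]
      · rw [if_pos]; omega
      · intro l _ hl; rw [if_neg]; omega
      · intro h; exact absurd (Finset.mem_range.2 (by omega)) h
    · refine Finset.sum_eq_zero fun l hl => ?_
      rw [if_neg]
      have := Finset.mem_range.1 hl
      omega
  rw [h, ← Finset.card_filter]
  have h2 : (Finset.range N).filter (fun k : ℕ => 0 ≤ n + (k : ℤ) ∧ n + (k : ℤ) < N) =
      Finset.Ico (max 0 (-n)).toNat (min (N : ℤ) (N - n)).toNat := by
    ext k; simp only [Finset.mem_filter, Finset.mem_range, Finset.mem_Ico]; omega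
  rw [h2, Nat.card_Ico]

/-- These are the Fejér weights 1 - |n|/N. -/
theorem tendsto_shiftCount (n : ℤ) :
    Tendsto (fun N : ℕ => (shiftCount N n : ℂ) / N) atTop (𝓝 1) := by
  have h : Tendsto (fun N : ℕ => 1 - (n.natAbs : ℝ) / N) atTop (𝓝 1) := by
    simpa using tendsto_const_nhds.sub (tendsto_const_div_atTop_nhds_zero_nat (n.natAbs : ℝ))
  have h2 : Tendsto (fun N : ℕ => (shiftCount N n : ℝ) / N) atTop (𝓝 1) := by
    refine tendsto_of_tendsto_of_tendsto_of_le_of_le' h tendsto_const_nhds ?_ ?_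
    · filter_upwards [eventually_gt_atTop 0] with N hN
      have hN' : (0 : ℝ) < N := by exact_mod_cast hN
      rw [le_div_iff₀ hN', sub_mul, div_mul_cancel₀ _ hN'.ne', one_mul, sub_le_iff_le_add]
      have : N ≤ shiftCount N n + n.natAbs := by rw [shiftCount_eq]; omega
      exact_mod_cast this
    · filter_upwards [eventually_gt_atTop 0] with N hN
      have hN' : (0 : ℝ) < N := by exact_mod_cast hN
      rw [div_le_one hN']
      have : shiftCount N n ≤ N := by rw [shiftCount_eq]; omega
      exact_mod_cast this
  have := (Complex.continuous_ofReal.tendsto 1).comp h2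
  simpa [Function.comp_def] using this

/-- The analytic polynomial `∑_{k < N} e^{-2πikt} Uᵏ f`. -/
def orbitPoly (U : H ≃ₗᵢ[ℂ] H) (f : H) (N : ℕ) (t : UnitAddCircle) : H :=
  ∑ k ∈ Finset.range N, (fourier (-(k : ℤ)) t : ℂ) • (U ^ (k : ℤ)) f

theorem continuous_orbitPoly (U : H ≃ₗᵢ[ℂ] H) (f : H) (N : ℕ) :
    Continuous (orbitPoly U f N) := by
  unfold orbitPoly
  fun_prop

/-- Expanding the square gives terms e^{2πi(n+k-l)t} ⟨f, U^(l-k) f⟩, and integration keeps only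
those with l - k = n. So `‖orbitPoly‖²` is a nonnegative density whose Fourier coefficients are the
Fejér-weighted autocorrelations of `f`. -/
theorem integral_fourier_mul_orbitPoly (U : H ≃ₗᵢ[ℂ] H) (f : H) (N : ℕ) (n : ℤ) :
    ∫ t, fourier n t * ((‖orbitPoly U f N t‖ ^ 2 : ℝ) : ℂ) ∂AddCircle.haarAddCircle =
      shiftCount N n * inner ℂ f ((U ^ n) f) := by
  have h : ∀ t, fourier n t * ((‖orbitPoly U f N t‖ ^ 2 : ℝ) : ℂ) =
      ∑ k ∈ Finset.range N, ∑ l ∈ Finset.range N,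
        fourier (n + ((k : ℤ) - l)) t * inner ℂ f ((U ^ ((l : ℤ) - k)) f) := by
    intro t
    have h1 : ((‖orbitPoly U f N t‖ ^ 2 : ℝ) : ℂ) =
        inner ℂ (orbitPoly U f N t) (orbitPoly U f N t) := by
      rw [inner_self_eq_norm_sq_to_K]; simp
    rw [h1, orbitPoly, sum_inner, Finset.mul_sum]
    refine Finset.sum_congr rfl fun k _ => ?_
    rw [inner_sum, Finset.mul_sum]
    refine Finset.sum_congr rfl fun l _ => ?_
    rw [inner_smul_left, inner_smul_right, inner_zpow_zpow, ← fourier_neg, neg_neg, fourier_add,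
      sub_eq_add_neg (k : ℤ) l, fourier_add]
    ring
  simp_rw [h]
  rw [integral_finsetSum _ fun k _ => integrable_finsetSum _ fun l _ =>
    (integrable_fourier _ _).mul_const _]
  rw [shiftCount, Nat.cast_sum, Finset.sum_mul]
  refine Finset.sum_congr rfl fun k _ => ?_
  rw [integral_finsetSum _ fun l _ => (integrable_fourier _ _).mul_const _, Nat.cast_sum,
    Finset.sum_mul]
  refine Finset.sum_congr rfl fun l _ => ?_
  rw [integral_mul_const, integral_fourier]
  split_ifs with hk
  · have : n = l - k := by omega
    simp [this]
  · simp

/-- Every vector has a spectral measure. -/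
theorem exists_isSpectralMeasure (U : H ≃ₗᵢ[ℂ] H) (f : H) :
    ∃ σ : Measure UnitAddCircle, IsSpectralMeasure U f σ := by
  rcases eq_or_ne f 0 with rfl | hf
  · exact ⟨0, inferInstance, fun n => by simp⟩
  -- Herglotz's theorem by Fejér means: these densities have total mass 1 for N ≥ 1, and a weak
  -- limit of them is the spectral measure divided by ‖f‖².
  let ρ : ℕ → UnitAddCircle → NNReal := fun N t => ‖orbitPoly U f N t‖₊ ^ 2 / (N * ‖f‖₊ ^ 2)
  have hρc : ∀ N, Continuous (ρ N) := fun N =>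
    (((continuous_orbitPoly U f N).nnnorm).pow 2).div_const _
  let ν : ℕ → Measure UnitAddCircle := fun N =>
    AddCircle.haarAddCircle.withDensity fun t => (ρ N t : ENNReal)
  have hfin : ∀ N, IsFiniteMeasure (ν N) := fun N => by
    refine isFiniteMeasure_withDensity ?_
    obtain ⟨t, ht⟩ := (isCompact_univ (X := UnitAddCircle)).exists_isMaxOn Set.univ_nonempty
      (hρc N).continuousOn
    refine ne_top_of_le_ne_top
      (b := ∫⁻ _ : UnitAddCircle, (ρ N t : ENNReal) ∂AddCircle.haarAddCircle) ?_ ?_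
    · simp
    · exact lintegral_mono fun s => ENNReal.coe_le_coe.2 (ht.2 (Set.mem_univ s))
  have hint : ∀ N : ℕ, ∀ n : ℤ, ∫ t, fourier n t ∂ν N =
      (shiftCount N n : ℂ) / N * (inner ℂ f ((U ^ n) f) / (‖f‖ ^ 2 : ℝ)) := fun N n => by
    rw [integral_withDensity_eq_integral_smul (hρc N).measurable]
    have : ∀ t, ρ N t • fourier n t =
        fourier n t * ((‖orbitPoly U f N t‖ ^ 2 : ℝ) : ℂ) * ((N * ‖f‖ ^ 2 : ℝ) : ℂ)⁻¹ := fun t => by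
      rw [NNReal.smul_def, Complex.real_smul]
      simp only [ρ, NNReal.coe_div, NNReal.coe_pow, coe_nnnorm, NNReal.coe_mul, NNReal.coe_natCast]
      push_cast
      ring
    simp_rw [this]
    rw [integral_mul_const, integral_fourier_mul_orbitPoly]
    push_cast
    ring
  have hf2 : ((‖f‖ ^ 2 : ℝ) : ℂ) ≠ 0 := by
    exact_mod_cast (pow_pos (norm_pos_iff.2 hf) 2).ne'
  -- The index is shifted by one because the density for N = 0 is 0/0 = 0.
  have hprob : ∀ N, IsProbabilityMeasure (ν (N + 1)) := fun N => by
    have h1 := hint (N + 1) 0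
    have h2 : inner ℂ f f = ((‖f‖ ^ 2 : ℝ) : ℂ) := by
      rw [inner_self_eq_norm_sq_to_K]; simp
    have h3 : shiftCount (N + 1) 0 = N + 1 := by rw [shiftCount_eq]; omega
    have h4 : ((N + 1 : ℕ) : ℂ) ≠ 0 := by exact_mod_cast N.succ_ne_zero
    rw [h3, zpow_zero, LinearIsometryEquiv.coe_one, id, h2, div_self hf2, div_self h4] at h1
    simp only [fourier_zero, integral_const, Complex.real_smul, mul_one, Complex.ofReal_eq_one] at h1
    exact ⟨(ENNReal.toReal_eq_one_iff _).1 h1⟩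
  let p : ℕ → ProbabilityMeasure UnitAddCircle := fun N => ⟨ν (N + 1), hprob N⟩
  -- Probability measures on the circle form a compact space, so an ultrafilter limit exists; no
  -- subsequence is needed.
  let 𝒰 := (hyperfilter ℕ).map p
  have hlim : Tendsto p (hyperfilter ℕ) (𝓝 𝒰.lim) := 𝒰.le_nhds_lim
  let τ := 𝒰.lim
  rw [ProbabilityMeasure.tendsto_iff_forall_integral_rclike_tendsto ℂ] at hlim
  have hτ : ∀ n : ℤ, ∫ t, fourier n t ∂(τ : Measure UnitAddCircle) =
      inner ℂ f ((U ^ n) f) / (‖f‖ ^ 2 : ℝ) := fun n => by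
    have h1 := hlim (BoundedContinuousFunction.mkOfCompact (fourier n))
    refine tendsto_nhds_unique h1 ?_
    simp only [BoundedContinuousFunction.mkOfCompact_apply]
    have h2 : ∀ N, ∫ t, fourier n t ∂(p N : Measure UnitAddCircle) = _ := fun N => hint (N + 1) n
    simp_rw [h2]
    have h3 := ((tendsto_shiftCount n).comp (tendsto_add_atTop_nat 1)).mul_const
      (inner ℂ f ((U ^ n) f) / (‖f‖ ^ 2 : ℝ))
    rw [one_mul] at h3
    exact h3.mono_left (Nat.hyperfilter_le_atTop)
  refine ⟨ENNReal.ofReal (‖f‖ ^ 2) • (τ : Measure UnitAddCircle), ?_, fun n => ?_⟩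
  · exact Measure.smul_finite _ ENNReal.ofReal_ne_top
  · rw [integral_smul_measure, hτ, ENNReal.toReal_ofReal (by positivity), Complex.real_smul]
    field_simp

/-- If `e^{2πi n_k t} → c` in the sense of Fourier coefficients of `σ`, then this holds weakly
against every integrable function. -/
theorem tendsto_integral_fourier_mul (σ : Measure UnitAddCircle) [IsFiniteMeasure σ]
    {n : ℕ → ℤ} {c : ℂ}
    (h : ∀ j : ℤ, Tendsto (fun k => ∫ t, fourier (n k + j) t ∂σ) atTop
      (𝓝 (c * ∫ t, fourier j t ∂σ)))
    (φ : UnitAddCircle → ℂ) (hφ : Integrable φ σ) :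
    Tendsto (fun k => ∫ t, fourier (n k) t * φ t ∂σ) atTop (𝓝 (c * ∫ t, φ t ∂σ)) := by
  let Λ : ℕ → Lp ℂ 1 σ → ℂ := fun k g => ∫ t, fourier (n k) t * g t ∂σ
  have hmul : ∀ k, ∀ g : UnitAddCircle → ℂ, Integrable g σ →
      Integrable (fun t => fourier (n k) t * g t) σ := fun k g hg =>
    hg.bdd_mul (c := 1) (fourier (n k)).continuous.aestronglyMeasurable (ae_of_all _ fun t => by
      rw [fourier_apply, Circle.norm_coe])
  have hdiff : ∀ k, ∀ g g' : UnitAddCircle → ℂ, Integrable g σ → Integrable g' σ →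
      ‖(∫ t, fourier (n k) t * g t ∂σ) - ∫ t, fourier (n k) t * g' t ∂σ‖ ≤
        ∫ t, ‖g t - g' t‖ ∂σ := fun k g g' hg hg' => by
    rw [← integral_sub (hmul k g hg) (hmul k g' hg')]
    refine (norm_integral_le_integral_norm _).trans (le_of_eq (integral_congr_ae ?_))
    refine ae_of_all _ fun t => ?_
    simp only
    rw [← mul_sub, norm_mul, fourier_apply, Circle.norm_coe, one_mul]
  -- The functions for which the claim holds form a subspace. It is closed in L¹(σ), as the
  -- functionals have norm at most 1, and contains the characters, hence the continuous functions,
  -- hence all integrable ones.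
  let S : Submodule ℂ (UnitAddCircle → ℂ) :=
    { carrier := {g | Integrable g σ ∧ Tendsto (fun k => ∫ t, fourier (n k) t * g t ∂σ) atTop
        (𝓝 (c * ∫ t, g t ∂σ))}
      zero_mem' := by simp
      add_mem' := by
        rintro a b ⟨ha, ha'⟩ ⟨hb, hb'⟩
        refine ⟨ha.add hb, ?_⟩
        have := ha'.add hb'
        rw [← mul_add, ← integral_add ha hb] at this
        refine this.congr fun k => ?_
        rw [← integral_add (hmul k a ha) (hmul k b hb)]
        simp [mul_add]
      smul_mem' := by
        rintro r a ⟨ha, ha'⟩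
        refine ⟨ha.smul r, ?_⟩
        have := ha'.const_mul r
        have e : r * (c * ∫ t, a t ∂σ) = c * ∫ t, (r • a) t ∂σ := by
          simp only [Pi.smul_apply, smul_eq_mul]
          rw [integral_const_mul]; ring
        rw [e] at this
        refine this.congr fun k => ?_
        rw [← integral_const_mul]
        refine integral_congr_ae (ae_of_all _ fun t => ?_)
        simp; ring }
  have hclose : ∀ g : UnitAddCircle → ℂ, Integrable g σ →
      (∀ ε > 0, ∃ g' ∈ S, ∫ t, ‖g t - g' t‖ ∂σ ≤ ε) → g ∈ S := by
    intro g hg hap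
    refine ⟨hg, Metric.tendsto_atTop.2 fun ε hε => ?_⟩
    obtain ⟨g', ⟨hg', hg't⟩, hgg'⟩ := hap (ε / (2 * (1 + ‖c‖))) (by positivity)
    obtain ⟨N, hN⟩ := Metric.tendsto_atTop.1 hg't (ε / 2) (by positivity)
    refine ⟨N, fun k hk => ?_⟩
    have h1 := hdiff k g g' hg hg'
    have h2 := hN k hk
    have h3 : ‖c * ∫ t, g' t ∂σ - c * ∫ t, g t ∂σ‖ ≤ ‖c‖ * ∫ t, ‖g t - g' t‖ ∂σ := by
      rw [← mul_sub, norm_mul, ← norm_neg (_ - _), neg_sub, ← integral_sub hg hg']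
      exact mul_le_mul_of_nonneg_left (norm_integral_le_integral_norm _) (norm_nonneg _)
    rw [dist_eq_norm] at h2 ⊢
    have h4 : (1 + ‖c‖) * ∫ t, ‖g t - g' t‖ ∂σ ≤ ε / 2 := by
      calc _ ≤ (1 + ‖c‖) * (ε / (2 * (1 + ‖c‖))) := by gcongr
        _ = ε / 2 := by field_simp
    have h5 : (∫ t, fourier (n k) t * g t ∂σ) - c * ∫ t, g t ∂σ =
        ((∫ t, fourier (n k) t * g t ∂σ) - ∫ t, fourier (n k) t * g' t ∂σ) +
        ((∫ t, fourier (n k) t * g' t ∂σ) - c * ∫ t, g' t ∂σ) +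
        (c * ∫ t, g' t ∂σ - c * ∫ t, g t ∂σ) := by ring
    rw [h5]
    refine (norm_add₃_le).trans_lt ?_
    linarith
  have hfour : ∀ j : ℤ, (fun t => fourier j t) ∈ S := fun j => by
    refine ⟨integrable_fourier σ j, (h j).congr fun k => ?_⟩
    simp only [fourier_add]
  have hspan : ∀ g ∈ Submodule.span ℂ (Set.range (@fourier 1)), (fun t => g t) ∈ S := by
    intro g hg
    induction hg using Submodule.span_induction with
    | mem x hx => obtain ⟨j, rfl⟩ := hx; exact hfour j
    | zero => exact S.zero_mem
    | add x y _ _ hx hy => exact S.add_mem hx hy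
    | smul a x _ hx => exact S.smul_mem a hx
  have hcont : ∀ g : C(UnitAddCircle, ℂ), (fun t => g t) ∈ S := by
    intro g
    have hg : g ∈ (Submodule.span ℂ (Set.range (@fourier 1))).topologicalClosure := by
      rw [span_fourier_closure_eq_top]; trivial
    refine hclose _ (BoundedContinuousFunction.integrable σ
      (BoundedContinuousFunction.mkOfCompact g)) fun ε hε => ?_
    have hg2 : g ∈ closure (Submodule.span ℂ (Set.range (@fourier 1)) : Set C(UnitAddCircle, ℂ)) := hg
    obtain ⟨g', hg', hd⟩ := Metric.mem_closure_iff.1 hg2 (ε / (σ.real Set.univ + 1))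
      (by positivity)
    refine ⟨_, hspan g' hg', ?_⟩
    have hb : ∀ t, ‖g t - g' t‖ ≤ ε / (σ.real Set.univ + 1) := fun t => by
      rw [← dist_eq_norm]; exact (ContinuousMap.dist_apply_le_dist t).trans hd.le
    calc ∫ t, ‖g t - g' t‖ ∂σ ≤ ∫ t, ε / (σ.real Set.univ + 1) ∂σ := by
          refine integral_mono ?_ (integrable_const _) hb
          exact (BoundedContinuousFunction.integrable σ
            (BoundedContinuousFunction.mkOfCompact (g - g'))).norm
      _ = σ.real Set.univ * (ε / (σ.real Set.univ + 1)) := by simp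
      _ ≤ ε := by
          rw [← mul_div_assoc, div_le_iff₀ (by positivity)]
          nlinarith [measureReal_nonneg (μ := σ) (s := Set.univ)]
  refine (hclose φ hφ fun ε hε => ?_).2
  obtain ⟨g, hg, _⟩ := hφ.exists_boundedContinuous_integral_sub_le hε
  exact ⟨g, hcont g.toContinuousMap, hg⟩

/-- A unitary operator with a nonzero scalar operator as a weak limit of its powers `U^{n_k}`,
`n_k → ∞`, has singular spectrum. -/
theorem hasSingularSpectrum_of_tendsto (U : H ≃ₗᵢ[ℂ] H) {n : ℕ → ℤ} {c : ℂ} (hc : c ≠ 0)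
    (hn : Tendsto n atTop atTop)
    (h : ∀ f g : H, Tendsto (fun k => inner ℂ f ((U ^ n k) g)) atTop (𝓝 (c * inner ℂ f g))) :
    HasSingularSpectrum U := by
  intro f
  obtain ⟨σ, hσ⟩ := exists_isSpectralMeasure U f
  refine ⟨σ, hσ, ?_⟩
  obtain ⟨hfin, hcoef⟩ := hσ
  let m : Measure UnitAddCircle := AddCircle.haarAddCircle
  -- `A` has full Lebesgue measure and is null for the singular part, so σ restricted to `A` is the
  -- absolutely continuous part. Integrating e^{2πi n_k t} over `A` gives the limit c σ(A) by
  -- hypothesis and 0 by Riemann–Lebesgue, so σ(A) = 0.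
  obtain ⟨A, hA, hA1, hA2⟩ := Measure.mutuallySingular_singularPart σ m
  have hdec := Measure.haveLebesgueDecomposition_add σ m
  have hρm : Measurable (σ.rnDeriv m) := Measure.measurable_rnDeriv _ _
  have h1 := tendsto_integral_fourier_mul σ (n := n) (c := c) (fun j => by
    simp_rw [hcoef, zpow_add_apply]
    exact h f _) (A.indicator 1) ((integrable_const (1 : ℂ)).indicator hA)
  -- The Riemann–Lebesgue lemma, as the case c = 0 of the same criterion.
  have h2 := tendsto_integral_fourier_mul m (n := n) (c := 0) (fun j => by
    simp_rw [m, integral_fourier, zero_mul]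
    refine tendsto_const_nhds.congr' ?_
    filter_upwards [hn.eventually_gt_atTop (-j)] with k hk
    rw [if_neg (by omega)]) (fun t => ((σ.rnDeriv m t).toReal : ℂ))
      Measure.integrable_toReal_rnDeriv.ofReal
  have h3 : ∀ g : UnitAddCircle → ℂ, ∫ t, g t * A.indicator 1 t ∂σ =
      ∫ t, g t * ((σ.rnDeriv m t).toReal : ℂ) ∂m := fun g => by
    have e1 : (fun t => g t * A.indicator 1 t) = A.indicator g := by
      ext t; by_cases ht : t ∈ A <;> simp [ht]
    rw [e1, integral_indicator hA]
    have e2 : σ.restrict A = (m.withDensity (σ.rnDeriv m)) := by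
      conv_lhs => rw [hdec]
      rw [Measure.restrict_add, Measure.restrict_eq_zero.2 hA1, zero_add]
      refine Measure.restrict_eq_self_of_ae_mem ?_
      exact (withDensity_absolutelyContinuous m _) hA2
    rw [e2, integral_withDensity_eq_integral_toReal_smul hρm (Measure.rnDeriv_lt_top _ _)]
    refine integral_congr_ae (ae_of_all _ fun t => ?_)
    simp [mul_comm]
  simp_rw [h3] at h1
  rw [zero_mul] at h2
  have h4 := tendsto_nhds_unique h1 h2
  rw [mul_eq_zero, or_iff_right hc, integral_indicator hA] at h4
  simp only [Pi.one_apply, integral_const, measureReal_restrict_apply_univ, Complex.real_smul,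
    mul_one, Complex.ofReal_eq_zero] at h4
  refine ⟨A, hA, ?_, hA2⟩
  exact (measureReal_eq_zero_iff).1 h4

end SpectralMeasure

/-! ### Cyclic subspaces and a Baire category criterion for simple spectrum. -/

section Cyclic
open Filter Topology
variable {H : Type*} [NormedAddCommGroup H] [InnerProductSpace ℂ H]

/-- The closed cyclic subspace of `U` generated by `f`. -/
def cyc (U : H ≃ₗᵢ[ℂ] H) (f : H) : Submodule ℂ H :=
  (Submodule.span ℂ (Set.range fun n : ℤ => (U ^ n) f)).topologicalClosure

theorem isClosed_cyc (U : H ≃ₗᵢ[ℂ] H) (f : H) : IsClosed (cyc U f : Set H) :=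
  Submodule.isClosed_topologicalClosure _

theorem zpow_mem_cyc_self (U : H ≃ₗᵢ[ℂ] H) (f : H) (n : ℤ) : (U ^ n) f ∈ cyc U f :=
  Submodule.le_topologicalClosure _ (Submodule.subset_span ⟨n, rfl⟩)

theorem self_mem_cyc (U : H ≃ₗᵢ[ℂ] H) (f : H) : f ∈ cyc U f := zpow_mem_cyc_self U f 0

theorem cyc_le_of_forall_mem (U : H ≃ₗᵢ[ℂ] H) {f : H} {K : Submodule ℂ H}
    (hK : IsClosed (K : Set H)) (h : ∀ n : ℤ, (U ^ n) f ∈ K) : cyc U f ≤ K := by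
  refine Submodule.topologicalClosure_minimal _ (Submodule.span_le.2 ?_) hK
  rintro _ ⟨n, rfl⟩
  exact h n

theorem zpow_mem_cyc (U : H ≃ₗᵢ[ℂ] H) {f v : H} (hv : v ∈ cyc U f) (k : ℤ) :
    (U ^ k) v ∈ cyc U f := by
  have : cyc U f ≤ (cyc U f).comap ((U ^ k).toLinearEquiv : H →ₗ[ℂ] H) := by
    refine cyc_le_of_forall_mem U ((isClosed_cyc U f).preimage (U ^ k).continuous) fun n => ?_
    change (U ^ k) ((U ^ n) f) ∈ cyc U f
    rw [← zpow_add_apply]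
    exact zpow_mem_cyc_self U f _
  exact this hv

theorem apply_mem_cyc (U : H ≃ₗᵢ[ℂ] H) {f v : H} (hv : v ∈ cyc U f) : U v ∈ cyc U f := by
  simpa using zpow_mem_cyc U hv 1

theorem cyc_le_cyc (U : H ≃ₗᵢ[ℂ] H) {f v : H} (hv : v ∈ cyc U f) : cyc U v ≤ cyc U f :=
  cyc_le_of_forall_mem U (isClosed_cyc U f) fun n => zpow_mem_cyc U hv n

/-- Removes exceptional parameters: `S` need only be preserved for a dense set of `a`, as the
closure of `S` is then preserved for every `a`. -/
theorem closure_induct {H : Type*} [TopologicalSpace H] {S : Set H} {A : Set ℂ} (hA : Dense A) {F : ℂ → H → H}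
    (hc : ∀ w, Continuous fun a => F a w) (hc' : ∀ a, Continuous (F a))
    (h : ∀ a ∈ A, ∀ w ∈ S, F a w ∈ S) (a : ℂ) {w : H} (hw : w ∈ closure S) :
    F a w ∈ closure S := by
  have h1 : ∀ w ∈ S, F a w ∈ closure S := fun w hw => by
    have : a ∈ closure A := hA a
    exact map_mem_closure (f := fun a => F a w) (hc w) this fun b hb => h b hb w hw
  have h2 := map_mem_closure (hc' a) hw h1
  rwa [closure_closure] at h2

open Polynomial in
theorem aeval_X_pow_apply (U : H ≃ₗᵢ[ℂ] H) (n : ℕ) (w : H) :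
    aeval (U.toLinearEquiv : H →ₗ[ℂ] H) (X ^ n : ℂ[X]) w = (U ^ (n : ℤ)) w := by
  rw [map_pow, aeval_X]
  induction n generalizing w with
  | zero => simp
  | succ n ih =>
    rw [pow_succ, Module.End.mul_apply, ih]
    push_cast
    rw [zpow_add_apply, zpow_one]; rfl

open Polynomial in
-- A Laurent polynomial in `U` becomes a polynomial after multiplication by a power of `U`, and can
-- then be factored over ℂ.
theorem exists_zpow_eq_aeval (U : H ≃ₗᵢ[ℂ] H) {g v : H}
    (hv : v ∈ Submodule.span ℂ (Set.range fun n : ℤ => (U ^ n) g)) :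
    ∃ (N : ℕ) (p : ℂ[X]), (U ^ (N : ℤ)) v = aeval (U.toLinearEquiv : H →ₗ[ℂ] H) p g := by
  induction hv using Submodule.span_induction with
  | mem x hx =>
    obtain ⟨n, rfl⟩ := hx
    refine ⟨n.natAbs, X ^ (n.natAbs + n).toNat, ?_⟩
    rw [aeval_X_pow_apply]
    simp only
    rw [← zpow_add_apply]; congr 2; omega
  | zero => exact ⟨0, 0, by simp⟩
  | add x y _ _ hx hy =>
    obtain ⟨N, p, hp⟩ := hx
    obtain ⟨N', p', hp'⟩ := hy
    refine ⟨N + N', X ^ N' * p + X ^ N * p', ?_⟩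
    rw [map_add, map_add, map_mul, map_mul, LinearMap.add_apply, Module.End.mul_apply,
      Module.End.mul_apply, aeval_X_pow_apply, aeval_X_pow_apply, ← hp, ← hp', ← zpow_add_apply,
      ← zpow_add_apply]
    push_cast
    rw [add_comm (N' : ℤ)]
  | smul c x _ hx =>
    obtain ⟨N, p, hp⟩ := hx
    refine ⟨N, c • p, ?_⟩
    rw [map_smul, hp, map_smul, LinearMap.smul_apply]

/-- The vectors whose cyclic subspace contains `g`. -/
def generators (U : H ≃ₗᵢ[ℂ] H) (g : H) : Set H := {w | g ∈ cyc U w}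

theorem mem_generators {U : H ≃ₗᵢ[ℂ] H} {g w : H} : w ∈ generators U g ↔ g ∈ cyc U w := Iff.rfl

variable [CompleteSpace H]

/-- Let u be the component of `v` orthogonal to the cyclic space K of Uv - av. Both K and its
complement are invariant, so Uu - au lies in both and vanishes. An isometry has no eigenvalue off
the unit circle, hence u = 0. -/
theorem mem_cyc_apply_sub_smul (U : H ≃ₗᵢ[ℂ] H) (v : H) {a : ℂ} (ha : ‖a‖ ≠ 1) :
    v ∈ cyc U (U v - a • v) := by
  set K := cyc U (U v - a • v)
  have : CompleteSpace K := (isClosed_cyc U _).completeSpace_coe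
  set z : H := K.starProjection v
  have hz : z ∈ K := Submodule.starProjection_apply_mem K v
  have hu : v - z ∈ Kᗮ := Submodule.sub_starProjection_mem_orthogonal v
  have h1 : U (v - z) - a • (v - z) ∈ K := by
    have e : U (v - z) - a • (v - z) = (U v - a • v) - (U z - a • z) := by
      rw [map_sub, smul_sub]; abel
    rw [e]
    exact K.sub_mem (self_mem_cyc U _) (K.sub_mem (apply_mem_cyc U hz) (K.smul_mem a hz))
  have h2 : U (v - z) - a • (v - z) ∈ Kᗮ := by
    refine Kᗮ.sub_mem (fun w hw => ?_) (Kᗮ.smul_mem a hu)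
    have hw' : (U ^ (-1 : ℤ)) w ∈ K := zpow_mem_cyc U hw _
    have e : w = U ((U ^ (-1 : ℤ)) w) := by
      have := zpow_add_apply U w 1 (-1)
      rwa [zpow_one, add_neg_cancel, zpow_zero] at this
    rw [e, LinearIsometryEquiv.inner_map_map]
    exact hu _ hw'
  have h3 : U (v - z) - a • (v - z) = 0 := by
    have := (Submodule.isOrtho_iff_inner_eq.1 (Submodule.isOrtho_orthogonal_right K)) _ h1 _ h2
    exact inner_self_eq_zero.1 this
  have h4 : ‖v - z‖ = ‖a‖ * ‖v - z‖ := by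
    rw [← norm_smul, ← sub_eq_zero.1 h3, LinearIsometryEquiv.norm_map]
  have h5 : ‖v - z‖ = 0 := by
    by_contra h
    exact ha (mul_right_cancel₀ h (by rw [← h4, one_mul]))
  rw [sub_eq_zero.1 (norm_eq_zero.1 h5)]
  exact hz

theorem dense_norm_ne_one : Dense {a : ℂ | ‖a‖ ≠ 1} := by
  have h : {a : ℂ | ‖a‖ ≠ 1} = (Metric.sphere (0 : ℂ) 1)ᶜ := by ext; simp
  rw [h, ← interior_eq_empty_iff_dense_compl]
  exact interior_sphere _ one_ne_zero

/-- Vectors of the cyclic subspace of `g` are approximated by vectors generating the same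
cyclic subspace. -/
theorem mem_closure_generators (U : H ≃ₗᵢ[ℂ] H) {g v : H} (hv : v ∈ cyc U g) :
    v ∈ closure (generators U g) := by
  have hsmul : ∀ (c : ℂ) (w : H), w ∈ closure (generators U g) →
      c • w ∈ closure (generators U g) := fun c w hw => by
    refine closure_induct (A := {0}ᶜ) (F := fun (c : ℂ) (w : H) => c • w)
      (dense_compl_singleton 0) (fun w => by fun_prop) (fun a => by fun_prop)
      (fun a ha w hw => ?_) c hw
    rw [mem_generators] at hw ⊢
    refine cyc_le_cyc U (v := w) ?_ hw
    have h := (cyc U (a • w)).smul_mem a⁻¹ (self_mem_cyc U (a • w))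
    rwa [inv_smul_smul₀ ha] at h
  have hsub : ∀ (a : ℂ) (w : H), w ∈ closure (generators U g) →
      U w - a • w ∈ closure (generators U g) := fun a w hw => by
    refine closure_induct (F := fun (a : ℂ) (w : H) => U w - a • w) dense_norm_ne_one
      (fun w => by fun_prop) (fun a => by fun_prop) (fun a ha w hw => ?_) a hw
    rw [mem_generators] at hw ⊢
    exact cyc_le_cyc U (mem_cyc_apply_sub_smul U w ha) hw
  have hpow : ∀ (n : ℤ) (w : H), w ∈ closure (generators U g) →
      (U ^ n) w ∈ closure (generators U g) := fun n w hw => by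
    refine map_mem_closure (U ^ n).continuous hw fun w hw => ?_
    rw [mem_generators] at hw ⊢
    refine cyc_le_cyc U (v := w) ?_ hw
    have := zpow_mem_cyc_self U ((U ^ n) w) (-n)
    rwa [← zpow_add_apply, neg_add_cancel, zpow_zero] at this
  have hpoly : ∀ s : Multiset ℂ, Polynomial.aeval (U.toLinearEquiv : H →ₗ[ℂ] H)
      (s.map fun a => Polynomial.X - Polynomial.C a).prod g ∈ closure (generators U g) :=
    fun s => by
    induction s using Multiset.induction with
    | empty =>
      rw [Multiset.map_zero, Multiset.prod_zero, map_one]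
      exact subset_closure (mem_generators.2 (self_mem_cyc U g))
    | cons a s ih =>
      rw [Multiset.map_cons, Multiset.prod_cons, map_mul, Module.End.mul_apply, map_sub,
        Polynomial.aeval_X, Polynomial.aeval_C]
      exact hsub a _ ih
  have hsp : (Submodule.span ℂ (Set.range fun n : ℤ => (U ^ n) g) : Set H) ⊆
      closure (generators U g) := by
    intro v hv
    obtain ⟨N, p, hp⟩ := exists_zpow_eq_aeval U hv
    -- The vector is, up to a power of `U` and a scalar, a product of factors U - a applied to `g`.
    -- Moving the roots slightly off the unit circle makes each factor preserve the generators.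
    rw [(IsAlgClosed.splits p).eq_prod_roots, map_mul, Polynomial.aeval_C] at hp
    have := hpow (-(N : ℤ)) _ (hsmul p.leadingCoeff _ (hpoly p.roots))
    have e : (U ^ (N : ℤ)) v = p.leadingCoeff • (Polynomial.aeval (U.toLinearEquiv : H →ₗ[ℂ] H)
      (p.roots.map fun a => Polynomial.X - Polynomial.C a).prod g) := hp
    rwa [← e, ← zpow_add_apply, neg_add_cancel, zpow_zero] at this
  exact closure_minimal hsp isClosed_closure hv

/-- If the space is the closure of the union of an increasing sequence of cyclic subspaces,
then there is a cyclic vector. -/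
theorem hasSimpleSpectrum_of_increasing (U : H ≃ₗᵢ[ℂ] H) (g : ℕ → H)
    (hinc : ∀ j, g j ∈ cyc U (g (j + 1)))
    (hd : (⨆ j, cyc U (g j)).topologicalClosure = ⊤) : HasSimpleSpectrum U := by
  have hmono : Monotone fun j => cyc U (g j) := monotone_nat_of_le_succ fun j => cyc_le_cyc U (hinc j)
  -- Baire category: `O (j, k)` consists of the vectors for which some combination of orbit points
  -- is within 1/(k+1) of `g j`. A vector in all of these open dense sets has every `g j` in its
  -- cyclic space.
  let O : ℕ × ℕ → Set H := fun q =>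
    ⋃ c : ℤ →₀ ℂ, {v : H | ‖(c.sum fun i a => a • (U ^ i) v) - g q.1‖ < 1 / ((q.2 : ℝ) + 1)}
  have hO : ∀ q, IsOpen (O q) := fun q => by
    refine isOpen_iUnion fun c => isOpen_lt ?_ continuous_const
    unfold Finsupp.sum
    refine (Continuous.sub ?_ continuous_const).norm
    exact continuous_finsetSum _ fun i _ => ((U ^ i).continuous.const_smul _)
  have hmemO : ∀ q v, g q.1 ∈ cyc U v → v ∈ O q := fun q v hv => by
    have hv' : g q.1 ∈ closure (Submodule.span ℂ (Set.range fun n : ℤ => (U ^ n) v) : Set H) := hv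
    obtain ⟨x, hx, hxd⟩ := Metric.mem_closure_iff.1 hv' (1 / ((q.2 : ℝ) + 1)) (by positivity)
    obtain ⟨c, rfl⟩ := (Finsupp.mem_span_range_iff_exists_finsupp).1 hx
    refine Set.mem_iUnion.2 ⟨c, ?_⟩
    rwa [dist_comm, dist_eq_norm] at hxd
  have hOmem : ∀ q v, v ∈ O q →
      ∃ c : ℤ →₀ ℂ, ‖(c.sum fun i a => a • (U ^ i) v) - g q.1‖ < 1 / ((q.2 : ℝ) + 1) :=
    fun q v hv => by simpa only [O, Set.mem_iUnion, Set.mem_ofPred_eq] using hv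
  clear_value O
  have hdense : ∀ q, Dense (O q) := fun q => by
    have h1 : ((⨆ j, cyc U (g j) : Submodule ℂ H) : Set H) ⊆ closure (O q) := by
      rw [Submodule.coe_iSup_of_directed _ hmono.directed_le]
      -- Passing to the larger of the two indices, `v` is approximated by generators of a cyclic
      -- space that also contains `g q.1`, and such generators lie in `O q`.
      refine Set.iUnion_subset fun j v hv => ?_
      have hv' : v ∈ cyc U (g (max j q.1)) := hmono (le_max_left _ _) hv
      refine closure_mono ?_ (mem_closure_generators U hv')
      intro w hw
      rw [mem_generators] at hw
      have h2 : g q.1 ∈ cyc U (g (max j q.1)) :=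
        hmono (le_max_right j q.1) (self_mem_cyc U (g q.1))
      exact hmemO q w (cyc_le_cyc U hw h2)
    intro v
    have hv : v ∈ closure ((⨆ j, cyc U (g j) : Submodule ℂ H) : Set H) := by
      rw [← Submodule.topologicalClosure_coe, hd]; trivial
    exact closure_minimal h1 isClosed_closure hv
  obtain ⟨f, hf⟩ := (dense_iInter_of_isOpen (f := O) hO hdense).nonempty
  refine ⟨f, ?_⟩
  change cyc U f = ⊤
  have hg : ∀ j, g j ∈ cyc U f := fun j => by
    change g j ∈ closure (Submodule.span ℂ (Set.range fun n : ℤ => (U ^ n) f) : Set H)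
    refine Metric.mem_closure_iff.2 fun ε hε => ?_
    obtain ⟨k, hk⟩ := exists_nat_one_div_lt hε
    obtain ⟨c, hc⟩ := hOmem _ _ (Set.mem_iInter.1 hf (j, k))
    refine ⟨_, (Finsupp.mem_span_range_iff_exists_finsupp).2 ⟨c, rfl⟩, ?_⟩
    rw [dist_comm, dist_eq_norm]
    exact lt_trans hc hk
  rw [eq_top_iff, ← hd]
  exact Submodule.topologicalClosure_minimal _ (iSup_le fun j => cyc_le_cyc U (hg j))
    (isClosed_cyc U f)

end Cyclic

/-! ### Lebesgue spectrum from orthonormal orbits. -/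

section Lebesgue
variable {H : Type*} [NormedAddCommGroup H] [InnerProductSpace ℂ H] [CompleteSpace H]

/-- The isometry `L²(𝕋) → H` with `e^{2πint} ↦ Uⁿ e`, for an orthonormal orbit of `e`. -/
def orbitIsometry (U : H ≃ₗᵢ[ℂ] H) (e : H) (he : Orthonormal ℂ fun n : ℤ => (U ^ n) e) :
    Lp ℂ 2 (AddCircle.haarAddCircle : Measure UnitAddCircle) →ₗᵢ[ℂ] H :=
  he.orthogonalFamily.linearIsometry.comp fourierBasis.repr.toLinearIsometry

theorem orbitIsometry_fourierLp (U : H ≃ₗᵢ[ℂ] H) (e : H)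
    (he : Orthonormal ℂ fun n : ℤ => (U ^ n) e) (n : ℤ) :
    orbitIsometry U e he (fourierLp 2 n) = (U ^ n) e := by
  have h : fourierBasis.repr (fourierLp (T := 1) 2 n) = lp.single 2 n (1 : ℂ) := by
    rw [← coe_fourierBasis, HilbertBasis.repr_self]
  change he.orthogonalFamily.linearIsometry (fourierBasis.repr (fourierLp 2 n)) = _
  rw [h, OrthogonalFamily.linearIsometry_apply_single]
  simp

theorem inner_orbitIsometry_eq_zero (U : H ≃ₗᵢ[ℂ] H) (e : H)
    (he : Orthonormal ℂ fun n : ℤ => (U ^ n) e) (v : H)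
    (hv : ∀ n : ℤ, inner ℂ v ((U ^ n) e) = 0)
    (x : Lp ℂ 2 (AddCircle.haarAddCircle : Measure UnitAddCircle)) :
    inner ℂ v (orbitIsometry U e he x) = 0 := by
  have h := (he.orthogonalFamily.hasSum_linearIsometry (fourierBasis.repr x)).mapL (innerSL ℂ v)
  have h0 : ∀ n : ℤ, innerSL ℂ v (LinearIsometry.toSpanSingleton ℂ H (he.1 n)
      (fourierBasis.repr x n)) = 0 := fun n => by
    simp [hv n]
  simp_rw [h0] at h
  exact h.unique hasSum_zero

/-- Multiplication by the coordinate shifts Fourier coefficients by one; this is compared below with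
the action of `U` on the orbits `Uⁿ e_k`. -/
theorem inner_fourierLp_toLp_mul (n : ℤ)
    (g : Lp ℂ 2 (AddCircle.haarAddCircle : Measure UnitAddCircle))
    (hg : MemLp (fun t => fourier 1 t * g t) 2 AddCircle.haarAddCircle) :
    inner ℂ (fourierLp 2 n) (hg.toLp _) = inner ℂ (fourierLp 2 (n - 1)) g := by
  rw [L2.inner_def, L2.inner_def]
  refine integral_congr_ae ?_
  filter_upwards [coeFn_fourierLp (T := 1) 2 n, coeFn_fourierLp (T := 1) 2 (n - 1), hg.coeFn_toLp]
    with t h1 h2 h3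
  rw [h1, h2, h3, RCLike.inner_apply, RCLike.inner_apply, ← fourier_neg, ← fourier_neg,
    neg_sub, sub_eq_add_neg, fourier_add]
  ring

/-- A unitary operator with a complete orthonormal system of the form `Uⁿ e_k` has countable
Lebesgue spectrum. -/
theorem hasCountableLebesgueSpectrum_of_orthonormal (U : H ≃ₗᵢ[ℂ] H) (e : ℕ → H)
    (ho : Orthonormal ℂ fun p : ℕ × ℤ => (U ^ p.2) (e p.1))
    (ht : ∀ f : H, (∀ k, ∀ n : ℤ, inner ℂ ((U ^ n) (e k)) f = 0) → f = 0) :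
    HasCountableLebesgueSpectrum U := by
  have hok : ∀ k, Orthonormal ℂ fun n : ℤ => (U ^ n) (e k) := fun k =>
    ho.comp (fun n : ℤ => (k, n)) fun a b h => (Prod.ext_iff.1 h).2
  let V : (k : ℕ) → Lp ℂ 2 (AddCircle.haarAddCircle : Measure UnitAddCircle) →ₗᵢ[ℂ] H :=
    fun k => orbitIsometry U (e k) (hok k)
  have hVo : OrthogonalFamily ℂ
      (fun _ : ℕ => Lp ℂ 2 (AddCircle.haarAddCircle : Measure UnitAddCircle)) V := by
    intro k l hkl x y
    refine inner_orbitIsometry_eq_zero U (e l) (hok l) _ (fun n => ?_) y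
    rw [inner_eq_zero_symm]
    refine inner_orbitIsometry_eq_zero U (e k) (hok k) _ (fun m => ?_) x
    exact ho.2 (i := (l, n)) (j := (k, m)) (fun h => hkl (Prod.ext_iff.1 h).1.symm)
  have hV : IsHilbertSum ℂ
      (fun _ : ℕ => Lp ℂ 2 (AddCircle.haarAddCircle : Measure UnitAddCircle)) V := by
    refine IsHilbertSum.mk hVo ?_
    rw [top_le_iff, Submodule.topologicalClosure_eq_top_iff, Submodule.eq_bot_iff]
    intro f hf
    refine ht f fun k n => ?_
    refine hf _ (Submodule.mem_iSup_of_mem k ⟨fourierLp 2 n, ?_⟩)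
    exact orbitIsometry_fourierLp U (e k) (hok k) n
  have hinner : ∀ (k : ℕ) (n : ℤ) (f : H),
      inner ℂ (fourierLp 2 n) (hV.linearIsometryEquiv f k) = inner ℂ ((U ^ n) (e k)) f := by
    intro k n f
    refine (lp.inner_single_left (𝕜 := ℂ)
      (G := fun _ : ℕ => Lp ℂ 2 (AddCircle.haarAddCircle : Measure UnitAddCircle))
      k (fourierLp 2 n) (hV.linearIsometryEquiv f)).symm.trans ?_
    rw [← hV.linearIsometryEquiv.symm.inner_map_map,
      LinearIsometryEquiv.symm_apply_apply, IsHilbertSum.linearIsometryEquiv_symm_apply_single]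
    congr 1
    exact orbitIsometry_fourierLp U (e k) (hok k) n
  refine ⟨hV.linearIsometryEquiv, fun f k => ?_⟩
  set g := hV.linearIsometryEquiv f k with hg
  have hM : MemLp (fun t => fourier 1 t * g t) 2
      (AddCircle.haarAddCircle : Measure UnitAddCircle) := by
    refine (Lp.memLp g).of_le
      ((fourier 1).continuous.aestronglyMeasurable.mul (Lp.aestronglyMeasurable g)) ?_
    refine Filter.Eventually.of_forall fun t => ?_
    rw [norm_mul, fourier_apply, Circle.norm_coe, one_mul]
  have key : hV.linearIsometryEquiv (U f) k = hM.toLp _ := by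
    apply fourierBasis.repr.injective
    ext n
    rw [HilbertBasis.repr_apply_apply, HilbertBasis.repr_apply_apply, coe_fourierBasis, hinner,
      inner_fourierLp_toLp_mul, hg, hinner]
    have := inner_zpow_zpow U (e k) f n 1
    rw [zpow_one] at this
    rw [this]
    have h2 := inner_zpow_zpow U (e k) f (n - 1) 0
    rw [zpow_zero] at h2
    rw [show inner ℂ ((U ^ (n - 1)) (e k)) f = inner ℂ ((U ^ (n - 1)) (e k))
      ((1 : H ≃ₗᵢ[ℂ] H) f) from rfl, h2]
    congr 3; ring
  rw [key]
  exact hM.coeFn_toLp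

end Lebesgue

/-! ### Dissipative transformations have countable Lebesgue spectrum. -/

section Wandering
open Filter Topology
variable {Y : Type*} [MeasurableSpace Y] {ν : Measure Y}

theorem measurable_perm_zpow (S : Y ≃ᵐ Y) (n : ℤ) :
    Measurable ((S.toEquiv ^ n : Equiv.Perm Y) : Y → Y) := by
  induction n using Int.induction_on with
  | zero => exact measurable_id
  | succ n ih => rw [zpow_add_one]; exact ih.comp S.measurable
  | pred n ih => rw [zpow_sub_one]; exact ih.comp S.symm.measurable

theorem measurePreserving_perm_zpow (S : Y ≃ᵐ Y) (hS : MeasurePreserving S ν ν) (n : ℤ) :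
    MeasurePreserving ((S.toEquiv ^ n : Equiv.Perm Y) : Y → Y) ν ν := by
  induction n using Int.induction_on with
  | zero => exact MeasurePreserving.id ν
  | succ n ih => rw [zpow_add_one]; exact ih.comp hS
  | pred n ih => rw [zpow_sub_one]; exact ih.comp (hS.symm S)

theorem coeFn_koopman (S : Y ≃ᵐ Y) (hS : MeasurePreserving S ν ν) (f : Lp ℂ 2 ν) :
    (koopman S hS f : Y → ℂ) =ᵐ[ν] f ∘ S :=
  Lp.coeFn_compMeasurePreserving f hS

theorem coeFn_koopman_zpow (S : Y ≃ᵐ Y) (hS : MeasurePreserving S ν ν) (n : ℤ) (f : Lp ℂ 2 ν) :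
    (((koopman S hS) ^ n) f : Y → ℂ) =ᵐ[ν] f ∘ (S.toEquiv ^ n : Equiv.Perm Y) := by
  induction n using Int.induction_on with
  | zero => rfl
  | succ n ih =>
    have h1 : ((koopman S hS) ^ ((n : ℤ) + 1)) f = koopman S hS (((koopman S hS) ^ (n : ℤ)) f) := by
      rw [add_comm, zpow_add_apply, zpow_one]
    rw [h1, zpow_add_one]
    refine (coeFn_koopman S hS _).trans ?_
    exact hS.quasiMeasurePreserving.ae_eq_comp ih
  | pred n ih =>
    have h1 : koopman S hS (((koopman S hS) ^ (-(n : ℤ) - 1)) f) =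
        ((koopman S hS) ^ (-(n : ℤ))) f := by
      have := zpow_add_apply (koopman S hS) f 1 (-(n : ℤ) - 1)
      rw [zpow_one] at this
      rw [← this]; congr 2; ring
    have h2 := coeFn_koopman S hS (((koopman S hS) ^ (-(n : ℤ) - 1)) f)
    rw [h1] at h2
    have h3 := (hS.symm S).quasiMeasurePreserving.ae_eq_comp (h2.symm.trans ih)
    filter_upwards [h3] with x hx
    rw [Function.comp_apply, Function.comp_apply, MeasurableEquiv.apply_symm_apply] at hx
    rw [hx, Function.comp_apply, zpow_sub_one]
    rfl

/-- Successive differences of a decreasing chain obtained by repeated splitting, trimmed to finite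
measure. The normalizable indicators of these sets show that L²(W) is infinite-dimensional. -/
theorem exists_disjoint_seq [SigmaFinite ν] {W : Set Y} (hW : MeasurableSet W) (h0 : 0 < ν W)
    (hsplit : ∀ A ⊆ W, MeasurableSet A → 0 < ν A →
      ∃ B ⊆ A, MeasurableSet B ∧ 0 < ν B ∧ 0 < ν (A \ B)) :
    ∃ C : ℕ → Set Y, (∀ n, MeasurableSet (C n)) ∧ (∀ n, C n ⊆ W) ∧ (∀ n, 0 < ν (C n)) ∧
      (∀ n, ν (C n) < ⊤) ∧ Pairwise fun i j => Disjoint (C i) (C j) := by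
  let 𝒜 := {A : Set Y // A ⊆ W ∧ MeasurableSet A ∧ 0 < ν A}
  have hs : ∀ A : 𝒜, ∃ B : 𝒜, B.1 ⊆ A.1 ∧ 0 < ν (A.1 \ B.1) := fun A => by
    obtain ⟨B, hBA, hB, hB0, hAB⟩ := hsplit A.1 A.2.1 A.2.2.1 A.2.2.2
    exact ⟨⟨B, hBA.trans A.2.1, hB, hB0⟩, hBA, hAB⟩
  choose β hβ hβ0 using hs
  let A : ℕ → 𝒜 := fun n => β^[n] ⟨W, subset_rfl, hW, h0⟩
  have hA : ∀ n, A (n + 1) = β (A n) := fun n => Function.iterate_succ_apply' _ _ _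
  have hanti : Antitone fun n => (A n).1 := antitone_nat_of_succ_le fun n => by
    rw [hA]; exact hβ _
  have hfin : ∀ n, ∃ t, MeasurableSet t ∧ t ⊆ (A n).1 \ (A (n + 1)).1 ∧ 0 < ν t ∧ ν t < ⊤ :=
    fun n => by
    have h1 : 0 < ν ((A n).1 \ (A (n + 1)).1) := by rw [hA]; exact hβ0 _
    exact Measure.exists_subset_measure_lt_top ((A n).2.2.1.diff (A (n + 1)).2.2.1) h1
  choose C hC hCs hC0 hCf using hfin
  refine ⟨C, hC, fun n => ((hCs n).trans Set.sdiff_subset).trans (A n).2.1, hC0, hCf, ?_⟩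
  have key : ∀ i j, i < j → Disjoint (C i) (C j) := fun i j hij => by
    rw [Set.disjoint_left]
    intro x hx hx'
    exact (hCs i hx).2 (hanti (Nat.succ_le_of_lt hij) (hCs j hx').1)
  intro i j hij
  rcases lt_or_gt_of_ne hij with h | h
  · exact key i j h
  · exact (key j i h).symm

/-- The subspace of `L²` functions vanishing outside of `W`. -/
def supportedOn (ν : Measure Y) (W : Set Y) : Submodule ℂ (Lp ℂ 2 ν) :=
  (LpToLpRestrictCLM Y ℂ ℂ ν 2 Wᶜ).ker

theorem mem_supportedOn {W : Set Y} (hW : MeasurableSet W) {f : Lp ℂ 2 ν} :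
    f ∈ supportedOn ν W ↔ ∀ᵐ x ∂ν, x ∉ W → f x = 0 := by
  rw [supportedOn, LinearMap.mem_ker]
  change LpToLpRestrictCLM Y ℂ ℂ ν 2 Wᶜ f = 0 ↔ _
  have h := LpToLpRestrictCLM_coeFn ℂ Wᶜ f (p := 2)
  have h2 : (∀ᵐ x ∂ν, x ∉ W → f x = 0) ↔ (f : Y → ℂ) =ᵐ[ν.restrict Wᶜ] 0 := by
    rw [EventuallyEq, ae_restrict_iff' hW.compl]; rfl
  rw [h2, Lp.eq_zero_iff_ae_eq_zero]
  exact ⟨fun h3 => h.symm.trans h3, fun h3 => h.trans h3⟩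

theorem isClosed_supportedOn (W : Set Y) : IsClosed (supportedOn ν W : Set (Lp ℂ 2 ν)) :=
  ContinuousLinearMap.isClosed_ker _

theorem orthonormal_countable {K : Type*} [NormedAddCommGroup K] [InnerProductSpace ℂ K]
    [SecondCountableTopology K] {ι : Type*} {v : ι → K} (hv : Orthonormal ℂ v) : Countable ι := by
  have hd : ∀ i j, i ≠ j → 1 ≤ dist (v i) (v j) := fun i j hij => by
    have h1 : ‖v i - v j‖ ^ 2 = 2 := by
      have := norm_sub_sq (𝕜 := ℂ) (v i) (v j)
      rw [hv.2 hij, hv.1 i, hv.1 j] at this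
      norm_num at this
      exact this
    rw [dist_eq_norm]
    nlinarith [norm_nonneg (v i - v j)]
  refine Pairwise.countable_of_isOpen_disjoint (s := fun i => Metric.ball (v i) (1 / 2)) ?_
    (fun i => Metric.isOpen_ball) (fun i => ⟨v i, Metric.mem_ball_self (by norm_num)⟩)
  intro i j hij
  exact Metric.ball_disjoint_ball (by have := hd i j hij; linarith)

/-- A Hilbert basis is countable by separability and infinite because the orthogonal sequence `u` is
linearly independent, so it can be indexed by ℕ. -/
theorem exists_orthonormal_nat {K : Type*} [NormedAddCommGroup K] [InnerProductSpace ℂ K]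
    [CompleteSpace K] [SecondCountableTopology K] {u : ℕ → K} (hu : ∀ n, u n ≠ 0)
    (ho : Pairwise fun i j => inner ℂ (u i) (u j) = 0) :
    ∃ e : ℕ → K, Orthonormal ℂ e ∧ ∀ f, (∀ k, inner ℂ (e k) f = 0) → f = 0 := by
  obtain ⟨w, b, hb⟩ := exists_hilbertBasis ℂ K
  have hcount : Countable w := orthonormal_countable b.orthonormal
  have hinf : Infinite w := by
    by_contra hfin
    rw [not_infinite_iff_finite] at hfin
    have := Fintype.ofFinite w
    have hfd : FiniteDimensional ℂ K := Module.Finite.of_basis b.toOrthonormalBasis.toBasis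
    have hli : LinearIndependent ℂ u := linearIndependent_of_ne_zero_of_inner_eq_zero hu ho
    exact (Module.Finite.not_linearIndependent_of_infinite u) hli
  obtain ⟨φ⟩ : Nonempty (ℕ ≃ w) := nonempty_equiv_of_countable
  refine ⟨b ∘ φ, b.orthonormal.comp φ φ.injective, fun f hf => ?_⟩
  apply b.repr.injective
  ext i
  rw [HilbertBasis.repr_apply_apply, map_zero]
  have := hf (φ.symm i)
  simpa using this

/-- The Koopman operator of a dissipative transformation with a non-atomic wandering set
has countable Lebesgue spectrum. -/
theorem hasCountableLebesgueSpectrum_of_wandering [SigmaFinite ν]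
    [SecondCountableTopology (Lp ℂ 2 ν)] (S : Y ≃ᵐ Y) (hS : MeasurePreserving S ν ν)
    (W : Set Y) (hW : MeasurableSet W) (h0 : ν Set.univ ≠ 0)
    (hsplit : ∀ A : Set Y, MeasurableSet A → 0 < ν A →
      ∃ B ⊆ A, MeasurableSet B ∧ 0 < ν B ∧ 0 < ν (A \ B))
    (hdisj : ∀ n : ℤ, n ≠ 0 → ∀ x ∈ W, (S.toEquiv ^ n : Equiv.Perm Y) x ∉ W)
    (hcov : ∀ᵐ x ∂ν, ∃ n : ℤ, (S.toEquiv ^ n : Equiv.Perm Y) x ∈ W) :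
    HasCountableLebesgueSpectrum (koopman S hS) := by
  have hWpos : 0 < ν W := by
    rw [pos_iff_ne_zero]
    intro hW0
    have h1 : ∀ᵐ x ∂ν, ∀ n : ℤ, (S.toEquiv ^ n : Equiv.Perm Y) x ∉ W := ae_all_iff.2 fun n => by
      have h2 : ∀ᵐ x ∂ν, x ∉ W := measure_eq_zero_iff_ae_notMem.1 hW0
      exact (measurePreserving_perm_zpow S hS n).quasiMeasurePreserving.ae h2
    have h3 : ∀ᵐ x ∂ν, False := by
      filter_upwards [h1, hcov] with x hx ⟨n, hn⟩ using hx n hn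
    exact h0 (by simpa [ae_iff] using h3)
  obtain ⟨C, hC, hCW, hC0, hCf, hCd⟩ := exists_disjoint_seq hW hWpos fun A _ => hsplit A
  let K := supportedOn ν W
  have hKc : CompleteSpace K := (isClosed_supportedOn W).completeSpace_coe
  have hu : ∀ n, indicatorConstLp 2 (hC n) (hCf n).ne (1 : ℂ) ∈ K := fun n => by
    rw [mem_supportedOn hW]
    filter_upwards [indicatorConstLp_coeFn (p := 2) (hs := hC n) (hμs := (hCf n).ne) (c := (1 : ℂ))]
      with x hx hxW
    rw [hx, Set.indicator_of_notMem fun h => hxW (hCW n h)]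
  obtain ⟨e, he, het⟩ := exists_orthonormal_nat (K := K) (u := fun n => ⟨_, hu n⟩)
    (fun n hn => by
      have hn' : indicatorConstLp 2 (hC n) (hCf n).ne (1 : ℂ) = 0 := congrArg Subtype.val hn
      have h2 : ‖indicatorConstLp 2 (hC n) (hCf n).ne (1 : ℂ)‖ = 0 := by rw [hn', norm_zero]
      rw [norm_indicatorConstLp (by norm_num) (by norm_num)] at h2
      have h3 : 0 < ν.real (C n) := ENNReal.toReal_pos (hC0 n).ne' (hCf n).ne
      have h4 : 0 < ν.real (C n) ^ (1 / (2 : ENNReal).toReal) := Real.rpow_pos_of_pos h3 _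
      simp at h2
      exact absurd h2 (by simpa using h4.ne'))
    (fun i j hij => by
      change inner ℂ (indicatorConstLp 2 (hC i) (hCf i).ne (1 : ℂ))
        (indicatorConstLp 2 (hC j) (hCf j).ne (1 : ℂ)) = 0
      rw [L2.inner_indicatorConstLp_indicatorConstLp (hμs := (hCf i).ne) (hμt := (hCf j).ne),
        (hCd hij).inter_eq]
      simp)
  have hsupp : ∀ k, ∀ᵐ x ∂ν, x ∉ W → (e k : Lp ℂ 2 ν) x = 0 := fun k =>
    (mem_supportedOn hW).1 (e k).2
  refine hasCountableLebesgueSpectrum_of_orthonormal _ (fun k => (e k : Lp ℂ 2 ν)) ?_ ?_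
  · refine ⟨fun p => ?_, fun p q hpq => ?_⟩
    · rw [LinearIsometryEquiv.norm_map]; exact he.1 p.1
    · simp only
      rw [inner_zpow_zpow]
      -- For equal powers this is orthonormality in L²(W); for different powers the supports lie in
      -- disjoint translates of `W`.
      by_cases hn : q.2 - p.2 = 0
      · rw [hn, zpow_zero]
        refine he.2 (i := p.1) (j := q.1) fun h => hpq (Prod.ext h ?_)
        omega
      · rw [L2.inner_def]
        refine integral_eq_zero_of_ae ?_
        filter_upwards [hsupp p.1, (measurePreserving_perm_zpow S hS
          (q.2 - p.2)).quasiMeasurePreserving.ae (hsupp q.1),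
          coeFn_koopman_zpow S hS (q.2 - p.2) (e q.1)] with x h1 h2 h3
        by_cases hx : x ∈ W
        · rw [h3, Function.comp_apply, h2 (hdisj _ hn x hx), inner_zero_right]; rfl
        · rw [h1 hx, inner_zero_left]; rfl
  · intro f hf
    -- Each translate of `f`, cut down to `W`, is orthogonal to a basis of L²(W). Since the
    -- translates of `W` cover almost everything, `f` vanishes.
    have hzero : ∀ n : ℤ, ∀ᵐ x ∂ν, x ∈ W → (((koopman S hS) ^ n) f : Lp ℂ 2 ν) x = 0 := by
      intro n
      set F : Lp ℂ 2 ν := ((koopman S hS) ^ n) f with hF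
      have hm : MemLp (W.indicator F) 2 ν := (Lp.memLp F).indicator hW
      have hmK : hm.toLp _ ∈ K := by
        rw [mem_supportedOn hW]
        filter_upwards [hm.coeFn_toLp] with x hx hxW
        rw [hx, Set.indicator_of_notMem hxW]
      have h1 : (⟨hm.toLp _, hmK⟩ : K) = 0 := by
        refine het _ fun k => ?_
        change inner ℂ (e k : Lp ℂ 2 ν) (hm.toLp _) = 0
        have h2 : inner ℂ (e k : Lp ℂ 2 ν) (hm.toLp _) = inner ℂ (e k : Lp ℂ 2 ν) F := by
          rw [L2.inner_def, L2.inner_def]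
          refine integral_congr_ae ?_
          filter_upwards [hsupp k, hm.coeFn_toLp] with x h3 h4
          by_cases hx : x ∈ W
          · rw [h4, Set.indicator_of_mem hx]
          · rw [h3 hx, inner_zero_left, inner_zero_left]
        have h5 := inner_zpow_zpow (koopman S hS) (e k : Lp ℂ 2 ν) f (-n) 0
        rw [zero_sub, neg_neg] at h5
        rw [h2, hF, ← h5, zpow_zero]
        exact hf k (-n)
      have h2 : hm.toLp _ = 0 := congrArg Subtype.val h1
      rw [Lp.eq_zero_iff_ae_eq_zero] at h2
      filter_upwards [h2, hm.coeFn_toLp] with x h3 h4 hx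
      rw [h3] at h4
      rw [Set.indicator_of_mem hx] at h4
      exact h4.symm
    rw [Lp.eq_zero_iff_ae_eq_zero]
    have h1 : ∀ᵐ x ∂ν, ∀ n : ℤ, (S.toEquiv ^ n : Equiv.Perm Y) x ∈ W → f x = 0 := by
      refine ae_all_iff.2 fun n => ?_
      filter_upwards [(measurePreserving_perm_zpow S hS n).quasiMeasurePreserving.ae (hzero (-n)),
        (measurePreserving_perm_zpow S hS n).quasiMeasurePreserving.ae
          (coeFn_koopman_zpow S hS (-n) f)] with x h2 h3 hx
      rw [h2 hx, Function.comp_apply, ← Equiv.Perm.mul_apply, ← zpow_add, neg_add_cancel,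
        zpow_zero] at h3
      exact h3.symm
    filter_upwards [h1, hcov] with x hx ⟨n, hn⟩ using hx n hn

/-- If almost every orbit meets one of the sets `A i` and a.e. return times to each `A i` are
bounded, then the Koopman operator has countable Lebesgue spectrum. -/
theorem hasCountableLebesgueSpectrum_of_bounded_returns [SigmaFinite ν]
    [SecondCountableTopology (Lp ℂ 2 ν)] (S : Y ≃ᵐ Y) (hS : MeasurePreserving S ν ν)
    (h0 : ν Set.univ ≠ 0)
    (hsplit : ∀ A : Set Y, MeasurableSet A → 0 < ν A →
      ∃ B ⊆ A, MeasurableSet B ∧ 0 < ν B ∧ 0 < ν (A \ B))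
    (A : ℕ → Set Y) (hA : ∀ i, MeasurableSet (A i)) (hcov : ∀ᵐ x ∂ν, ∃ i, x ∈ A i)
    (hret : ∀ i, ∃ N : ℤ, ∀ n ≥ N, ∀ᵐ x ∂ν, x ∈ A i → (S.toEquiv ^ n : Equiv.Perm Y) x ∉ A i) :
    HasCountableLebesgueSpectrum (koopman S hS) := by
  choose N hN using hret
  let P : ℤ → Y → Y := fun n => (S.toEquiv ^ n : Equiv.Perm Y)
  have hPP : ∀ m n x, P m (P n x) = P (m + n) x := fun m n x => by
    simp only [P]; rw [zpow_add, Equiv.Perm.mul_apply]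
  have hP0 : ∀ x, P 0 x = x := fun x => by simp [P]
  -- `W` picks one point from each orbit: its last visit to `A i`, where `i` is the smallest index
  -- of a set that the orbit meets.
  let W : Set Y := ⋃ i, A i ∩ ((⋂ n : ℤ, ⋂ _ : 0 < n, P n ⁻¹' (A i)ᶜ) ∩
    ⋂ j : ℕ, ⋂ _ : j < i, ⋂ n : ℤ, P n ⁻¹' (A j)ᶜ)
  have hWmem : ∀ x, x ∈ W ↔ ∃ i, x ∈ A i ∧ (∀ n : ℤ, 0 < n → P n x ∉ A i) ∧
      ∀ j < i, ∀ n : ℤ, P n x ∉ A j := fun x => by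
    simp [W]
  have hWm : MeasurableSet W := by
    refine MeasurableSet.iUnion fun i => (hA i).inter (MeasurableSet.inter ?_ ?_)
    · exact MeasurableSet.iInter fun n => MeasurableSet.iInter fun _ =>
        measurable_perm_zpow S n (hA i).compl
    · exact MeasurableSet.iInter fun j => MeasurableSet.iInter fun _ => MeasurableSet.iInter fun n =>
        measurable_perm_zpow S n (hA j).compl
  refine hasCountableLebesgueSpectrum_of_wandering S hS W hWm h0 hsplit ?_ ?_
  · intro n hn x hx hx'
    obtain ⟨i, hi, hi1, hi2⟩ := (hWmem x).1 hx
    obtain ⟨j, hj, hj1, hj2⟩ := (hWmem _).1 hx'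
    change P n x ∈ A j at hj
    change ∀ m : ℤ, 0 < m → P m (P n x) ∉ A j at hj1
    change ∀ i < j, ∀ m : ℤ, P m (P n x) ∉ A i at hj2
    have hback : P (-n) (P n x) = x := by rw [hPP, neg_add_cancel, hP0]
    rcases lt_trichotomy i j with h | rfl | h
    · exact hj2 i h (-n) (by rwa [hback])
    · rcases lt_or_gt_of_ne hn with h' | h'
      · exact hj1 (-n) (by omega) (by rwa [hback])
      · exact hi1 n h' hj
    · exact hi2 j h n hj
  · have h1 : ∀ᵐ x ∂ν, ∀ i, ∀ m : ℤ, ∀ n ≥ N i, P m x ∈ A i → P n (P m x) ∉ A i := by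
      refine ae_all_iff.2 fun i => ae_all_iff.2 fun m => ae_all_iff.2 fun n => ?_
      by_cases hn : n ≥ N i
      · filter_upwards [(measurePreserving_perm_zpow S hS m).quasiMeasurePreserving.ae (hN i n hn)]
          with x hx _ using hx
      · exact Eventually.of_forall fun x h => absurd h hn
    filter_upwards [h1, hcov] with x hx ⟨i₀, hi₀⟩
    have hex : ∃ i, ∃ n, P n x ∈ A i := ⟨i₀, 0, by rwa [hP0]⟩
    classical
    let i := Nat.find hex
    obtain ⟨m, hm⟩ : ∃ n, P n x ∈ A i := Nat.find_spec hex
    have hmin : ∀ j < i, ∀ n, P n x ∉ A j := fun j hj n h => Nat.find_min hex hj ⟨n, h⟩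
    -- Bounded return times bound the visits from above, so a last visit exists.
    obtain ⟨M, hM, hMmax⟩ := Int.exists_greatest_of_bdd (P := fun n => P n x ∈ A i)
      ⟨m + N i, fun z hz => by
        by_contra hlt
        push Not at hlt
        refine hx i m (z - m) (by omega) hm ?_
        rw [hPP, sub_add_cancel]; exact hz⟩ ⟨m, hm⟩
    refine ⟨M, (hWmem _).2 ⟨i, hM, fun n hn h => ?_, fun j hj n h => ?_⟩⟩
    · change P n (P M x) ∈ A i at h
      rw [hPP] at h
      have := hMmax _ h
      omega
    · change P n (P M x) ∈ A j at h
      rw [hPP] at h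
      exact hmin j hj _ h

end Wandering

/-! ### Cutting and stacking: itineraries and the measures carried by the towers. -/

section Tower
open Filter Topology

/-- Cutting-and-stacking data: at stage `l` the tower of half-height `h l` is cut into four
columns placed at the positions `c l k` of the next tower. -/
structure IsTower (c : ℕ → Fin 4 → ℤ) (h : ℕ → ℤ) : Prop where
  nonneg : 0 ≤ h 0
  step : ∀ l k, |c l k| + h l + 1 ≤ h (l + 1)
  gap : ∀ l k k', k ≠ k' → 2 * h l < |c l k - c l k'|
  growth : ∀ l : ℕ, (l : ℤ) * 4 ^ l ≤ h l

/-- Position in tower `r` of the point with digits `ω` over the base of tower `i`. -/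
def digitSum (c : ℕ → Fin 4 → ℤ) (i r : ℕ) (ω : ℕ → Fin 4) : ℤ := ∑ l ∈ Finset.Ico i r, c l (ω l)

variable {c : ℕ → Fin 4 → ℤ} {h : ℕ → ℤ}

theorem digitSum_self (i : ℕ) (ω : ℕ → Fin 4) : digitSum c i i ω = 0 := by simp [digitSum]

theorem digitSum_succ {i r : ℕ} (hir : i ≤ r) (ω : ℕ → Fin 4) :
    digitSum c i (r + 1) ω = digitSum c i r ω + c r (ω r) :=
  Finset.sum_Ico_succ_top hir _

theorem digitSum_eq_add {i r : ℕ} (hir : i < r) (ω : ℕ → Fin 4) :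
    digitSum c i r ω = c i (ω i) + digitSum c (i + 1) r ω :=
  Finset.sum_eq_sum_Ico_succ_bot hir _

theorem digitSum_congr {i r : ℕ} {ω ω' : ℕ → Fin 4} (hω : ∀ l, i ≤ l → l < r → ω l = ω' l) :
    digitSum c i r ω = digitSum c i r ω' :=
  Finset.sum_congr rfl fun _ hl => by rw [hω _ (Finset.mem_Ico.1 hl).1 (Finset.mem_Ico.1 hl).2]

theorem digitSum_update_right (i r : ℕ) (ω : ℕ → Fin 4) (k : Fin 4) :
    digitSum c i r (Function.update ω r k) = digitSum c i r ω :=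
  digitSum_congr fun _ _ hl => Function.update_of_ne hl.ne _ _

theorem digitSum_update_left (i r : ℕ) (ω : ℕ → Fin 4) (k : Fin 4) :
    digitSum c (i + 1) r (Function.update ω i k) = digitSum c (i + 1) r ω :=
  digitSum_congr fun l hl _ => Function.update_of_ne (by omega) _ _

theorem IsTower.height_nonneg (ht : IsTower c h) (l : ℕ) : 0 ≤ h l :=
  le_trans (by positivity) (ht.growth l)

theorem IsTower.abs_digitSum_le (ht : IsTower c h) {i r : ℕ} (hir : i ≤ r) (ω : ℕ → Fin 4) :
    |digitSum c i r ω| ≤ h r - h i := by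
  induction r, hir using Nat.le_induction with
  | base => simp [digitSum_self]
  | succ r hir ih =>
    rw [digitSum_succ hir]
    have := ht.step r (ω r)
    have := abs_add_le (digitSum c i r ω) (c r (ω r))
    omega

/-- The highest stage with different digits dominates: `gap` there exceeds 2 h r, while the lower
digits change the difference by at most 2 (h r - h i). -/
theorem IsTower.digitSum_sub (ht : IsTower c h) {i r : ℕ} (hir : i ≤ r) (ω ω' : ℕ → Fin 4) :
    digitSum c i r ω = digitSum c i r ω' ∨ 2 * h i < |digitSum c i r ω - digitSum c i r ω'| := by
  induction r, hir using Nat.le_induction with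
  | base => simp [digitSum_self]
  | succ r hir ih =>
    rw [digitSum_succ hir, digitSum_succ hir]
    rcases eq_or_ne (ω r) (ω' r) with he | he
    · rw [he]; simpa using ih
    · right
      have h1 := ht.gap r _ _ he
      have h2 := abs_le.1 (ht.abs_digitSum_le hir ω)
      have h3 := abs_le.1 (ht.abs_digitSum_le hir ω')
      rw [lt_abs] at h1 ⊢
      omega

/-- `TowerRel c i j n a ω r`: at stage `r`, the point with digits `ω` at position `n` of tower `i`
is seen to be in the base of tower `j` after time `a`. -/
def TowerRel (c : ℕ → Fin 4 → ℤ) (i j : ℕ) (n a : ℤ) (ω : ℕ → Fin 4) (r : ℕ) : Prop :=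
  ∃ k, a + digitSum c j r k = n + digitSum c i r ω

/-- Both digit strings are extended by the same digits of `ω`, so a visit once seen stays visible at
later stages. -/
theorem TowerRel.mono {i j : ℕ} {n a : ℤ} {ω : ℕ → Fin 4} {r r' : ℕ} (hi : i ≤ r) (hj : j ≤ r)
    (hr : r ≤ r') (H : TowerRel c i j n a ω r) : TowerRel c i j n a ω r' := by
  induction r', hr using Nat.le_induction with
  | base => exact H
  | succ r' hr ih =>
    obtain ⟨k, hk⟩ := ih
    refine ⟨Function.update k r' (ω r'), ?_⟩
    rw [digitSum_succ (by omega), digitSum_succ (by omega), digitSum_update_right,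
      Function.update_self]
    omega

open Classical in
/-- The orbit itinerary (times of visits to the bases of all towers) of the point with digits `ω`
at position `n` of tower `i`. -/
def itinerary (c : ℕ → Fin 4 → ℤ) (i : ℕ) (n : ℤ) (ω : ℕ → Fin 4) : ℕ → ℤ → Bool :=
  fun j a => decide (∃ r, i ≤ r ∧ j ≤ r ∧ TowerRel c i j n a ω r)

theorem itinerary_eq_true {i j : ℕ} {n a : ℤ} {ω : ℕ → Fin 4} :
    itinerary c i n ω j a = true ↔ ∃ r, i ≤ r ∧ j ≤ r ∧ TowerRel c i j n a ω r := by
  simp [itinerary]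

theorem itinerary_self (i : ℕ) (n : ℤ) (ω : ℕ → Fin 4) : itinerary c i n ω i n = true :=
  itinerary_eq_true.2 ⟨i, le_rfl, le_rfl, ω, rfl⟩

theorem itinerary_split (i j : ℕ) (n a : ℤ) (ω : ℕ → Fin 4) :
    itinerary c i n ω j a = true ↔ ∃ k, itinerary c i n ω (j + 1) (a + c j k) = true := by
  simp only [itinerary_eq_true]
  constructor
  · rintro ⟨r, hi, hj, H⟩
    obtain ⟨k, hk⟩ := H.mono (r' := r + 1) hi hj (by omega)
    refine ⟨k j, r + 1, by omega, by omega, k, ?_⟩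
    rw [add_assoc, ← digitSum_eq_add (show j < r + 1 by omega) k, hk]
  · rintro ⟨k₀, r, hi, hj, k, hk⟩
    refine ⟨r, hi, by omega, Function.update k j k₀, ?_⟩
    rw [← hk, digitSum_eq_add (show j < r by omega), digitSum_update_left, Function.update_self]; ring

theorem IsTower.itinerary_gap (ht : IsTower c h) {i j : ℕ} {n a b : ℤ} {ω : ℕ → Fin 4}
    (ha : itinerary c i n ω j a = true) (hb : itinerary c i n ω j b = true) (hab : a ≠ b) :
    2 * h j < |a - b| := by
  obtain ⟨r, hi, hj, H⟩ := itinerary_eq_true.1 ha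
  obtain ⟨r', hi', hj', H'⟩ := itinerary_eq_true.1 hb
  obtain ⟨k, hk⟩ := H.mono hi hj (le_max_left r r')
  obtain ⟨k', hk'⟩ := H'.mono hi' hj' (le_max_right r r')
  rcases ht.digitSum_sub (le_max_of_le_left hj : j ≤ max r r') k k' with h1 | h1
  · omega
  · rw [abs_sub_comm a b]
    convert h1 using 2
    omega

theorem itinerary_next (i : ℕ) (n : ℤ) (ω : ℕ → Fin 4) :
    itinerary c i n ω = itinerary c (i + 1) (n + c i (ω i)) ω := by
  funext j a
  rw [Bool.eq_iff_iff, itinerary_eq_true, itinerary_eq_true]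
  constructor
  · rintro ⟨r, hi, hj, H⟩
    obtain ⟨k, hk⟩ := H.mono (r' := r + 1) hi hj (by omega)
    refine ⟨r + 1, by omega, by omega, k, ?_⟩
    rw [hk, digitSum_eq_add (show i < r + 1 by omega) ω]; ring
  · rintro ⟨r, hi, hj, k, hk⟩
    refine ⟨r, by omega, hj, k, ?_⟩
    rw [hk, digitSum_eq_add (show i < r by omega) ω]; ring

/-- From tower `i + 1` on, the digit `ω i` is already absorbed in the position `n`; hence it can be
resampled independently. -/
theorem itinerary_update (i : ℕ) (n : ℤ) (ω : ℕ → Fin 4) (k : Fin 4) :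
    itinerary c (i + 1) n (Function.update ω i k) = itinerary c (i + 1) n ω := by
  funext j a
  rw [Bool.eq_iff_iff, itinerary_eq_true, itinerary_eq_true]
  simp only [TowerRel, digitSum_update_left]

/-- The shift of itineraries. -/
def itineraryShift : (ℕ → ℤ → Bool) ≃ᵐ (ℕ → ℤ → Bool) where
  toFun x j a := x j (a + 1)
  invFun x j a := x j (a - 1)
  left_inv x := by funext j a; simp
  right_inv x := by funext j a; simp
  measurable_toFun := by
    refine measurable_pi_lambda _ fun j => measurable_pi_lambda _ fun a => ?_
    exact (measurable_pi_apply (a + 1)).comp (measurable_pi_apply j)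
  measurable_invFun := by
    refine measurable_pi_lambda _ fun j => measurable_pi_lambda _ fun a => ?_
    exact (measurable_pi_apply (a - 1)).comp (measurable_pi_apply j)

theorem itineraryShift_apply (x : ℕ → ℤ → Bool) (j : ℕ) (a : ℤ) :
    itineraryShift x j a = x j (a + 1) := rfl

theorem itineraryShift_itinerary (i : ℕ) (n : ℤ) (ω : ℕ → Fin 4) :
    itineraryShift (itinerary c i n ω) = itinerary c i (n - 1) ω := by
  funext j a
  rw [itineraryShift_apply, Bool.eq_iff_iff, itinerary_eq_true, itinerary_eq_true]
  refine exists_congr fun r => and_congr_right fun _ => and_congr_right fun _ =>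
    exists_congr fun k => ?_
  omega

theorem itineraryShift_symm_itinerary (i : ℕ) (n : ℤ) (ω : ℕ → Fin 4) :
    itineraryShift.symm (itinerary c i n ω) = itinerary c i (n + 1) ω := by
  rw [MeasurableEquiv.symm_apply_eq, itineraryShift_itinerary, add_sub_cancel_right]

theorem measurable_digitSum (i r : ℕ) : Measurable (digitSum c i r) := by
  unfold digitSum
  exact Finset.measurable_fun_sum _ fun l _ =>
    (measurable_of_countable (c l)).comp (measurable_pi_apply l)

theorem measurable_itinerary (i : ℕ) (n : ℤ) : Measurable (itinerary c i n) := by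
  refine measurable_pi_lambda _ fun j => measurable_pi_lambda _ fun a => ?_
  refine measurable_to_bool ?_
  have : (fun ω => itinerary c i n ω j a) ⁻¹' {true} =
      ⋃ r : ℕ, ⋃ _ : i ≤ r ∧ j ≤ r, (digitSum c i r) ⁻¹' {s | ∃ k, a + digitSum c j r k = n + s} := by
    ext ω
    simp only [Set.mem_preimage, Set.mem_singleton_iff, itinerary_eq_true, TowerRel,
      Set.mem_iUnion, Set.mem_ofPred_eq, exists_prop, and_assoc]
  rw [this]
  exact MeasurableSet.iUnion fun r => MeasurableSet.iUnion fun _ =>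
    measurable_digitSum i r (MeasurableSet.of_discrete)

/-- The uniform measure on four points. -/
def unif4 : Measure (Fin 4) := ∑ k : Fin 4, (4⁻¹ : ENNReal) • Measure.dirac k

theorem four_mul_inv : (4 : ENNReal) * 4⁻¹ = 1 := ENNReal.mul_inv_cancel (by norm_num) (by norm_num)

instance : IsProbabilityMeasure unif4 := ⟨by
  simp [unif4, Measure.finsetSum_apply, four_mul_inv]⟩

/-- The Bernoulli measure on digit sequences. -/
def digitMeasure : Measure (ℕ → Fin 4) := Measure.infinitePi fun _ => unif4

instance : IsProbabilityMeasure digitMeasure := by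
  unfold digitMeasure; infer_instance

theorem measurable_update_const (i : ℕ) (k : Fin 4) :
    Measurable fun ω : ℕ → Fin 4 => Function.update ω i k := by
  refine measurable_pi_lambda _ fun l => ?_
  by_cases hl : l = i
  · subst hl; simp
  · simp only [Function.update_of_ne hl]; exact measurable_pi_apply l

/-- Resampling one coordinate uniformly preserves the product measure. This is what cuts a level
into four equal parts in `levelLaw_eq_sum`. -/
theorem digitMeasure_eq_sum (i : ℕ) :
    digitMeasure = ∑ k : Fin 4, (4⁻¹ : ENNReal) •
      digitMeasure.map fun ω : ℕ → Fin 4 => Function.update ω i k := by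
  symm
  refine Measure.eq_infinitePi _ fun s t htm => ?_
  have hm : MeasurableSet (Set.pi (s : Set ℕ) t) :=
    MeasurableSet.pi s.countable_toSet fun l _ => htm l
  rw [Measure.finsetSum_apply]
  simp only [Measure.smul_apply, smul_eq_mul, Measure.map_apply (measurable_update_const i _) hm]
  classical
  have hpre : ∀ k : Fin 4, (fun ω : ℕ → Fin 4 => Function.update ω i k) ⁻¹' Set.pi (s : Set ℕ) t =
      if i ∈ s → k ∈ t i then Set.pi ((s.erase i : Finset ℕ) : Set ℕ) t else ∅ := by
    intro k
    ext ω
    split_ifs with hk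
    · simp only [Set.mem_preimage, Set.mem_pi, Finset.mem_coe, Finset.mem_erase]
      constructor
      · rintro H l ⟨hl, hls⟩
        simpa [Function.update_of_ne hl] using H l hls
      · intro H l hl
        by_cases hli : l = i
        · subst hli; simpa using hk hl
        · simpa [Function.update_of_ne hli] using H l ⟨hli, hl⟩
    · simp only [Set.mem_preimage, Set.mem_pi, Finset.mem_coe, Set.mem_empty_iff_false, iff_false]
      intro H
      exact hk fun his => by simpa using H i his
  simp_rw [hpre]
  have hval : digitMeasure (Set.pi ((s.erase i : Finset ℕ) : Set ℕ) t) =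
      ∏ l ∈ s.erase i, unif4 (t l) := Measure.infinitePi_pi _ fun l _ => htm l
  have hterm : ∀ k : Fin 4, 4⁻¹ * digitMeasure (if i ∈ s → k ∈ t i then
      Set.pi ((s.erase i : Finset ℕ) : Set ℕ) t else ∅) =
      (4⁻¹ * if i ∈ s → k ∈ t i then 1 else 0) * ∏ l ∈ s.erase i, unif4 (t l) := by
    intro k
    split_ifs
    · rw [hval, mul_one]
    · simp
  simp_rw [hterm]
  rw [← Finset.sum_mul]
  by_cases his : i ∈ s
  · rw [← Finset.mul_prod_erase s _ his]
    congr 1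
    simp [his, unif4, Measure.finsetSum_apply, Set.indicator_apply]
  · rw [Finset.erase_eq_of_notMem his]
    simp [his, four_mul_inv]

/-- The law of the itinerary of a random point of level `n` of tower `i`. -/
def levelLaw (c : ℕ → Fin 4 → ℤ) (i : ℕ) (n : ℤ) : Measure (ℕ → ℤ → Bool) :=
  digitMeasure.map (itinerary c i n)

instance (i : ℕ) (n : ℤ) : IsProbabilityMeasure (levelLaw c i n) :=
  Measure.isProbabilityMeasure_map (measurable_itinerary i n).aemeasurable

theorem levelLaw_eq_sum (i : ℕ) (n : ℤ) :
    levelLaw c i n = ∑ k : Fin 4, (4⁻¹ : ENNReal) • levelLaw c (i + 1) (n + c i k) := by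
  ext A hA
  rw [levelLaw, Measure.map_apply (measurable_itinerary i n) hA, digitMeasure_eq_sum i,
    Measure.finsetSum_apply, Measure.finsetSum_apply]
  refine Finset.sum_congr rfl fun k _ => ?_
  rw [Measure.smul_apply, Measure.smul_apply, Measure.map_apply (measurable_update_const i k)
    (measurable_itinerary i n hA), levelLaw, Measure.map_apply (measurable_itinerary _ _) hA]
  congr 2
  ext ω
  simp only [Set.mem_preimage]
  rw [itinerary_next, itinerary_update, Function.update_self]

theorem map_shift_levelLaw (i : ℕ) (n : ℤ) :
    (levelLaw c i n).map itineraryShift = levelLaw c i (n - 1) := by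
  rw [levelLaw, Measure.map_map itineraryShift.measurable (measurable_itinerary i n), levelLaw]
  congr 1
  funext ω
  exact itineraryShift_itinerary i n ω

theorem map_shift_symm_levelLaw (i : ℕ) (n : ℤ) :
    (levelLaw c i n).map itineraryShift.symm = levelLaw c i (n + 1) := by
  rw [levelLaw, Measure.map_map itineraryShift.symm.measurable (measurable_itinerary i n), levelLaw]
  congr 1
  funext ω
  exact itineraryShift_symm_itinerary i n ω

/-- The invariant measure restricted to the levels of tower `i`. -/
def towerMeasure (c : ℕ → Fin 4 → ℤ) (h : ℕ → ℤ) (i : ℕ) (e : ℤ) : Measure (ℕ → ℤ → Bool) :=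
  (4⁻¹ : ENNReal) ^ i • ∑ n ∈ Finset.Icc (-h i) (h i), levelLaw c i (n + e)

instance (i : ℕ) (e : ℤ) : IsFiniteMeasure (towerMeasure c h i e) := by
  unfold towerMeasure
  exact Measure.smul_finite _ (ENNReal.pow_ne_top (by simp))

/-- After cutting, the levels of tower `i` occupy distinct levels of tower `i + 1` by `gap`, and the
`+ 1` in `step` leaves room to displace the whole tower by one. The case e = 0 gives monotonicity in
`i`, and e = ±1 gives shift invariance of the limit. -/
theorem IsTower.towerMeasure_le (ht : IsTower c h) (i : ℕ) {e : ℤ} (he : |e| ≤ 1) :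
    towerMeasure c h i e ≤ towerMeasure c h (i + 1) 0 := by
  have h1 : towerMeasure c h i e = (4⁻¹ : ENNReal) ^ (i + 1) •
      ∑ p ∈ Finset.Icc (-h i) (h i) ×ˢ (Finset.univ : Finset (Fin 4)),
        levelLaw c (i + 1) (p.1 + e + c i p.2) := by
    rw [towerMeasure, pow_succ, mul_smul, Finset.sum_product, Finset.smul_sum (r := (4⁻¹ : ENNReal))]
    congr 1
    refine Finset.sum_congr rfl fun n _ => ?_
    rw [levelLaw_eq_sum, Finset.smul_sum]
  rw [h1, towerMeasure]
  refine Measure.le_iff.2 fun A hA => ?_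
  rw [Measure.smul_apply, Measure.smul_apply, Measure.finsetSum_apply, Measure.finsetSum_apply]
  refine smul_le_smul_of_nonneg_left ?_ zero_le
  simp only [add_zero]
  have hinj : Set.InjOn (fun p : ℤ × Fin 4 => p.1 + e + c i p.2)
      (Finset.Icc (-h i) (h i) ×ˢ (Finset.univ : Finset (Fin 4)) : Finset (ℤ × Fin 4)) := by
    rintro ⟨n, k⟩ hp ⟨n', k'⟩ hp' heq
    simp only [Finset.coe_product, Set.mem_prod, Finset.coe_Icc, Set.mem_Icc] at hp hp' heq
    by_cases hk : k = k'
    · subst hk; simp at heq; rw [heq]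
    · have := ht.gap i k k' hk
      rw [lt_abs] at this
      omega
  rw [← Finset.sum_image (f := fun n => levelLaw c (i + 1) n A) hinj]
  refine Finset.sum_le_sum_of_subset fun n hn => ?_
  obtain ⟨⟨n', k⟩, hp, rfl⟩ := Finset.mem_image.1 hn
  have hp' := (Finset.mem_product.1 hp).1
  have h2 := ht.step i k
  rw [Finset.mem_Icc] at hp' ⊢
  have h3 := abs_le.1 (le_refl |c i k|)
  have h4 := abs_le.1 he
  simp only at hp' ⊢
  omega

theorem map_shift_towerMeasure (i : ℕ) :
    (towerMeasure c h i 0).map itineraryShift = towerMeasure c h i (-1) := by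
  rw [towerMeasure, Measure.map_smul, Measure.map_finset_sum itineraryShift.measurable.aemeasurable,
    towerMeasure]
  simp only [map_shift_levelLaw, add_zero, sub_eq_add_neg]

theorem map_shift_symm_towerMeasure (i : ℕ) :
    (towerMeasure c h i 0).map itineraryShift.symm = towerMeasure c h i 1 := by
  rw [towerMeasure, Measure.map_smul,
    Measure.map_finset_sum itineraryShift.symm.measurable.aemeasurable, towerMeasure]
  simp only [map_shift_symm_levelLaw, add_zero]

/-- The limit is the sum of the successive differences; finiteness makes the subtraction legitimate.
-/
theorem exists_measure_eq_iSup {X : Type*} [MeasurableSpace X] (m : ℕ → Measure X)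
    [∀ i, IsFiniteMeasure (m i)] (hm : Monotone m) :
    ∃ μ : Measure X, ∀ A, MeasurableSet A → μ A = ⨆ i, m i A := by
  let d : ℕ → Measure X := fun i => Nat.casesOn i (m 0) fun i => m (i + 1) - m i
  have hd : ∀ i, ∑ l ∈ Finset.range (i + 1), d l = m i := by
    intro i
    induction i with
    | zero => simp [d]
    | succ i ih =>
      rw [Finset.sum_range_succ, ih, add_comm]
      exact Measure.sub_add_cancel_of_le (hm (Nat.le_succ i))
  refine ⟨Measure.sum d, fun A hA => ?_⟩
  rw [Measure.sum_apply _ hA, ENNReal.tsum_eq_iSup_nat]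
  refine le_antisymm (iSup_le fun i => ?_) (iSup_le fun i => ?_)
  · refine le_trans (Finset.sum_le_sum_of_subset (Finset.range_mono (Nat.le_succ i))) ?_
    rw [← Measure.finsetSum_apply, hd]
    exact le_iSup (fun i => m i A) i
  · rw [← hd i, Measure.finsetSum_apply]
    exact le_iSup (fun i => ∑ l ∈ Finset.range i, d l A) (i + 1)

end Tower

/-! ### The invariant measure of the rank-one transformation. -/

section TowerSpace
open Filter Topology
variable {c : ℕ → Fin 4 → ℤ} {h : ℕ → ℤ}

/-- The set of itineraries visiting the base of tower `j` at time `a`. -/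
def level (j : ℕ) (a : ℤ) : Set (ℕ → ℤ → Bool) := {x | x j a = true}

theorem mem_level {j : ℕ} {a : ℤ} {x : ℕ → ℤ → Bool} : x ∈ level j a ↔ x j a = true := Iff.rfl

theorem measurableSet_level (j : ℕ) (a : ℤ) : MeasurableSet (level j a) := by
  have : Measurable fun x : ℕ → ℤ → Bool => x j a :=
    (measurable_pi_apply a).comp (measurable_pi_apply j)
  exact this (MeasurableSet.singleton true)

/-- The shift-invariant measure describing the rank-one transformation with data `c`, `h`. -/
structure IsTowerMeasure (c : ℕ → Fin 4 → ℤ) (h : ℕ → ℤ) (μ : Measure (ℕ → ℤ → Bool)) : Prop where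
  pres : MeasurePreserving itineraryShift μ μ
  split : ∀ j a, ∀ᵐ x ∂μ, (x ∈ level j a ↔ ∃ k, x ∈ level (j + 1) (a + c j k))
  disj : ∀ j a b, a ≠ b → |a - b| ≤ 2 * h j → ∀ᵐ x ∂μ, x ∈ level j a → x ∉ level j b
  cover : ∀ᵐ x ∂μ, ∃ a, x ∈ level 0 a
  measure_level : ∀ j a, μ (level j a) = 4⁻¹ ^ j
  measure_univ : μ Set.univ = ⊤

theorem ae_of_iSup {X : Type*} [MeasurableSpace X] {m : ℕ → Measure X} {μ : Measure X}
    (hμ : ∀ A, MeasurableSet A → μ A = ⨆ i, m i A) {p : X → Prop}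
    (hp : MeasurableSet {x | p x}) (H : ∀ i, ∀ᵐ x ∂m i, p x) : ∀ᵐ x ∂μ, p x := by
  rw [ae_iff, ← Set.compl_ofPred, hμ _ hp.compl]
  simp only [ENNReal.iSup_eq_zero]
  intro i
  have := H i
  rwa [ae_iff, ← Set.compl_ofPred] at this

theorem ae_towerMeasure {i : ℕ} {e : ℤ} {p : (ℕ → ℤ → Bool) → Prop} (hp : MeasurableSet {x | p x})
    (H : ∀ i n ω, p (itinerary c i n ω)) : ∀ᵐ x ∂towerMeasure c h i e, p x := by
  have h1 : ∀ n, (levelLaw c i n) {x | p x}ᶜ = 0 := fun n => by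
    rw [levelLaw, Measure.map_apply (measurable_itinerary i n) hp.compl]
    convert measure_empty (μ := digitMeasure)
    ext ω
    simpa using H i n ω
  rw [ae_iff, ← Set.compl_ofPred, towerMeasure, Measure.smul_apply, Measure.finsetSum_apply]
  simp [h1]

theorem measurableSet_split (j : ℕ) (a : ℤ) : MeasurableSet
    {x : ℕ → ℤ → Bool | x ∈ level j a ↔ ∃ k, x ∈ level (j + 1) (a + c j k)} := by
  rw [measurableSet_setOfPred]
  refine Measurable.iff ?_ (Measurable.exists fun k => ?_)
  · exact measurableSet_setOfPred.1 (measurableSet_level j a)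
  · exact measurableSet_setOfPred.1 (measurableSet_level (j + 1) (a + c j k))

theorem measurableSet_disj (j : ℕ) (a b : ℤ) : MeasurableSet
    {x : ℕ → ℤ → Bool | x ∈ level j a → x ∉ level j b} := by
  rw [measurableSet_setOfPred]
  refine Measurable.imp ?_ (Measurable.not ?_)
  · exact measurableSet_setOfPred.1 (measurableSet_level j a)
  · exact measurableSet_setOfPred.1 (measurableSet_level j b)

theorem exists_itinerary_zero (i : ℕ) (n : ℤ) (ω : ℕ → Fin 4) :
    ∃ a, itinerary c i n ω ∈ level 0 a := by
  have : ∀ l ≤ i, ∃ a, itinerary c i n ω ∈ level (i - l) a := by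
    intro l
    induction l with
    | zero => exact fun _ => ⟨n, itinerary_self i n ω⟩
    | succ l ih =>
      intro hl
      obtain ⟨a, ha⟩ := ih (by omega)
      refine ⟨a - c (i - (l + 1)) 0, ?_⟩
      rw [mem_level, itinerary_split]
      refine ⟨0, ?_⟩
      rw [sub_add_cancel, show i - (l + 1) + 1 = i - l by omega]
      exact ha
  simpa using this i le_rfl

/-- Splitting a level of tower `j` into four levels of tower `j + 1`. -/
theorem measure_level_split (ht : IsTower c h) {m : Measure (ℕ → ℤ → Bool)} (j : ℕ) (a : ℤ)
    (hs : ∀ᵐ x ∂m, (x ∈ level j a ↔ ∃ k, x ∈ level (j + 1) (a + c j k)))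
    (hd : ∀ a b, a ≠ b → |a - b| ≤ 2 * h (j + 1) →
      ∀ᵐ x ∂m, x ∈ level (j + 1) a → x ∉ level (j + 1) b) :
    m (level j a) = ∑ k, m (level (j + 1) (a + c j k)) := by
  have h1 : level j a =ᵐ[m] ⋃ k, level (j + 1) (a + c j k) := by
    filter_upwards [hs] with x hx
    refine propext ?_
    change x ∈ level j a ↔ x ∈ ⋃ k, level (j + 1) (a + c j k)
    rw [hx, Set.mem_iUnion]
  rw [measure_congr h1, measure_iUnion₀ _ fun k => (measurableSet_level _ _).nullMeasurableSet,
    tsum_fintype]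
  intro k k' hkk'
  have h2 := ht.gap j k k' hkk'
  have h3 := ht.height_nonneg j
  have h4 := abs_le.1 ((le_refl |c j k|).trans (by linarith [ht.step j k] : _ ≤ h (j + 1)))
  have h5 := abs_le.1 ((le_refl |c j k'|).trans (by linarith [ht.step j k'] : _ ≤ h (j + 1)))
  have h6 := hd (a + c j k) (a + c j k') (fun heq => by
    have : c j k - c j k' = 0 := by linarith
    rw [this, abs_zero] at h2; linarith) (by rw [abs_le]; constructor <;> linarith)
  change m _ = 0
  rw [measure_eq_zero_iff_ae_notMem]
  filter_upwards [h6] with x hx hx2 using hx hx2.1 hx2.2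

/-- Descends from the top tower `i`, where exactly one summand charges the level. The allowance `+
l` pays for the descent, since each splitting gains one unit from `step`; it makes the formula valid
for any fixed `a` once `i` is large. -/
theorem IsTower.towerMeasure_level (ht : IsTower c h) (i l : ℕ) (hl : l ≤ i) (a : ℤ)
    (ha : |a| ≤ h (i - l) + l) : towerMeasure c h i 0 (level (i - l) a) = 4⁻¹ ^ (i - l) := by
  induction l generalizing a with
  | zero =>
    simp only [Nat.sub_zero, Nat.cast_zero, add_zero] at ha ⊢
    have h1 : ∀ n ∈ Finset.Icc (-h i) (h i), levelLaw c i (n + 0) (level i a) =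
        if n = a then 1 else 0 := fun n hn => by
      rw [add_zero, levelLaw, Measure.map_apply (measurable_itinerary i n) (measurableSet_level _ _)]
      split_ifs with hna
      · subst hna
        convert measure_univ (μ := digitMeasure)
        ext ω
        simp [mem_level, itinerary_self i n ω]
      · convert measure_empty (μ := digitMeasure)
        ext ω
        simp only [Set.mem_preimage, Set.mem_empty_iff_false, iff_false]
        intro hx
        have := ht.itinerary_gap (itinerary_self i n ω) hx hna
        rw [Finset.mem_Icc] at hn
        rw [abs_le] at ha
        rw [lt_abs] at this
        omega
    rw [towerMeasure, Measure.smul_apply, Measure.finsetSum_apply, Finset.sum_congr rfl h1,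
      Finset.sum_ite_eq', if_pos, smul_eq_mul, mul_one]
    rw [Finset.mem_Icc]
    exact abs_le.1 ha
  | succ l ih =>
    have e : i - (l + 1) + 1 = i - l := by omega
    rw [measure_level_split ht (i - (l + 1)) a
      (ae_towerMeasure (measurableSet_split _ _) fun i n ω => itinerary_split _ _ _ _ _)
      (fun a b hab hab' => ae_towerMeasure (measurableSet_disj _ _ _) fun i n ω h1 h2 =>
        absurd (ht.itinerary_gap h1 h2 hab) (not_lt.2 hab'))]
    have h1 : ∀ k, towerMeasure c h i 0 (level (i - (l + 1) + 1) (a + c (i - (l + 1)) k)) =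
        4⁻¹ ^ (i - l) := fun k => by
      have h2 := ht.step (i - (l + 1)) k
      rw [e] at h2 ⊢
      refine ih (by omega) _ ?_
      have := abs_add_le a (c (i - (l + 1)) k)
      push_cast at ha
      linarith
    simp_rw [h1]
    rw [Finset.sum_const, Finset.card_univ, Fintype.card_fin, ← e, pow_succ, nsmul_eq_mul,
      mul_comm (4⁻¹ ^ _ : ENNReal), ← mul_assoc]
    push_cast
    rw [four_mul_inv, one_mul]

theorem towerMeasure_univ (i : ℕ) :
    towerMeasure c h i 0 Set.univ = 4⁻¹ ^ i * ((2 * h i + 1).toNat : ENNReal) := by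
  rw [towerMeasure, Measure.smul_apply, Measure.finsetSum_apply]
  simp only [MeasureTheory.IsProbabilityMeasure.measure_univ, Finset.sum_const, smul_eq_mul, nsmul_eq_mul, mul_one,
    Int.card_Icc]
  congr 3
  ring

theorem exists_isTowerMeasure (ht : IsTower c h) :
    ∃ μ : Measure (ℕ → ℤ → Bool), IsTowerMeasure c h μ := by
  have hmono : Monotone fun i => towerMeasure c h i 0 :=
    monotone_nat_of_le_succ fun i => ht.towerMeasure_le i (by simp)
  obtain ⟨μ, hμ⟩ := exists_measure_eq_iSup _ hmono
  refine ⟨μ, ⟨?_, ?_, ?_, ?_, ?_, ?_⟩⟩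
  · refine ⟨itineraryShift.measurable, ?_⟩
    have h1 : μ.map itineraryShift ≤ μ := Measure.le_iff.2 fun A hA => by
      rw [itineraryShift.map_apply, hμ _ (itineraryShift.measurable hA), hμ A hA]
      refine iSup_le fun i => ?_
      rw [← itineraryShift.map_apply, map_shift_towerMeasure]
      exact (ht.towerMeasure_le i (e := -1) (by simp) A).trans
        (le_iSup (fun i => towerMeasure c h i 0 A) (i + 1))
    have h2 : μ.map itineraryShift.symm ≤ μ := Measure.le_iff.2 fun A hA => by
      rw [itineraryShift.symm.map_apply, hμ _ (itineraryShift.symm.measurable hA), hμ A hA]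
      refine iSup_le fun i => ?_
      rw [← itineraryShift.symm.map_apply, map_shift_symm_towerMeasure]
      exact (ht.towerMeasure_le i (e := 1) (by simp) A).trans
        (le_iSup (fun i => towerMeasure c h i 0 A) (i + 1))
    -- Both images are dominated by `μ`; applying the shift to the second inequality reverses the
    -- first.
    refine le_antisymm h1 ?_
    calc μ = (μ.map itineraryShift.symm).map itineraryShift := by simp
      _ ≤ μ.map itineraryShift := Measure.map_mono h2 itineraryShift.measurable
  · exact fun j a => ae_of_iSup hμ (measurableSet_split j a) fun i =>
      ae_towerMeasure (measurableSet_split _ _) fun i n ω => itinerary_split _ _ _ _ _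
  · exact fun j a b hab hab' => ae_of_iSup hμ (measurableSet_disj j a b) fun i =>
      ae_towerMeasure (measurableSet_disj _ _ _) fun i n ω h1 h2 =>
        absurd (ht.itinerary_gap h1 h2 hab) (not_lt.2 hab')
  · have hm : MeasurableSet {x : ℕ → ℤ → Bool | ∃ a, x ∈ level 0 a} := by
      rw [measurableSet_setOfPred]
      exact Measurable.exists fun a => measurableSet_setOfPred.1 (measurableSet_level 0 a)
    exact ae_of_iSup hμ hm fun i => ae_towerMeasure hm exists_itinerary_zero
  · intro j a
    rw [hμ _ (measurableSet_level j a)]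
    have h1 : ∀ i ≥ j + a.natAbs, towerMeasure c h i 0 (level j a) = 4⁻¹ ^ j := fun i hi => by
      have e : i - (i - j) = j := by omega
      have := ht.towerMeasure_level i (i - j) (by omega) a (by
        rw [e]; have := ht.height_nonneg j; rw [abs_le]; omega)
      rwa [e] at this
    refine le_antisymm (iSup_le fun i => ?_) ?_
    · rw [← h1 (max i (j + a.natAbs)) (le_max_right _ _)]
      exact hmono (le_max_left i (j + a.natAbs)) _
    · rw [← h1 (j + a.natAbs) le_rfl]
      exact le_iSup (fun i => towerMeasure c h i 0 (level j a)) _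
  · rw [hμ _ MeasurableSet.univ, iSup_eq_top]
    intro b hb
    obtain ⟨i, hi⟩ := ENNReal.exists_nat_gt hb.ne
    refine ⟨i, hi.trans_le ?_⟩
    rw [towerMeasure_univ]
    -- Tower `i` has 2 h i + 1 levels of measure 4⁻ⁱ, so `growth` makes its mass at least `i`.
    have h1 : (i * 4 ^ i : ℕ) ≤ (2 * h i + 1).toNat := by
      have h2 := ht.growth i
      have h3 := ht.height_nonneg i
      zify
      rw [Int.toNat_of_nonneg (by linarith)]
      linarith
    calc (i : ENNReal) = 4⁻¹ ^ i * ((i * 4 ^ i : ℕ) : ENNReal) := by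
          push_cast
          rw [mul_left_comm, ← mul_pow, mul_comm (4⁻¹ : ENNReal), four_mul_inv, one_pow, mul_one]
      _ ≤ _ := by gcongr

namespace IsTowerMeasure
variable {μ : Measure (ℕ → ℤ → Bool)}

theorem sigmaFinite (hμ : IsTowerMeasure c h μ) : SigmaFinite μ := by
  let N : Set (ℕ → ℤ → Bool) := (⋃ a, level 0 a)ᶜ
  refine Measure.sigmaFinite_of_countable (S := insert N (Set.range fun a : ℤ => level 0 a))
    ((Set.countable_range _).insert _) ?_ ?_
  · rintro s (rfl | ⟨a, rfl⟩)
    · have : μ N = 0 := by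
        rw [measure_eq_zero_iff_ae_notMem]
        filter_upwards [hμ.cover] with x hx
        simpa [N] using hx
      simp [this]
    · simp only
      rw [hμ.measure_level]
      simp
  · rw [Set.sUnion_insert, Set.sUnion_range, Set.compl_union_self]

theorem exists_mem_level (hμ : IsTowerMeasure c h μ) (i : ℕ) : ∀ᵐ x ∂μ, ∃ a, x ∈ level i a := by
  induction i with
  | zero => exact hμ.cover
  | succ i ih =>
    filter_upwards [ih, ae_all_iff.2 (hμ.split i)] with x ⟨a, ha⟩ hx
    obtain ⟨k, hk⟩ := (hx a).1 ha
    exact ⟨_, hk⟩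

theorem nullSingleton (hμ : IsTowerMeasure c h μ) : NullSingletonClass μ := by
  refine ⟨fun x => ?_⟩
  by_contra hx
  -- A point of positive measure lies in some level of every tower, and levels have measure 4⁻ⁱ.
  have h1 : ∀ i, μ {x} ≤ 4⁻¹ ^ i := fun i => by
    have h2 : ∃ a, x ∈ level i a := by
      by_contra hno
      refine hx (measure_mono_null ?_ (ae_iff.1 (hμ.exists_mem_level i)))
      rintro y rfl
      exact hno
    obtain ⟨a, ha⟩ := h2
    rw [← hμ.measure_level i a]
    exact measure_mono (Set.singleton_subset_iff.2 ha)
  have h2 : Tendsto (fun i : ℕ => (4⁻¹ : ENNReal) ^ i) atTop (𝓝 0) :=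
    ENNReal.tendsto_pow_atTop_nhds_zero_of_lt_one (by simp)
  exact hx (le_antisymm (ge_of_tendsto' h2 h1) zero_le)

end IsTowerMeasure
end TowerSpace

/-! ### Correlations of levels along return times. -/

section Correlation
variable {c : ℕ → Fin 4 → ℤ} {h : ℕ → ℤ}

/-- `G j a b` behaves like the measure of the intersection of the levels `a`, `b` of tower `j`. -/
structure IsCorrelation (c : ℕ → Fin 4 → ℤ) (h : ℕ → ℤ) (G : ℕ → ℤ → ℤ → ℝ) : Prop where
  split : ∀ j a b, G j a b = ∑ k, ∑ k', G (j + 1) (a + c j k) (b + c j k')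
  diag : ∀ j a b, |a - b| ≤ 2 * h j → G j a b = if a = b then 4⁻¹ ^ j else 0

/-- At stage `l`, the difference `n - s` of two positions is separated from all the other
differences. -/
structure IsReturnTime (c : ℕ → Fin 4 → ℤ) (h : ℕ → ℤ) (l : ℕ) (n s : ℤ) : Prop where
  sep : ∃ k₀ k₀', c l k₀ - c l k₀' = n - s ∧
    ∀ k k', (k, k') ≠ (k₀, k₀') → 2 * h l < |c l k - c l k' - n|
  bound : ∀ k k', |n| + 2 * h l + |c l k - c l k'| ≤ 2 * h (l + 1)
  bound' : ∀ k k', |s| + 2 * h l + |c l k - c l k'| ≤ 2 * h (l + 1)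
  gap : ∀ k k', k ≠ k' → 2 * h l + |s| < |c l k - c l k'|

variable {G : ℕ → ℤ → ℤ → ℝ}

theorem IsCorrelation.eq_sum_ite (hG : IsCorrelation c h G) (l : ℕ) (a b : ℤ)
    (hb : ∀ k k', |a - b| + |c l k - c l k'| ≤ 2 * h (l + 1)) :
    G l a b = ∑ k, ∑ k', if c l k - c l k' = b - a then (4⁻¹ : ℝ) ^ (l + 1) else 0 := by
  rw [hG.split]
  refine Finset.sum_congr rfl fun k _ => Finset.sum_congr rfl fun k' _ => ?_
  rw [hG.diag]
  · refine if_congr ?_ rfl rfl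
    constructor <;> intro <;> linarith
  · refine le_trans ?_ (hb k k')
    rw [show a + c l k - (b + c l k') = (a - b) + (c l k - c l k') by ring]
    exact abs_add_le _ _

/-- Split both levels once. At time `n` only the pair (k₀, k₀') can contribute among the 16, whereas
at time `s` only the four diagonal pairs can, all equally and under the same condition a = b + s.
Hence the factor 1/4. -/
theorem IsCorrelation.shift_base (hG : IsCorrelation c h G) {l : ℕ} {n s : ℤ}
    (hn : IsReturnTime c h l n s) (a b : ℤ) (hab : |b - a| ≤ 2 * h l) :
    G l a (b + n) = 4⁻¹ * G l a (b + s) := by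
  obtain ⟨k₀, k₀', h0, hsep⟩ := hn.sep
  have hab' := abs_le.1 hab
  rw [hG.eq_sum_ite l a (b + n), hG.eq_sum_ite l a (b + s)]
  · have h1 : ∀ k k', (if c l k - c l k' = b + n - a then (4⁻¹ : ℝ) ^ (l + 1) else 0) =
        if k = k₀ ∧ k' = k₀' then (if a = b + s then (4⁻¹ : ℝ) ^ (l + 1) else 0) else 0 := by
      intro k k'
      by_cases hk : k = k₀ ∧ k' = k₀'
      · rw [if_pos hk, hk.1, hk.2]
        refine if_congr ?_ rfl rfl
        constructor <;> intro <;> linarith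
      · rw [if_neg hk, if_neg]
        intro heq
        have := hsep k k' (fun h => hk (by simpa using h))
        rw [heq, lt_abs] at this
        omega
    have h2 : ∀ k k', (if c l k - c l k' = b + s - a then (4⁻¹ : ℝ) ^ (l + 1) else 0) =
        if k = k' then (if a = b + s then (4⁻¹ : ℝ) ^ (l + 1) else 0) else 0 := by
      intro k k'
      by_cases hk : k = k'
      · rw [if_pos hk, hk]
        refine if_congr ?_ rfl rfl
        constructor <;> intro <;> linarith
      · rw [if_neg hk, if_neg]
        intro heq
        have h3 := hn.gap k k' hk
        have h4 := abs_le.1 (le_refl |s|)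
        rw [heq, lt_abs] at h3
        omega
    simp_rw [h1, h2, ite_and]
    simp
  · intro k k'
    refine le_trans ?_ (hn.bound' k k')
    have : |a - (b + s)| ≤ |s| + 2 * h l := by
      have := abs_le.1 (le_refl |s|)
      rw [abs_le]; omega
    linarith
  · intro k k'
    refine le_trans ?_ (hn.bound k k')
    have : |a - (b + n)| ≤ |n| + 2 * h l := by
      have := abs_le.1 (le_refl |n|)
      rw [abs_le]; omega
    linarith

/-- Splitting carries the identity from tower `l` down to lower towers. Each step releases two units
by `step`, so the term 2r eventually admits any fixed pair of levels. -/
theorem IsCorrelation.shift (ht : IsTower c h) (hG : IsCorrelation c h G) {l : ℕ} {n s : ℤ}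
    (hn : IsReturnTime c h l n s) (r : ℕ) (hr : r ≤ l) (a b : ℤ)
    (hab : |b - a| ≤ 2 * h (l - r) + 2 * r) :
    G (l - r) a (b + n) = 4⁻¹ * G (l - r) a (b + s) := by
  induction r generalizing a b with
  | zero => exact hG.shift_base hn a b (by simpa using hab)
  | succ r ih =>
    rw [hG.split, hG.split, Finset.mul_sum]
    refine Finset.sum_congr rfl fun k _ => ?_
    rw [Finset.mul_sum]
    refine Finset.sum_congr rfl fun k' _ => ?_
    have e : l - (r + 1) + 1 = l - r := by omega
    have h1 := ht.step (l - (r + 1)) k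
    have h2 := ht.step (l - (r + 1)) k'
    rw [e] at h1 h2 ⊢
    rw [add_right_comm, add_right_comm b s]
    refine ih (by omega) _ _ ?_
    have h3 := abs_le.1 (le_refl |c (l - (r + 1)) k|)
    have h4 := abs_le.1 (le_refl |c (l - (r + 1)) k'|)
    push_cast at hab
    rw [abs_le] at hab ⊢
    omega

/-- Correlations of fixed levels are eventually multiplied by `1/4` along return times. -/
theorem IsCorrelation.eventually_shift (ht : IsTower c h) (hG : IsCorrelation c h G) (j : ℕ)
    (a b : ℤ) : ∀ᶠ l in Filter.atTop, ∀ n s, IsReturnTime c h l n s →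
      G j a (b + n) = 4⁻¹ * G j a (b + s) := by
  filter_upwards [Filter.eventually_ge_atTop (j + (b - a).natAbs)] with l hl n s hn
  have e : l - (l - j) = j := by omega
  have := hG.shift ht hn (l - j) (by omega) a b (by
    rw [e]; have := ht.height_nonneg j; rw [abs_le]; omega)
  rwa [e] at this

/-- A nonzero correlation has a nonzero term at every splitting; following these terms up to tower
`l`, where `diag` forces equality, writes b - a as a difference of digit sums. The stage l' is the
highest one with different digits, and all lower stages together contribute at most 2 (h l' - h (l -
r)). -/
theorem IsCorrelation.exists_near_aux (ht : IsTower c h) (hG : IsCorrelation c h G) (l r : ℕ)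
    (hr : r ≤ l) (a b : ℤ) (hab : |b - a| ≤ 2 * h (l - r) + 2 * r) (h0 : G (l - r) a b ≠ 0) :
    a = b ∨ ∃ l' k k', k ≠ k' ∧ |b - a - (c l' k - c l' k')| ≤ 2 * (h l' - h (l - r)) ∧
      l - r ≤ l' := by
  induction r generalizing a b with
  | zero =>
    left
    by_contra hne
    refine h0 ?_
    rw [hG.diag, if_neg hne]
    rw [abs_sub_comm]; simpa using hab
  | succ r ih =>
    rw [hG.split] at h0
    obtain ⟨k, _, hk⟩ := Finset.exists_ne_zero_of_sum_ne_zero h0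
    obtain ⟨k', _, hk'⟩ := Finset.exists_ne_zero_of_sum_ne_zero hk
    have e : l - (r + 1) + 1 = l - r := by omega
    have h1 := ht.step (l - (r + 1)) k
    have h2 := ht.step (l - (r + 1)) k'
    have h3 := abs_le.1 (le_refl |c (l - (r + 1)) k|)
    have h4 := abs_le.1 (le_refl |c (l - (r + 1)) k'|)
    push_cast at hab
    rw [e] at h1 h2 hk'
    rcases ih (by omega) _ _ (by rw [abs_le] at hab ⊢; omega) hk' with heq | ⟨l', q, q', hq, hd, hl'⟩
    · by_cases hkk : k = k'
      · subst hkk; left; linarith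
      · right
        refine ⟨l - (r + 1), k, k', hkk, ?_, le_rfl⟩
        rw [show b - a - (c (l - (r + 1)) k - c (l - (r + 1)) k') = 0 by linarith]
        simp
    · right
      refine ⟨l', q, q', hq, ?_, by omega⟩
      rw [abs_le] at hd ⊢
      omega

/-- Levels of the base tower meet only at times close to a difference of two positions. -/
theorem IsCorrelation.exists_near (ht : IsTower c h) (hG : IsCorrelation c h G) (a b : ℤ)
    (h0 : G 0 a b ≠ 0) :
    a = b ∨ ∃ l k k', k ≠ k' ∧ |b - a - (c l k - c l k')| ≤ 2 * h l := by
  have e : (b - a).natAbs - (b - a).natAbs = 0 := Nat.sub_self _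
  rcases hG.exists_near_aux ht (b - a).natAbs (b - a).natAbs le_rfl a b (by
    rw [e]; have := ht.nonneg; rw [abs_le]; omega) (by rwa [e]) with heq | ⟨l, k, k', hk, hd, _⟩
  · exact Or.inl heq
  · refine Or.inr ⟨l, k, k', hk, hd.trans ?_⟩
    rw [e]; have := ht.nonneg; linarith

theorem IsTowerMeasure.isCorrelation (ht : IsTower c h) {μ : Measure (ℕ → ℤ → Bool)}
    (hμ : IsTowerMeasure c h μ) :
    IsCorrelation c h fun j a b => μ.real (level j a ∩ level j b) := by
  have hfin : ∀ j a, μ (level j a) ≠ ⊤ := fun j a => by rw [hμ.measure_level]; simp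
  refine ⟨fun j a b => ?_, fun j a b hab => ?_⟩
  · have h1 : ∀ b, ∀ m : Measure (ℕ → ℤ → Bool), m ≪ μ →
        m (level j b) = ∑ k, m (level (j + 1) (b + c j k)) := fun b m hm =>
      measure_level_split ht j b (hm.ae_le (hμ.split j b))
        fun a b hab hab' => hm.ae_le (hμ.disj (j + 1) a b hab hab')
    have h2 : μ (level j a ∩ level j b) =
        ∑ k, ∑ k', μ (level (j + 1) (a + c j k) ∩ level (j + 1) (b + c j k')) := by
      rw [← Measure.restrict_apply (measurableSet_level j a),
        h1 a _ Measure.restrict_le_self.absolutelyContinuous]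
      refine Finset.sum_congr rfl fun k _ => ?_
      rw [Measure.restrict_apply (measurableSet_level _ _), Set.inter_comm,
        ← Measure.restrict_apply (measurableSet_level j b),
        h1 b _ Measure.restrict_le_self.absolutelyContinuous]
      refine Finset.sum_congr rfl fun k' _ => ?_
      rw [Measure.restrict_apply (measurableSet_level _ _), Set.inter_comm]
    have h3 : ∀ k k', μ (level (j + 1) (a + c j k) ∩ level (j + 1) (b + c j k')) ≠ ⊤ := fun k k' =>
      measure_ne_top_of_subset Set.inter_subset_left (hfin _ _)
    simp only [Measure.real]
    rw [h2, ENNReal.toReal_sum fun k _ => ENNReal.sum_ne_top.2 fun k' _ => h3 k k']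
    refine Finset.sum_congr rfl fun k _ => ?_
    rw [ENNReal.toReal_sum fun k' _ => h3 k k']
  · split_ifs with heq
    · subst heq
      rw [Set.inter_self, Measure.real, hμ.measure_level]
      simp
    · have : μ (level j a ∩ level j b) = 0 := by
        rw [measure_eq_zero_iff_ae_notMem]
        filter_upwards [hμ.disj j a b heq hab] with x hx hx2 using hx hx2.1 hx2.2
      rw [Measure.real, this, ENNReal.toReal_zero]

end Correlation

/-! ### Indicators of products of levels span L² of the product space. -/

section Rectangles
open Filter Topology
variable {c : ℕ → Fin 4 → ℤ} {h : ℕ → ℤ} {μ : Measure (ℕ → ℤ → Bool)}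

theorem aedisjoint_prod {X Y : Type*} [MeasurableSpace X] [MeasurableSpace Y] {μ : Measure X}
    {ν : Measure Y} [SFinite ν] {A A' : Set X} {B B' : Set Y}
    (H : AEDisjoint μ A A' ∨ AEDisjoint ν B B') : AEDisjoint (μ.prod ν) (A ×ˢ B) (A' ×ˢ B') := by
  rw [AEDisjoint, Set.prod_inter_prod, Measure.prod_prod, mul_eq_zero]
  exact H

namespace IsTowerMeasure

theorem measure_level_ne_top (hμ : IsTowerMeasure c h μ) (j : ℕ) (a : ℤ) : μ (level j a) ≠ ⊤ := by
  rw [hμ.measure_level]; simp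

theorem aedisjoint_level (hμ : IsTowerMeasure c h μ) {j : ℕ} {a b : ℤ} (hab : a ≠ b)
    (hab' : |a - b| ≤ 2 * h j) : AEDisjoint μ (level j a) (level j b) := by
  rw [AEDisjoint, measure_eq_zero_iff_ae_notMem]
  filter_upwards [hμ.disj j a b hab hab'] with x hx hx2 using hx hx2.1 hx2.2

theorem level_ae_eq_iUnion (hμ : IsTowerMeasure c h μ) (j : ℕ) (a : ℤ) :
    level j a =ᵐ[μ] ⋃ k, level (j + 1) (a + c j k) := by
  filter_upwards [hμ.split j a] with x hx
  refine propext ?_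
  change x ∈ level j a ↔ x ∈ ⋃ k, level (j + 1) (a + c j k)
  rw [hx, Set.mem_iUnion]

/-- A level is a union of levels of any sufficiently high tower. -/
theorem level_ae_eq_biUnion (ht : IsTower c h) (hμ : IsTowerMeasure c h μ) (r j : ℕ) (a : ℤ)
    (ha : |a| ≤ h j + r) : ∃ Q ⊆ Finset.Icc (-h (j + r)) (h (j + r)),
      level j a =ᵐ[μ] ⋃ q ∈ Q, level (j + r) q := by
  induction r generalizing j a with
  | zero =>
    refine ⟨{a}, ?_, EventuallyEq.of_eq (by simp only [Finset.mem_singleton, Set.iUnion_iUnion_eq_left]; rfl)⟩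
    simpa [Finset.singleton_subset_iff, Finset.mem_Icc, abs_le] using ha
  | succ r ih =>
    have h1 : ∀ k, |a + c j k| ≤ h (j + 1) + r := fun k => by
      have := ht.step j k
      have := abs_add_le a (c j k)
      push_cast at ha
      linarith
    have ih' := fun k => ih (j + 1) (a + c j k) (h1 k)
    rw [show j + 1 + r = j + (r + 1) by ring] at ih'
    choose Q hQ hQ' using ih'
    refine ⟨Finset.univ.biUnion Q, Finset.biUnion_subset.2 fun k _ => hQ k, ?_⟩
    have e : (⋃ k, ⋃ q ∈ Q k, level (j + (r + 1)) q) =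
        ⋃ q ∈ Finset.univ.biUnion Q, level (j + (r + 1)) q := by
      rw [Finset.set_biUnion_biUnion]; simp
    rw [← e]
    exact (hμ.level_ae_eq_iUnion j a).trans (Filter.EventuallyEq.countable_iUnion hQ')

theorem eventually_level_ae_eq (ht : IsTower c h) (hμ : IsTowerMeasure c h μ) (j : ℕ) (a : ℤ) :
    ∀ᶠ r in atTop, ∃ Q ⊆ Finset.Icc (-h r) (h r), level j a =ᵐ[μ] ⋃ q ∈ Q, level r q := by
  filter_upwards [eventually_ge_atTop (j + a.natAbs)] with r hr
  have := hμ.level_ae_eq_biUnion ht (r - j) j a (by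
    have := ht.height_nonneg j; rw [abs_le]; omega)
  rwa [show j + (r - j) = r by omega] at this

theorem biUnion_level_inter (hμ : IsTowerMeasure c h μ) {r : ℕ} {Q Q' : Finset ℤ}
    (hQ : Q ⊆ Finset.Icc (-h r) (h r)) (hQ' : Q' ⊆ Finset.Icc (-h r) (h r)) :
    ((⋃ q ∈ Q, level r q) ∩ (⋃ q ∈ Q', level r q) : Set _) =ᵐ[μ] ⋃ q ∈ Q ∩ Q', level r q := by
  have h1 : ∀ᵐ x ∂μ, ∀ q ∈ Q, ∀ q' ∈ Q', q ≠ q' → x ∈ level r q → x ∉ level r q' := by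
    refine (ae_ball_iff Q.countable_toSet).2 fun q hq =>
      (ae_ball_iff Q'.countable_toSet).2 fun q' hq' => ?_
    by_cases hqq : q = q'
    · simp [hqq]
    · have h2 := Finset.mem_Icc.1 (hQ hq)
      have h3 := Finset.mem_Icc.1 (hQ' hq')
      filter_upwards [hμ.disj r q q' hqq (by rw [abs_le]; omega)] with x hx _ using hx
  filter_upwards [h1] with x hx
  refine propext ?_
  change x ∈ (⋃ q ∈ Q, level r q) ∩ (⋃ q ∈ Q', level r q) ↔ x ∈ ⋃ q ∈ Q ∩ Q', level r q
  simp only [Set.mem_inter_iff, Set.mem_iUnion, Finset.mem_inter, exists_prop]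
  constructor
  · rintro ⟨⟨q, hq, hxq⟩, ⟨q', hq', hxq'⟩⟩
    by_cases hqq : q = q'
    · exact ⟨q, ⟨hq, hqq ▸ hq'⟩, hxq⟩
    · exact absurd hxq' (hx q hq q' hq' hqq hxq)
  · rintro ⟨q, ⟨hq, hq'⟩, hxq⟩
    exact ⟨⟨q, hq, hxq⟩, ⟨q, hq', hxq⟩⟩

theorem generateFrom_eq_of_levels
    {C : Set (Set ((ℕ → ℤ → Bool) × (ℕ → ℤ → Bool)))} (hC : ∀ s ∈ C, MeasurableSet s)
    (h1 : ∀ j a, (level j a ×ˢ Set.univ : Set ((ℕ → ℤ → Bool) × (ℕ → ℤ → Bool))) ∈ C)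
    (h2 : ∀ j a, (Set.univ ×ˢ level j a : Set ((ℕ → ℤ → Bool) × (ℕ → ℤ → Bool))) ∈ C) :
    (inferInstance : MeasurableSpace ((ℕ → ℤ → Bool) × (ℕ → ℤ → Bool))) =
      MeasurableSpace.generateFrom C := by
  refine le_antisymm ?_ (MeasurableSpace.generateFrom_le hC)
  have hf : @Measurable _ _ (MeasurableSpace.generateFrom C) _
      (Prod.fst : (ℕ → ℤ → Bool) × (ℕ → ℤ → Bool) → _) := by
    let _ := MeasurableSpace.generateFrom C
    refine measurable_pi_lambda _ fun j => measurable_pi_lambda _ fun a => measurable_to_bool ?_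
    convert MeasurableSpace.measurableSet_generateFrom (h1 j a) using 1
    ext x; simp [mem_level]
  have hs : @Measurable _ _ (MeasurableSpace.generateFrom C) _
      (Prod.snd : (ℕ → ℤ → Bool) × (ℕ → ℤ → Bool) → _) := by
    let _ := MeasurableSpace.generateFrom C
    refine measurable_pi_lambda _ fun j => measurable_pi_lambda _ fun a => measurable_to_bool ?_
    convert MeasurableSpace.measurableSet_generateFrom (h2 j a) using 1
    ext x; simp [mem_level]
  exact sup_le hf.comap_le hs.comap_le

/-- The sets whose trace on `level 0 a₀ × level 0 b₀` is a.e. equal to a product of unions of levels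
of every sufficiently high tower. -/
def cellSets (h : ℕ → ℤ) (μ : Measure (ℕ → ℤ → Bool)) (a₀ b₀ : ℤ) :
    Set (Set ((ℕ → ℤ → Bool) × (ℕ → ℤ → Bool))) :=
  {A | MeasurableSet A ∧ ∀ᶠ r in atTop, ∃ Q ⊆ Finset.Icc (-h r) (h r),
    ∃ Q' ⊆ Finset.Icc (-h r) (h r), (A ∩ level 0 a₀ ×ˢ level 0 b₀ : Set _) =ᵐ[μ.prod μ]
      (⋃ q ∈ Q, level r q) ×ˢ (⋃ q ∈ Q', level r q)}

theorem isPiSystem_cellSets (hμ : IsTowerMeasure c h μ) (a₀ b₀ : ℤ) :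
    IsPiSystem (cellSets h μ a₀ b₀) := by
  rintro A ⟨hA, hA'⟩ B ⟨hB, hB'⟩ -
  refine ⟨hA.inter hB, ?_⟩
  filter_upwards [hA', hB'] with r ⟨Q, hQ, Q', hQ', hQA⟩ ⟨P, hP, P', hP', hPB⟩
  refine ⟨Q ∩ P, Finset.inter_subset_left.trans hQ, Q' ∩ P', Finset.inter_subset_left.trans hQ', ?_⟩
  rw [Set.inter_inter_distrib_right]
  refine (hQA.inter hPB).trans ?_
  rw [Set.prod_inter_prod]
  exact Measure.set_prod_ae_eq (hμ.biUnion_level_inter hQ hP) (hμ.biUnion_level_inter hQ' hP')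

theorem level_prod_univ_mem_cellSets (ht : IsTower c h) (hμ : IsTowerMeasure c h μ) (a₀ b₀ : ℤ)
    (j : ℕ) (a : ℤ) : (level j a ×ˢ Set.univ) ∈ cellSets h μ a₀ b₀ := by
  refine ⟨(measurableSet_level j a).prod MeasurableSet.univ, ?_⟩
  filter_upwards [hμ.eventually_level_ae_eq ht j a, hμ.eventually_level_ae_eq ht 0 a₀,
    hμ.eventually_level_ae_eq ht 0 b₀] with r ⟨Q, hQ, hQ'⟩ ⟨P, hP, hP'⟩ ⟨R, hR, hR'⟩
  refine ⟨Q ∩ P, Finset.inter_subset_left.trans hQ, R, hR, ?_⟩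
  rw [Set.prod_inter_prod, Set.univ_inter]
  exact Measure.set_prod_ae_eq ((hQ'.inter hP').trans (hμ.biUnion_level_inter hQ hP)) hR'

theorem univ_prod_level_mem_cellSets (ht : IsTower c h) (hμ : IsTowerMeasure c h μ) (a₀ b₀ : ℤ)
    (j : ℕ) (a : ℤ) : (Set.univ ×ˢ level j a) ∈ cellSets h μ a₀ b₀ := by
  refine ⟨MeasurableSet.univ.prod (measurableSet_level j a), ?_⟩
  filter_upwards [hμ.eventually_level_ae_eq ht j a, hμ.eventually_level_ae_eq ht 0 a₀,
    hμ.eventually_level_ae_eq ht 0 b₀] with r ⟨Q, hQ, hQ'⟩ ⟨P, hP, hP'⟩ ⟨R, hR, hR'⟩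
  refine ⟨P, hP, Q ∩ R, Finset.inter_subset_left.trans hQ, ?_⟩
  rw [Set.prod_inter_prod, Set.univ_inter]
  exact Measure.set_prod_ae_eq hP' ((hQ'.inter hR').trans (hμ.biUnion_level_inter hQ hR))

variable [SigmaFinite μ]

theorem measure_rect_ne_top (hμ : IsTowerMeasure c h μ) (j : ℕ) (a b : ℤ) :
    (μ.prod μ) (level j a ×ˢ level j b) ≠ ⊤ := by
  rw [Measure.prod_prod]
  exact ENNReal.mul_ne_top (hμ.measure_level_ne_top j a) (hμ.measure_level_ne_top j b)

/-- The indicator function of the product of two levels of tower `j`. -/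
def rect (hμ : IsTowerMeasure c h μ) (j : ℕ) (a b : ℤ) : Lp ℂ 2 (μ.prod μ) :=
  indicatorConstLp 2 ((measurableSet_level j a).prod (measurableSet_level j b))
    (hμ.measure_rect_ne_top j a b) 1

theorem inner_rect_left (hμ : IsTowerMeasure c h μ) (j : ℕ) (a b : ℤ) (f : Lp ℂ 2 (μ.prod μ)) :
    inner ℂ (hμ.rect j a b) f = ∫ x in level j a ×ˢ level j b, f x ∂(μ.prod μ) :=
  L2.inner_indicatorConstLp_one _ _ f

theorem inner_rect_rect (hμ : IsTowerMeasure c h μ) (j : ℕ) (a b a' b' : ℤ) :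
    inner ℂ (hμ.rect j a b) (hμ.rect j a' b') =
      ((μ.real (level j a ∩ level j a') * μ.real (level j b ∩ level j b') : ℝ) : ℂ) := by
  rw [rect, rect, L2.inner_indicatorConstLp_one_indicatorConstLp_one (hμs := hμ.measure_rect_ne_top _ _ _)
    (hμt := hμ.measure_rect_ne_top _ _ _), Set.prod_inter_prod, Measure.real, Measure.prod_prod,
    ENNReal.toReal_mul]
  rfl

theorem integrableOn_of_measure_ne_top {X : Type*} [MeasurableSpace X] {ν : Measure X}
    (f : Lp ℂ 2 ν) {A : Set X} (hA : ν A ≠ ⊤) : IntegrableOn f A ν :=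
  have : IsFiniteMeasure (ν.restrict A) := ⟨by simpa using hA.lt_top⟩
  ((Lp.memLp f).restrict A).integrable (by norm_num)

theorem rect_split (ht : IsTower c h) (hμ : IsTowerMeasure c h μ) (j : ℕ) (a b : ℤ) :
    hμ.rect j a b = ∑ p : Fin 4 × Fin 4, hμ.rect (j + 1) (a + c j p.1) (b + c j p.2) := by
  refine ext_inner_right ℂ fun f => ?_
  rw [sum_inner, inner_rect_left]
  simp_rw [inner_rect_left]
  have h1 : (level j a ×ˢ level j b : Set _) =ᵐ[μ.prod μ]
      ⋃ p : Fin 4 × Fin 4, level (j + 1) (a + c j p.1) ×ˢ level (j + 1) (b + c j p.2) := by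
    refine (Measure.set_prod_ae_eq (hμ.level_ae_eq_iUnion j a)
      (hμ.level_ae_eq_iUnion j b)).trans (EventuallyEq.of_eq ?_)
    rw [← Set.iUnion_prod]
  rw [setIntegral_congr_set h1, integral_iUnion_ae, tsum_fintype]
  · exact fun p =>
      ((measurableSet_level _ _).prod (measurableSet_level _ _)).nullMeasurableSet
  · have hd : ∀ a k k', k ≠ k' →
        AEDisjoint μ (level (j + 1) (a + c j k)) (level (j + 1) (a + c j k')) := by
      intro a k k' hk
      have h2 := ht.gap j k k' hk
      have h3 := ht.height_nonneg j
      have h4 := abs_le.1 ((le_refl |c j k|).trans (by linarith [ht.step j k] : _ ≤ h (j + 1)))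
      have h5 := abs_le.1 ((le_refl |c j k'|).trans (by linarith [ht.step j k'] : _ ≤ h (j + 1)))
      refine hμ.aedisjoint_level (fun heq => ?_) (by rw [abs_le]; constructor <;> linarith)
      have : c j k - c j k' = 0 := by linarith
      rw [this, abs_zero] at h2; linarith
    intro p q hpq
    refine aedisjoint_prod ?_
    by_cases hp : p.1 = q.1
    · exact Or.inr (hd b _ _ fun hp' => hpq (Prod.ext hp hp'))
    · exact Or.inl (hd a _ _ hp)
  · refine (integrableOn_of_measure_ne_top f (hμ.measure_rect_ne_top j a b)).congr_set_ae h1.symm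

theorem setIntegral_biUnion_level_prod (hμ : IsTowerMeasure c h μ) (w : Lp ℂ 2 (μ.prod μ))
    (hw : ∀ j a b, inner ℂ (hμ.rect j a b) w = 0) {r : ℕ} {Q Q' : Finset ℤ}
    (hQ : Q ⊆ Finset.Icc (-h r) (h r)) (hQ' : Q' ⊆ Finset.Icc (-h r) (h r)) :
    ∫ x in (⋃ q ∈ Q, level r q) ×ˢ (⋃ q ∈ Q', level r q), w x ∂(μ.prod μ) = 0 := by
  have e : ((⋃ q ∈ Q, level r q) ×ˢ (⋃ q ∈ Q', level r q) : Set _) =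
      ⋃ p : Q × Q', level r (p.1 : ℤ) ×ˢ level r (p.2 : ℤ) := by
    rw [Set.iUnion_prod (fun q : Q => level r (q : ℤ)) (fun q : Q' => level r (q : ℤ))]
    simp only [Set.iUnion_subtype]
  have hI : IntegrableOn w (⋃ p : Q × Q', level r (p.1 : ℤ) ×ˢ level r (p.2 : ℤ)) (μ.prod μ) :=
    integrableOn_finite_iUnion.2 fun p =>
      integrableOn_of_measure_ne_top w (hμ.measure_rect_ne_top _ _ _)
  rw [e, integral_iUnion_ae _ _ hI]
  · simp_rw [← hμ.inner_rect_left, hw]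
    exact tsum_zero
  · exact fun p => ((measurableSet_level _ _).prod (measurableSet_level _ _)).nullMeasurableSet
  · have hd : ∀ q ∈ Finset.Icc (-h r) (h r), ∀ q' ∈ Finset.Icc (-h r) (h r), q ≠ q' →
        AEDisjoint μ (level r q) (level r q') := fun q hq q' hq' hne => by
      rw [Finset.mem_Icc] at hq hq'
      exact hμ.aedisjoint_level hne (by rw [abs_le]; omega)
    rintro ⟨p, p'⟩ ⟨q, q'⟩ hpq
    refine aedisjoint_prod ?_
    by_cases hp : p = q
    · refine Or.inr (hd _ (hQ' p'.2) _ (hQ' q'.2) fun hp' => hpq ?_)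
      exact Prod.ext hp (Subtype.ext hp')
    · exact Or.inl (hd _ (hQ p.2) _ (hQ q.2) fun hp' => hp (Subtype.ext hp'))

/-- On a product of two levels of tower 0, which has finite measure, the integrals of `w` vanish on
the π-system `cellSets`, which generates the σ-algebra. By the π-λ theorem they vanish on all
measurable subsets, and countably many such products cover almost everything. -/
theorem eq_zero_of_inner_rect (ht : IsTower c h) (hμ : IsTowerMeasure c h μ)
    (w : Lp ℂ 2 (μ.prod μ)) (hw : ∀ j a b, inner ℂ (hμ.rect j a b) w = 0) : w = 0 := by
  have key : ∀ a₀ b₀ : ℤ, ∀ᵐ x ∂(μ.prod μ), x ∈ level 0 a₀ ×ˢ level 0 b₀ → w x = 0 := by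
    intro a₀ b₀
    have hRm : MeasurableSet (level 0 a₀ ×ˢ level 0 b₀) :=
      (measurableSet_level _ _).prod (measurableSet_level _ _)
    have hI := integrableOn_of_measure_ne_top w (hμ.measure_rect_ne_top 0 a₀ b₀)
    have hR0 : ∫ x in level 0 a₀ ×ˢ level 0 b₀, w x ∂(μ.prod μ) = 0 := by
      rw [← hμ.inner_rect_left, hw]
    have h1 : ∀ A, MeasurableSet A →
        ∫ x in A, w x ∂((μ.prod μ).restrict (level 0 a₀ ×ˢ level 0 b₀)) = 0 := by
      refine MeasurableSpace.induction_on_inter (C := fun A _ =>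
        ∫ x in A, w x ∂((μ.prod μ).restrict (level 0 a₀ ×ˢ level 0 b₀)) = 0)
        (generateFrom_eq_of_levels (C := cellSets h μ a₀ b₀) (fun s hs => hs.1)
          (hμ.level_prod_univ_mem_cellSets ht a₀ b₀) (hμ.univ_prod_level_mem_cellSets ht a₀ b₀))
        (hμ.isPiSystem_cellSets a₀ b₀) ?_ ?_ ?_ ?_
      · simp
      · rintro A ⟨hA, hA'⟩
        obtain ⟨r, Q, hQ, Q', hQ', he⟩ := hA'.exists
        rw [Measure.restrict_restrict hA, setIntegral_congr_set he,
          hμ.setIntegral_biUnion_level_prod w hw hQ hQ']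
      · intro A hA hA0
        have := integral_add_compl hA hI
        rw [hA0, zero_add, hR0] at this
        exact this
      · intro f hd hf hf0
        rw [integral_iUnion hf hd hI.integrableOn]
        simp [hf0]
    have h2 := Integrable.ae_eq_zero_of_forall_setIntegral_eq_zero hI fun A hA _ => h1 A hA
    rwa [EventuallyEq, ae_restrict_iff' hRm] at h2
  rw [Lp.eq_zero_iff_ae_eq_zero]
  have h3 := ae_all_iff.2 fun a => ae_all_iff.2 fun b => key a b
  filter_upwards [h3, Measure.quasiMeasurePreserving_fst.ae hμ.cover,
    Measure.quasiMeasurePreserving_snd.ae hμ.cover] with x hx ⟨a, ha⟩ ⟨b, hb⟩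
  exact hx a b ⟨ha, hb⟩

/-- The indicators of products of levels span a dense subspace. -/
theorem span_rect (ht : IsTower c h) (hμ : IsTowerMeasure c h μ) :
    (Submodule.span ℂ (Set.range fun p : ℕ × ℤ × ℤ =>
      hμ.rect p.1 p.2.1 p.2.2)).topologicalClosure = ⊤ := by
  rw [Submodule.topologicalClosure_eq_top_iff, Submodule.eq_bot_iff]
  intro w hw
  exact hμ.eq_zero_of_inner_rect ht w fun j a b => hw _ (Submodule.subset_span ⟨(j, a, b), rfl⟩)

end IsTowerMeasure
end Rectangles

/-! ### Weak convergence in Hilbert space. -/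

section WeakLimits
open Filter Topology
variable {H : Type*} [NormedAddCommGroup H] [InnerProductSpace ℂ H]

/-- Weak convergence of a bounded sequence can be tested on a set with dense span. -/
theorem tendsto_inner_of_dense_span {S : Set H}
    (hS : (Submodule.span ℂ S).topologicalClosure = ⊤) {v : ℕ → H} {w : H} {C : ℝ}
    (hv : ∀ k, ‖v k‖ ≤ C)
    (h : ∀ g ∈ S, Tendsto (fun k => inner ℂ g (v k)) atTop (𝓝 (inner ℂ g w))) (g : H) :
    Tendsto (fun k => inner ℂ g (v k)) atTop (𝓝 (inner ℂ g w)) := by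
  let K : Submodule ℂ H :=
    { carrier := {g | Tendsto (fun k => inner ℂ g (v k)) atTop (𝓝 (inner ℂ g w))}
      add_mem' := fun {a b} ha hb => by
        change Tendsto _ _ _
        simp_rw [inner_add_left]
        exact Tendsto.add ha hb
      zero_mem' := by
        change Tendsto _ _ _
        simp_rw [inner_zero_left]
        exact tendsto_const_nhds
      smul_mem' := fun a b hb => by
        change Tendsto _ _ _
        simp_rw [inner_smul_left]
        exact Tendsto.const_mul _ hb }
  have hK : IsClosed (K : Set H) := by
    refine isClosed_of_closure_subset fun g hg => ?_
    change Tendsto _ _ _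
    rw [Metric.tendsto_atTop]
    intro ε hε
    have hC : 0 ≤ C := (norm_nonneg _).trans (hv 0)
    have hD : 0 < C + ‖w‖ + 1 := by positivity
    obtain ⟨g', hg', hd⟩ := Metric.mem_closure_iff.1 hg (ε / 2 / (C + ‖w‖ + 1)) (by positivity)
    obtain ⟨N, hN⟩ := Metric.tendsto_atTop.1
      (show Tendsto (fun k => inner ℂ g' (v k)) atTop (𝓝 (inner ℂ g' w)) from hg')
      (ε / 2) (by positivity)
    refine ⟨N, fun k hk => ?_⟩
    have h1 := hN k hk
    rw [dist_eq_norm, ← inner_sub_right] at h1 ⊢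
    rw [dist_eq_norm, lt_div_iff₀ hD] at hd
    have h2 : ‖v k - w‖ ≤ C + ‖w‖ + 1 := by
      have := norm_sub_le (v k) w
      have := hv k
      linarith
    have h3 : inner ℂ g (v k - w) = inner ℂ (g - g') (v k - w) + inner ℂ g' (v k - w) := by
      rw [inner_sub_left]; ring
    rw [h3]
    have h4 := norm_add_le (inner ℂ (g - g') (v k - w)) (inner ℂ g' (v k - w))
    have h5 := norm_inner_le_norm (𝕜 := ℂ) (g - g') (v k - w)
    have h6 := mul_le_mul_of_nonneg_left h2 (norm_nonneg (g - g'))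
    linarith
  have : (Submodule.span ℂ S).topologicalClosure ≤ K :=
    Submodule.topologicalClosure_minimal _ (Submodule.span_le.2 h) hK
  rw [hS] at this
  exact this trivial

/-- A closed subspace of a Hilbert space is weakly closed. -/
theorem mem_of_tendsto_inner [CompleteSpace H] {K : Submodule ℂ H} (hK : IsClosed (K : Set H))
    {v : ℕ → H} {w : H} (hv : ∀ k, v k ∈ K)
    (h : ∀ g, Tendsto (fun k => inner ℂ g (v k)) atTop (𝓝 (inner ℂ g w))) : w ∈ K := by
  rw [← hK.submodule_topologicalClosure_eq, ← Submodule.orthogonal_orthogonal_eq_closure]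
  intro g hg
  refine tendsto_nhds_unique (h g) ?_
  simp_rw [Submodule.inner_left_of_mem_orthogonal (hv _) hg]
  exact tendsto_const_nhds

end WeakLimits

/-! ### Spectral properties of the tensor product in terms of return times. -/

section Operator
open Filter Topology

theorem itineraryShift_iterate_apply (m : ℕ) (x : ℕ → ℤ → Bool) (j : ℕ) (a : ℤ) :
    itineraryShift^[m] x j a = x j (a + m) := by
  induction m generalizing x with
  | zero => simp
  | succ m ih =>
    rw [Function.iterate_succ_apply, ih, itineraryShift_apply]
    congr 1; push_cast; ring

theorem tensorPow_zpow_apply (m : ℕ) (n : ℤ) (x : (ℕ → ℤ → Bool) × (ℕ → ℤ → Bool)) :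
    ((tensorPow itineraryShift m).toEquiv ^ n : Equiv.Perm _) x =
      (fun j a => x.1 j (a + n), fun j a => x.2 j (a + m * n)) := by
  have hs : ∀ x : (ℕ → ℤ → Bool) × (ℕ → ℤ → Bool), tensorPow itineraryShift m x =
      (fun j a => x.1 j (a + 1), fun j a => x.2 j (a + m)) := fun x => by
    rw [tensorPow_apply]
    refine Prod.ext (funext fun j => funext fun a => itineraryShift_apply _ _ _)
      (funext fun j => funext fun a => itineraryShift_iterate_apply _ _ _ _)
  have hs' : ∀ x : (ℕ → ℤ → Bool) × (ℕ → ℤ → Bool), (tensorPow itineraryShift m).symm x =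
      (fun j a => x.1 j (a - 1), fun j a => x.2 j (a - m)) := fun x => by
    rw [MeasurableEquiv.symm_apply_eq, hs]
    simp
  induction n using Int.induction_on generalizing x with
  | zero => simp
  | succ n ih =>
    rw [zpow_add_one, Equiv.Perm.mul_apply, ih]
    change (fun j a => (tensorPow itineraryShift m x).1 j _,
      fun j a => (tensorPow itineraryShift m x).2 j _) = _
    rw [hs]
    refine Prod.ext (funext fun j => funext fun a => ?_) (funext fun j => funext fun a => ?_)
    · exact congrArg (x.1 j) (by ring)
    · exact congrArg (x.2 j) (by ring)
  | pred n ih =>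
    rw [zpow_sub_one, Equiv.Perm.mul_apply, ih]
    change (fun j a => ((tensorPow itineraryShift m).symm x).1 j _,
      fun j a => ((tensorPow itineraryShift m).symm x).2 j _) = _
    rw [hs']
    refine Prod.ext (funext fun j => funext fun a => ?_) (funext fun j => funext fun a => ?_)
    · exact congrArg (x.1 j) (by ring)
    · exact congrArg (x.2 j) (by ring)

variable {c : ℕ → Fin 4 → ℤ} {h : ℕ → ℤ} {μ : Measure (ℕ → ℤ → Bool)} [SigmaFinite μ]

namespace IsTowerMeasure

theorem tensorKoopman_zpow_rect (hμ : IsTowerMeasure c h μ) (m : ℕ) (n : ℤ) (j : ℕ) (a b : ℤ) :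
    (tensorKoopman itineraryShift hμ.pres m ^ n) (hμ.rect j a b) =
      hμ.rect j (a + n) (b + m * n) := by
  refine Lp.ext ?_
  have hS := measurePreserving_tensorPow itineraryShift hμ.pres m
  refine (coeFn_koopman_zpow _ hS n _).trans ?_
  have h1 := (measurePreserving_perm_zpow _ hS n).quasiMeasurePreserving.ae_eq_comp
    (indicatorConstLp_coeFn (p := 2) (hs := (measurableSet_level j a).prod (measurableSet_level j b))
      (hμs := hμ.measure_rect_ne_top j a b) (c := (1 : ℂ)))
  refine h1.trans (EventuallyEq.trans (EventuallyEq.of_eq ?_) indicatorConstLp_coeFn.symm)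
  funext x
  rw [Function.comp_apply, tensorPow_zpow_apply]
  rfl

/-- For rectangles of the same tower the inner product is a product of two correlations, each
eventually multiplied by 1/4, which gives 1/16. Otherwise the rectangle of the lower tower is split
until the towers agree. -/
theorem tendsto_inner_rect_rect (ht : IsTower c h) (hμ : IsTowerMeasure c h μ) {m : ℕ} {s t : ℤ}
    {φ : ℕ → ℕ} (hφ : Tendsto φ atTop atTop) {n : ℕ → ℤ}
    (hn : ∀ k, IsReturnTime c h (φ k) (n k) s) (hn' : ∀ k, IsReturnTime c h (φ k) (m * n k) t)
    (i : ℕ) (a b : ℤ) (j : ℕ) (a' b' : ℤ) :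
    Tendsto (fun k => inner ℂ (hμ.rect i a b)
        ((tensorKoopman itineraryShift hμ.pres m ^ n k) (hμ.rect j a' b'))) atTop
      (𝓝 (inner ℂ (hμ.rect i a b) ((16⁻¹ : ℂ) • hμ.rect j (a' + s) (b' + t)))) := by
  simp_rw [tensorKoopman_zpow_rect]
  have hr : ∀ r i j a b a' b', i + r = j →
      Tendsto (fun k => inner ℂ (hμ.rect i a b) (hμ.rect j (a' + n k) (b' + m * n k))) atTop
      (𝓝 (inner ℂ (hμ.rect i a b) ((16⁻¹ : ℂ) • hμ.rect j (a' + s) (b' + t)))) := by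
    intro r
    induction r with
    | zero =>
      rintro i j a b a' b' rfl
      have hG := hμ.isCorrelation ht
      refine tendsto_const_nhds.congr' ?_
      filter_upwards [hφ.eventually (hG.eventually_shift ht i a a'),
        hφ.eventually (hG.eventually_shift ht i b b')] with k h1 h2
      rw [inner_smul_right, add_zero, inner_rect_rect, inner_rect_rect, h1 _ _ (hn k),
        h2 _ _ (hn' k)]
      push_cast
      ring
    | succ r ih =>
      intro i j a b a' b' hij
      rw [hμ.rect_split ht i a b]
      simp_rw [sum_inner]
      exact tendsto_finsetSum _ fun p _ => ih _ _ _ _ _ _ (by omega)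
  have hr' : ∀ r i j a b a' b', j + r = i →
      Tendsto (fun k => inner ℂ (hμ.rect i a b) (hμ.rect j (a' + n k) (b' + m * n k))) atTop
      (𝓝 (inner ℂ (hμ.rect i a b) ((16⁻¹ : ℂ) • hμ.rect j (a' + s) (b' + t)))) := by
    intro r
    induction r with
    | zero => exact fun i j a b a' b' hij => hr 0 i j a b a' b' (by omega)
    | succ r ih =>
      intro i j a b a' b' hij
      have e : ∀ x y, hμ.rect j (a' + x) (b' + y) = ∑ p : Fin 4 × Fin 4,
          hμ.rect (j + 1) (a' + c j p.1 + x) (b' + c j p.2 + y) := fun x y => by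
        rw [hμ.rect_split ht j]
        refine Finset.sum_congr rfl fun p _ => ?_
        rw [add_right_comm, add_right_comm b']
      rw [e, Finset.smul_sum, inner_sum]
      simp_rw [e, inner_sum]
      exact tendsto_finsetSum _ fun p _ =>
        ih i (j + 1) a b (a' + c j p.1) (b' + c j p.2) (by omega)
  rcases le_total i j with hij | hij
  · exact hr (j - i) _ _ _ _ _ _ (by omega)
  · exact hr' (i - j) _ _ _ _ _ _ (by omega)

theorem tendsto_inner_zpow_rect (ht : IsTower c h) (hμ : IsTowerMeasure c h μ) {m : ℕ} {s t : ℤ}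
    {φ : ℕ → ℕ} (hφ : Tendsto φ atTop atTop) {n : ℕ → ℤ}
    (hn : ∀ k, IsReturnTime c h (φ k) (n k) s) (hn' : ∀ k, IsReturnTime c h (φ k) (m * n k) t)
    (j : ℕ) (a b : ℤ) (g : Lp ℂ 2 (μ.prod μ)) :
    Tendsto (fun k => inner ℂ g
        ((tensorKoopman itineraryShift hμ.pres m ^ n k) (hμ.rect j a b))) atTop
      (𝓝 (inner ℂ g ((16⁻¹ : ℂ) • hμ.rect j (a + s) (b + t)))) := by
  refine tendsto_inner_of_dense_span (hμ.span_rect ht) (C := ‖hμ.rect j a b‖)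
    (fun k => (LinearIsometryEquiv.norm_map _ _).le) ?_ g
  rintro _ ⟨p, rfl⟩
  exact hμ.tendsto_inner_rect_rect ht hφ hn hn' _ _ _ _ _ _

theorem hasSingularSpectrum (ht : IsTower c h) (hμ : IsTowerMeasure c h μ) {m : ℕ}
    (H : ∃ᶠ l : ℕ in atTop, ∃ n : ℤ, (l : ℤ) ≤ n ∧ IsReturnTime c h l n 0 ∧ IsReturnTime c h l (m * n) 0) :
    HasSingularSpectrum (tensorKoopman itineraryShift hμ.pres m) := by
  obtain ⟨φ, hφ, hH⟩ := extraction_of_frequently_atTop H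
  choose n hn0 hn hn' using hH
  refine hasSingularSpectrum_of_tendsto _ (c := 16⁻¹) (n := n) (by norm_num)
    (tendsto_atTop_mono hn0 (tendsto_natCast_atTop_atTop.comp hφ.tendsto_atTop)) fun f g => ?_
  set U := tensorKoopman itineraryShift hμ.pres m
  -- The limit is known for rectangles on one side and arbitrary vectors on the other. Passing to
  -- the adjoint powers lets density be used on the remaining side.
  have hU : ∀ k u v, inner ℂ u ((U ^ (-n k)) v) = star (inner ℂ v ((U ^ n k) u)) := fun k u v => by
    have h1 := inner_zpow_zpow U u v 0 (-n k)
    have h2 := inner_zpow_zpow U v u (-n k) 0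
    rw [zpow_zero, sub_zero] at h1
    rw [zpow_zero, zero_sub, neg_neg] at h2
    rw [← h2]
    exact (inner_conj_symm _ _).symm
  have key := tendsto_inner_of_dense_span (hμ.span_rect ht) (v := fun k => (U ^ (-n k)) f)
    (w := (16⁻¹ : ℂ) • f) (C := ‖f‖) (fun k => (LinearIsometryEquiv.norm_map _ _).le) (by
      rintro _ ⟨p, rfl⟩
      have h1 := hμ.tendsto_inner_zpow_rect ht hφ.tendsto_atTop hn hn' p.1 p.2.1 p.2.2 f
      simp_rw [hU]
      convert (continuous_star.tendsto _).comp h1 using 2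
      · rfl
      rw [add_zero, add_zero, inner_smul_right, inner_smul_right, star_mul']
      congr 1
      · simp
      · exact (inner_conj_symm _ _).symm) g
  simp_rw [hU] at key
  convert (continuous_star.tendsto _).comp key using 2
  · simp
  · rw [inner_smul_right, star_mul']
    congr 1
    · simp
    · exact (inner_conj_symm _ _).symm

/-- Cyclic subspaces are weakly closed, so the weak limits put every `rect j s t` into the cyclic
space of `rect j 0 0`. Splitting shows that these spaces increase with `j`. -/
theorem hasSimpleSpectrum (ht : IsTower c h) (hμ : IsTowerMeasure c h μ) {m : ℕ}
    (H : ∀ s t : ℤ, ∃ᶠ l in atTop, ∃ n, IsReturnTime c h l n s ∧ IsReturnTime c h l (m * n) t) :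
    HasSimpleSpectrum (tensorKoopman itineraryShift hμ.pres m) := by
  set U := tensorKoopman itineraryShift hμ.pres m with hU
  have key : ∀ j s t, hμ.rect j s t ∈ cyc U (hμ.rect j 0 0) := fun j s t => by
    obtain ⟨φ, hφ, hH⟩ := extraction_of_frequently_atTop (H s t)
    choose n hn hn' using hH
    have h1 : (16⁻¹ : ℂ) • hμ.rect j (0 + s) (0 + t) ∈ cyc U (hμ.rect j 0 0) :=
      mem_of_tendsto_inner (isClosed_cyc U _) (fun k => zpow_mem_cyc_self U _ (n k))
        (hμ.tendsto_inner_zpow_rect ht hφ.tendsto_atTop hn hn' j 0 0)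
    rw [zero_add, zero_add] at h1
    simpa [smul_smul] using Submodule.smul_mem _ (16 : ℂ) h1
  refine hasSimpleSpectrum_of_increasing U (fun j => hμ.rect j 0 0) (fun j => ?_) ?_
  · rw [hμ.rect_split ht j]
    exact Submodule.sum_mem _ fun p _ => key _ _ _
  · rw [← top_le_iff, ← hμ.span_rect ht]
    refine Submodule.topologicalClosure_mono (Submodule.span_le.2 ?_)
    rintro _ ⟨p, rfl⟩
    exact Submodule.mem_iSup_of_mem p.1 (key _ _ _)

/-- An atom would be contained, up to a null set, in a single product of two levels of tower `i` for
every `i`, and the measures of these products tend to 0. -/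
theorem exists_split (hμ : IsTowerMeasure c h μ) (A : Set ((ℕ → ℤ → Bool) × (ℕ → ℤ → Bool)))
    (hA : MeasurableSet A) (h0 : 0 < (μ.prod μ) A) :
    ∃ B ⊆ A, MeasurableSet B ∧ 0 < (μ.prod μ) B ∧ 0 < (μ.prod μ) (A \ B) := by
  by_contra! hns
  refine h0.ne' (le_antisymm ?_ zero_le)
  have hle : ∀ i : ℕ, (μ.prod μ) A ≤ (4⁻¹ : ENNReal) ^ i := fun i => by
    have hcov : ∀ᵐ x ∂(μ.prod μ), ∃ p : ℤ × ℤ, x ∈ level i p.1 ×ˢ level i p.2 := by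
      filter_upwards [Measure.quasiMeasurePreserving_fst.ae (hμ.exists_mem_level i),
        Measure.quasiMeasurePreserving_snd.ae (hμ.exists_mem_level i)] with x ⟨a, ha⟩ ⟨b, hb⟩
      exact ⟨(a, b), ha, hb⟩
    obtain ⟨p, hp⟩ : ∃ p : ℤ × ℤ, 0 < (μ.prod μ) (A ∩ level i p.1 ×ˢ level i p.2) := by
      by_contra! hp
      refine h0.ne' (measure_eq_zero_iff_ae_notMem.2 ?_)
      have hp' := ae_all_iff.2 fun p => measure_eq_zero_iff_ae_notMem.1 (le_antisymm (hp p) zero_le)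
      filter_upwards [hcov, hp'] with x ⟨p, hx⟩ hx' hxA
      exact hx' p ⟨hxA, hx⟩
    have hR : MeasurableSet (level i p.1 ×ˢ level i p.2) :=
      (measurableSet_level _ _).prod (measurableSet_level _ _)
    have h1 := hns _ Set.inter_subset_left (hA.inter hR) hp
    have h2 := measure_inter_add_sdiff (μ := μ.prod μ) A hR
    rw [Set.sdiff_self_inter] at h1
    rw [le_antisymm h1 zero_le, add_zero] at h2
    rw [← h2]
    refine (measure_mono Set.inter_subset_right).trans ?_
    rw [Measure.prod_prod, hμ.measure_level, hμ.measure_level]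
    exact mul_le_of_le_one_right zero_le (pow_le_one₀ zero_le (by norm_num))
  exact ge_of_tendsto' (ENNReal.tendsto_pow_atTop_nhds_zero_of_lt_one (by norm_num)) hle

theorem hasCountableLebesgueSpectrum (hμ : IsTowerMeasure c h μ) {m : ℕ} {N : ℤ}
    (H : ∀ n ≥ N, ∀ a b : ℤ, μ.real (level 0 a ∩ level 0 (a + n)) *
      μ.real (level 0 b ∩ level 0 (b + m * n)) = 0) :
    HasCountableLebesgueSpectrum (tensorKoopman itineraryShift hμ.pres m) := by
  have : Fact ((2 : ENNReal) ≠ ⊤) := ⟨by norm_num⟩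
  obtain ⟨e⟩ : Nonempty (ℕ ≃ ℤ × ℤ) := ⟨(Denumerable.eqv (ℤ × ℤ)).symm⟩
  refine hasCountableLebesgueSpectrum_of_bounded_returns _ _ ?_ hμ.exists_split
    (fun i => level 0 (e i).1 ×ˢ level 0 (e i).2)
    (fun i => (measurableSet_level _ _).prod (measurableSet_level _ _)) ?_ fun i =>
    ⟨N, fun n hn => ?_⟩
  · rw [← Set.univ_prod_univ, Measure.prod_prod, hμ.measure_univ]; simp
  · filter_upwards [Measure.quasiMeasurePreserving_fst.ae hμ.cover,
      Measure.quasiMeasurePreserving_snd.ae hμ.cover] with x ⟨a, ha⟩ ⟨b, hb⟩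
    exact ⟨e.symm (a, b), by simpa using ⟨ha, hb⟩⟩
  · have h0 : (μ.prod μ) ((level 0 (e i).1 ∩ level 0 ((e i).1 + n)) ×ˢ
        (level 0 (e i).2 ∩ level 0 ((e i).2 + m * n))) = 0 := by
      have h1 := H n hn (e i).1 (e i).2
      rw [Measure.real, Measure.real, ← ENNReal.toReal_mul, ← Measure.prod_prod,
        ENNReal.toReal_eq_zero_iff] at h1
      refine h1.resolve_right (measure_ne_top_of_subset ?_
        (hμ.measure_rect_ne_top 0 (e i).1 (e i).2))
      exact Set.prod_mono Set.inter_subset_left Set.inter_subset_left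
    filter_upwards [measure_eq_zero_iff_ae_notMem.1 h0] with x hx hx1 hx2
    rw [tensorPow_zpow_apply] at hx2
    exact hx ⟨⟨hx1.1, hx2.1⟩, ⟨hx1.2, hx2.2⟩⟩

end IsTowerMeasure
end Operator

/-! ### Choice of the parameters, and arithmetic of the position differences. -/

section Parameters
open Filter
variable (a : ℕ → ℕ) (s t : ℕ → ℤ)

/-- Heights of the towers of the construction with data `a`, `s`, `t`. -/
def height : ℕ → ℤ
  | 0 => 0
  -- This is 20 times `spacing`, with `spacing`, `returnTime` and `slack` written out. The factors l
  -- + 2 separate the scales by more than any fixed m.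
  | l + 1 => 20 * (20 * ((l + 2) * (a l * (20 * ((l + 2) * (height l + |s l| + |t l| + 1))))))

/-- The length scale of stage `l`. -/
def slack (l : ℕ) : ℤ := height a s t l + |s l| + |t l| + 1

/-- The return time created at stage `l`. -/
def returnTime (l : ℕ) : ℤ := 20 * ((l + 2) * slack a s t l)

/-- The distance between the two pairs of copies at stage `l`. -/
def spacing (l : ℕ) : ℤ := 20 * ((l + 2) * (a l * returnTime a s t l))

/-- The positions of the four copies of tower `l` in tower `l + 1`. -/
def positions (l : ℕ) : Fin 4 → ℤ :=
  -- The first two copies produce the return time R with shift s, the last two produce aR with shift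
  -- t; the spacing keeps the two pairs far apart.
  ![0, returnTime a s t l - s l, spacing a s t l,
    spacing a s t l + a l * returnTime a s t l - t l]

variable {a s t}

theorem height_succ (l : ℕ) : height a s t (l + 1) = 20 * spacing a s t l := rfl

theorem height_nonneg (l : ℕ) : 0 ≤ height a s t l := by
  induction l with
  | zero => exact le_rfl
  | succ l ih => rw [height]; positivity

theorem slack_pos (l : ℕ) : 0 < slack a s t l := by
  have := height_nonneg (a := a) (s := s) (t := t) l
  rw [slack]; positivity

theorem slack_le (l : ℕ) : 40 * slack a s t l ≤ returnTime a s t l := by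
  have := slack_pos (a := a) (s := s) (t := t) l
  rw [returnTime]; nlinarith

theorem returnTime_pos (l : ℕ) : 0 < returnTime a s t l := by
  have := slack_pos (a := a) (s := s) (t := t) l
  have := slack_le (a := a) (s := s) (t := t) l
  linarith

theorem returnTime_le (ha : ∀ l, 2 ≤ a l) (l : ℕ) :
    2 * returnTime a s t l ≤ a l * returnTime a s t l :=
  mul_le_mul_of_nonneg_right (by exact_mod_cast ha l) (returnTime_pos l).le

theorem le_spacing (l : ℕ) : 40 * (a l * returnTime a s t l) ≤ spacing a s t l := by
  have : 0 ≤ a l * returnTime a s t l := mul_nonneg (by positivity) (returnTime_pos l).le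
  rw [spacing]; nlinarith

theorem isTower (ha : ∀ l, 2 ≤ a l) : IsTower (positions a s t) (height a s t) := by
  have hpow : ∀ l, (4 : ℤ) ^ l ≤ height a s t l + 1 ∧
      ((l : ℤ) + 1) * 4 ^ (l + 1) ≤ height a s t (l + 1) := fun l => by
    -- The extra factor l + 1 over 4ˡ is what makes the total measure infinite.
    have h3 : ∀ l, 4 * ((l + 1) * (height a s t l + 1)) ≤ height a s t (l + 1) := fun l => by
      have h1 := returnTime_le (s := s) (t := t) ha l
      have h2 := le_spacing (a := a) (s := s) (t := t) l
      have h4 : ((l : ℤ) + 1) * (height a s t l + 1) ≤ (l + 2) * slack a s t l := by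
        have := height_nonneg (a := a) (s := s) (t := t) l
        refine mul_le_mul (by linarith) ?_ (by linarith) (by positivity)
        rw [slack]
        have := abs_nonneg (s l)
        have := abs_nonneg (t l)
        linarith
      have h5 : returnTime a s t l = 20 * ((l + 2) * slack a s t l) := rfl
      have := returnTime_pos (a := a) (s := s) (t := t) l
      rw [height_succ]
      linarith
    have h6 : ∀ l, (4 : ℤ) ^ l ≤ height a s t l + 1 := fun l => by
      induction l with
      | zero => simp [height]
      | succ l ih =>
        have := h3 l
        have := height_nonneg (a := a) (s := s) (t := t) l
        rw [pow_succ]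
        nlinarith
    refine ⟨h6 l, ?_⟩
    have := mul_le_mul_of_nonneg_left (h6 l) (show (0 : ℤ) ≤ 4 * (l + 1) by positivity)
    rw [pow_succ]
    linarith [h3 l]
  refine ⟨le_rfl, fun l k => ?_, fun l k k' hk => ?_, fun l => ?_⟩
  · have h1 := returnTime_le (s := s) (t := t) ha l
    have h2 := le_spacing (a := a) (s := s) (t := t) l
    have h3 := slack_le (a := a) (s := s) (t := t) l
    have h4 := height_nonneg (a := a) (s := s) (t := t) l
    have h5 := abs_le.1 (le_refl |s l|)
    have h6 := abs_le.1 (le_refl |t l|)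
    rw [height_succ]
    rw [slack] at h3
    have : |positions a s t l k| ≤ 20 * spacing a s t l - height a s t l - 1 := by
      rw [abs_le]
      fin_cases k <;> simp [positions] <;> omega
    linarith
  · have h1 := returnTime_le (s := s) (t := t) ha l
    have h2 := le_spacing (a := a) (s := s) (t := t) l
    have h3 := slack_le (a := a) (s := s) (t := t) l
    have h4 := height_nonneg (a := a) (s := s) (t := t) l
    have h5 := abs_le.1 (le_refl |s l|)
    have h6 := abs_le.1 (le_refl |t l|)
    rw [slack] at h3
    rw [lt_abs]
    fin_cases k <;> fin_cases k' <;> first | exact absurd rfl hk | (simp [positions]; omega)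
  · cases l with
    | zero => simp [height]
    | succ l => exact_mod_cast (hpow l).2

theorem isReturnTime_of_sep (ha : ∀ l, 2 ≤ a l) {l : ℕ} {n u : ℤ} (hn0 : 0 ≤ n)
    (hn : n ≤ a l * returnTime a s t l) (hu : |u| + height a s t l + 1 ≤ slack a s t l)
    (hsep : ∃ k₀ k₀', positions a s t l k₀ - positions a s t l k₀' = n - u ∧
      ∀ k k', (k, k') ≠ (k₀, k₀') →
        2 * height a s t l < |positions a s t l k - positions a s t l k' - n|) :
    IsReturnTime (positions a s t) (height a s t) l n u := by
  have h1 := returnTime_le (s := s) (t := t) ha l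
  have h2 := le_spacing (a := a) (s := s) (t := t) l
  have h3 := slack_le (a := a) (s := s) (t := t) l
  have h4 := height_nonneg (a := a) (s := s) (t := t) l
  have h5 := abs_le.1 (le_refl |s l|)
  have h6 := abs_le.1 (le_refl |t l|)
  have h7 := abs_nonneg u
  have h8 : slack a s t l = height a s t l + |s l| + |t l| + 1 := rfl
  have hd : ∀ k k', |positions a s t l k - positions a s t l k'| ≤ 2 * spacing a s t l := by
    intro k k'
    rw [abs_le]
    fin_cases k <;> fin_cases k' <;> simp [positions] <;> omega
  refine ⟨hsep, fun k k' => ?_, fun k k' => ?_, fun k k' hk => ?_⟩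
  · rw [abs_of_nonneg hn0, height_succ]
    linarith [hd k k']
  · rw [height_succ]
    linarith [hd k k']
  · rw [lt_abs]
    fin_cases k <;> fin_cases k' <;> first | exact absurd rfl hk | (simp [positions]; omega)

theorem isReturnTime_fst (ha : ∀ l, 2 ≤ a l) (l : ℕ) :
    IsReturnTime (positions a s t) (height a s t) l (returnTime a s t l) (s l) := by
  have h1 := returnTime_le (s := s) (t := t) ha l
  have h2 := le_spacing (a := a) (s := s) (t := t) l
  have h3 := slack_le (a := a) (s := s) (t := t) l
  have h4 := height_nonneg (a := a) (s := s) (t := t) l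
  have h5 := abs_le.1 (le_refl |s l|)
  have h6 := abs_le.1 (le_refl |t l|)
  have h8 : slack a s t l = height a s t l + |s l| + |t l| + 1 := rfl
  refine isReturnTime_of_sep ha (returnTime_pos l).le (by omega) (by omega)
    ⟨1, 0, by simp [positions], fun k k' hk => ?_⟩
  rw [lt_abs]
  fin_cases k <;> fin_cases k' <;> first | exact absurd rfl hk | (simp [positions]; omega)

theorem isReturnTime_snd (ha : ∀ l, 2 ≤ a l) (l : ℕ) :
    IsReturnTime (positions a s t) (height a s t) l (a l * returnTime a s t l) (t l) := by
  have h1 := returnTime_le (s := s) (t := t) ha l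
  have h2 := le_spacing (a := a) (s := s) (t := t) l
  have h3 := slack_le (a := a) (s := s) (t := t) l
  have h4 := height_nonneg (a := a) (s := s) (t := t) l
  have h5 := abs_le.1 (le_refl |s l|)
  have h6 := abs_le.1 (le_refl |t l|)
  have h8 : slack a s t l = height a s t l + |s l| + |t l| + 1 := rfl
  refine isReturnTime_of_sep ha (by have := returnTime_pos (a := a) (s := s) (t := t) l; omega)
    le_rfl (by omega) ⟨3, 2, by simp [positions]; ring, fun k k' hk => ?_⟩
  rw [lt_abs]
  fin_cases k <;> fin_cases k' <;> first | exact absurd rfl hk | (simp [positions]; omega)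

/-- Three scales occur: R within a pair, aR within the other pair, and the spacing between the
pairs. -/
theorem abs_positions_sub (ha : ∀ l, 2 ≤ a l) {l : ℕ} {k k' : Fin 4} (hk : k ≠ k') :
    |positions a s t l k - positions a s t l k'| = returnTime a s t l - s l ∨
    |positions a s t l k - positions a s t l k'| = a l * returnTime a s t l - t l ∨
    spacing a s t l - 2 * returnTime a s t l ≤ |positions a s t l k - positions a s t l k'| ∧
    |positions a s t l k - positions a s t l k'| ≤
      spacing a s t l + 2 * (a l * returnTime a s t l) := by
  have h1 := returnTime_le (s := s) (t := t) ha l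
  have h2 := le_spacing (a := a) (s := s) (t := t) l
  have h3 := slack_le (a := a) (s := s) (t := t) l
  have h4 := height_nonneg (a := a) (s := s) (t := t) l
  have h5 := abs_le.1 (le_refl |s l|)
  have h6 := abs_le.1 (le_refl |t l|)
  have h8 : slack a s t l = height a s t l + |s l| + |t l| + 1 := rfl
  rcases abs_cases (positions a s t l k - positions a s t l k') with ⟨h, h'⟩ | ⟨h, h'⟩ <;>
    rw [h] <;> revert h' <;> fin_cases k <;> fin_cases k' <;>
    first | exact absurd rfl hk | (simp [positions] <;> omega)

/-- With `abs_positions_sub_le`, this separates the differences of distinct stages even after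
multiplication by m ≤ l. Any sufficiently large constant would do in place of 17. -/
theorem le_abs_positions_sub (ha : ∀ l, 2 ≤ a l) {l : ℕ} {k k' : Fin 4} (hk : k ≠ k') :
    17 * ((l + 2) * (height a s t l + 1)) ≤
      |positions a s t l k - positions a s t l k'| - 2 * height a s t l := by
  have h1 := returnTime_le (s := s) (t := t) ha l
  have h2 := le_spacing (a := a) (s := s) (t := t) l
  have h4 := height_nonneg (a := a) (s := s) (t := t) l
  have h5 := abs_le.1 (le_refl |s l|)
  have h6 := abs_le.1 (le_refl |t l|)
  have h7 := slack_le (a := a) (s := s) (t := t) l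
  have h8 : slack a s t l = height a s t l + |s l| + |t l| + 1 := rfl
  have h9 : ((l : ℤ) + 2) * (height a s t l + 1) ≤ (l + 2) * slack a s t l :=
    mul_le_mul_of_nonneg_left (by omega) (by positivity)
  have h10 : returnTime a s t l = 20 * ((l + 2) * slack a s t l) := rfl
  rcases abs_positions_sub (s := s) (t := t) ha (l := l) hk with h | h | h <;> omega

theorem abs_positions_sub_le (ha : ∀ l, 2 ≤ a l) {l : ℕ} {k k' : Fin 4} (hk : k ≠ k') :
    |positions a s t l k - positions a s t l k'| + 2 * height a s t l ≤ height a s t (l + 1) := by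
  have h1 := returnTime_le (s := s) (t := t) ha l
  have h2 := le_spacing (a := a) (s := s) (t := t) l
  have h3 := slack_le (a := a) (s := s) (t := t) l
  have h4 := height_nonneg (a := a) (s := s) (t := t) l
  have h5 := abs_le.1 (le_refl |s l|)
  have h6 := abs_le.1 (le_refl |t l|)
  have h8 : slack a s t l = height a s t l + |s l| + |t l| + 1 := rfl
  rw [height_succ]
  rcases abs_positions_sub (s := s) (t := t) ha (l := l) hk with h | h | h <;> omega

/-- The differences of positions at stage `l` have no ratios close to `m` unless `m = a l`. -/
theorem lt_abs_mul_positions_sub (ha : ∀ l, 2 ≤ a l) {l m : ℕ} (hm : 2 ≤ m) (hml : m ≤ l)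
    (hma : m ≠ a l) {k k' q q' : Fin 4} (hk : k ≠ k') (hq : q ≠ q') :
    2 * ((m + 1) * height a s t l) <
      |m * (positions a s t l k - positions a s t l k') -
        (positions a s t l q - positions a s t l q')| := by
  have hm' : (2 : ℤ) ≤ m := by exact_mod_cast hm
  have hml' : (m : ℤ) ≤ l + 2 := by have : (m : ℤ) ≤ l := by exact_mod_cast hml
                                    linarith
  have h1 := returnTime_le (s := s) (t := t) ha l
  have h2 := le_spacing (a := a) (s := s) (t := t) l
  have h3 := slack_le (a := a) (s := s) (t := t) l
  have h4 := height_nonneg (a := a) (s := s) (t := t) l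
  have h5 := abs_le.1 (le_refl |s l|)
  have h6 := abs_le.1 (le_refl |t l|)
  have hpos := slack_pos (a := a) (s := s) (t := t) l
  have h8 : slack a s t l = height a s t l + |s l| + |t l| + 1 := rfl
  have h9 : returnTime a s t l = 20 * ((l + 2) * slack a s t l) := rfl
  have h10 : spacing a s t l = 20 * ((l + 2) * (a l * returnTime a s t l)) := rfl
  have hA : 0 ≤ a l * returnTime a s t l := by linarith
  have e1 : (m : ℤ) * slack a s t l ≤ (l + 2) * slack a s t l :=
    mul_le_mul_of_nonneg_right hml' hpos.le
  have e2 : 2 * slack a s t l ≤ (m : ℤ) * slack a s t l := mul_le_mul_of_nonneg_right hm' hpos.le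
  have e3 : (m : ℤ) * height a s t l + m * |s l| + m * |t l| + m = m * slack a s t l := by
    rw [h8]; ring
  have e4 : (0 : ℤ) ≤ m * height a s t l := by positivity
  have e5 : |(m : ℤ) * s l| = m * |s l| := by rw [abs_mul, Nat.abs_cast]
  have e6 : |(m : ℤ) * t l| = m * |t l| := by rw [abs_mul, Nat.abs_cast]
  have e7 := abs_le.1 (le_refl |(m : ℤ) * s l|)
  have e8 := abs_le.1 (le_refl |(m : ℤ) * t l|)
  have e9 : (m : ℤ) * (a l * returnTime a s t l) ≤ (l + 2) * (a l * returnTime a s t l) :=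
    mul_le_mul_of_nonneg_right hml' hA
  have e10 : 2 * (a l * returnTime a s t l) ≤ (m : ℤ) * (a l * returnTime a s t l) :=
    mul_le_mul_of_nonneg_right hm' hA
  have e11 : 2 * returnTime a s t l ≤ (m : ℤ) * returnTime a s t l :=
    mul_le_mul_of_nonneg_right hm' (returnTime_pos l).le
  have e12 : 2 * ((m : ℤ) * returnTime a s t l) ≤ m * (a l * returnTime a s t l) := by
    rw [mul_left_comm]; exact mul_le_mul_of_nonneg_left h1 (by positivity)
  -- The only place where m ≠ a l enters: mR and aR differ by at least R.
  have e13 : returnTime a s t l ≤ m * returnTime a s t l - a l * returnTime a s t l ∨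
      returnTime a s t l ≤ a l * returnTime a s t l - m * returnTime a s t l := by
    have hp := (returnTime_pos (a := a) (s := s) (t := t) l).le
    rcases lt_or_gt_of_ne hma with hlt | hlt
    · right
      have : (m : ℤ) + 1 ≤ a l := by exact_mod_cast hlt
      have := mul_le_mul_of_nonneg_right this hp
      linarith
    · left
      have : (a l : ℤ) + 1 ≤ m := by exact_mod_cast hlt
      have := mul_le_mul_of_nonneg_right this hp
      linarith
  -- Within one scale the factor m ≥ 2 separates mp from p'. Between scales, m times an R-difference
  -- misses aR by the previous bound, and m times an R- or aR-difference stays well below the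
  -- spacing since m ≤ l + 2.
  have key : ∀ p p' : ℤ, 0 ≤ p →
      (p = returnTime a s t l - s l ∨ p = a l * returnTime a s t l - t l ∨
        spacing a s t l - 2 * returnTime a s t l ≤ p ∧
          p ≤ spacing a s t l + 2 * (a l * returnTime a s t l)) →
      (p' = returnTime a s t l - s l ∨ p' = a l * returnTime a s t l - t l ∨
        spacing a s t l - 2 * returnTime a s t l ≤ p' ∧
          p' ≤ spacing a s t l + 2 * (a l * returnTime a s t l)) →
      2 * ((m + 1) * height a s t l) < |m * p - p'| := by
    intro p p' hp0 hp hp'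
    have f1 : (2 : ℤ) * p ≤ m * p := mul_le_mul_of_nonneg_right hm' hp0
    have f2 : ((m : ℤ) + 1) * height a s t l = m * height a s t l + height a s t l := by ring
    rw [f2, lt_abs]
    rcases hp with hp | hp | hp
    · have f3 : (m : ℤ) * p = m * returnTime a s t l - m * s l := by rw [hp]; ring
      rcases hp' with hp' | hp' | hp' <;> omega
    · have f3 : (m : ℤ) * p = m * (a l * returnTime a s t l) - m * t l := by rw [hp]; ring
      rcases hp' with hp' | hp' | hp' <;> omega
    · rcases hp' with hp' | hp' | hp' <;> omega
  refine (key _ _ (abs_nonneg _) (abs_positions_sub ha hk) (abs_positions_sub ha hq)).trans_le ?_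
  have := abs_abs_sub_abs_le_abs_sub (m * (positions a s t l k - positions a s t l k'))
    (positions a s t l q - positions a s t l q')
  rwa [abs_mul, Nat.abs_cast] at this

/-- If both factors were nonzero, n would be close to a difference d of stage l and mn to a
difference d' of stage l'. Sizes exclude l ≠ l', and for l = l' the ratio of d' to d would be too
close to m. -/
theorem correlation_mul_eq_zero (ha : ∀ l, 2 ≤ a l) {m : ℕ} (hm : 2 ≤ m)
    (hma : ∀ l, m ≤ l → m ≠ a l) {G : ℕ → ℤ → ℤ → ℝ}
    (hG : IsCorrelation (positions a s t) (height a s t) G) (n : ℤ) (hn : height a s t m < n)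
    (x y : ℤ) : G 0 x (x + n) * G 0 y (y + m * n) = 0 := by
  have ht := isTower (s := s) (t := t) ha
  have hm' : (2 : ℤ) ≤ m := by exact_mod_cast hm
  have hn0 : 0 < n := (height_nonneg m).trans_lt hn
  have hnm : 2 * n ≤ m * n := mul_le_mul_of_nonneg_right hm' hn0.le
  have hmono : Monotone (height a s t) := monotone_nat_of_le_succ fun l => by
    have := ht.step l 0
    have := abs_nonneg (positions a s t l 0)
    linarith
  by_contra hne
  obtain ⟨h1, h2⟩ := mul_ne_zero_iff.1 hne
  obtain ⟨l, k, k', hk, hd⟩ := (hG.exists_near ht _ _ h1).resolve_left (by omega)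
  obtain ⟨l', q, q', hq, hd'⟩ := (hG.exists_near ht _ _ h2).resolve_left (by omega)
  rw [add_sub_cancel_left] at hd hd'
  have b1 := le_abs_positions_sub (s := s) (t := t) ha (l := l) hk
  have b2 := abs_positions_sub_le (s := s) (t := t) ha (l := l) hk
  have b3 := le_abs_positions_sub (s := s) (t := t) ha (l := l') hq
  have b4 := abs_positions_sub_le (s := s) (t := t) ha (l := l') hq
  set d := positions a s t l k - positions a s t l k' with hd_def
  set d' := positions a s t l' q - positions a s t l' q' with hd'_def
  have c1 : |d| ≤ n + 2 * height a s t l := by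
    have := abs_sub_abs_le_abs_sub d n
    rw [abs_sub_comm d n, abs_of_pos hn0] at this
    linarith
  have c2 : n ≤ |d| + 2 * height a s t l := by
    have := abs_sub_abs_le_abs_sub n d
    rw [abs_of_pos hn0] at this
    linarith
  have c3 : |d'| ≤ m * n + 2 * height a s t l' := by
    have := abs_sub_abs_le_abs_sub d' (m * n)
    rw [abs_sub_comm d' (m * n), abs_of_pos (a := (m : ℤ) * n) (by linarith)] at this
    linarith
  have c4 : m * n ≤ |d'| + 2 * height a s t l' := by
    have := abs_sub_abs_le_abs_sub (m * n) d'
    rw [abs_of_pos (a := (m : ℤ) * n) (by linarith)] at this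
    linarith
  -- A difference of stage l < m is too small, since n exceeds the height of tower m.
  have hl : m ≤ l := by
    by_contra! hlt
    have := hmono (Nat.succ_le_of_lt hlt)
    rw [Nat.succ_eq_add_one] at this
    linarith
  have hl0 := height_nonneg (a := a) (s := s) (t := t) l
  have hl0' := height_nonneg (a := a) (s := s) (t := t) l'
  rcases lt_trichotomy l l' with hlt | rfl | hlt
  · have g1 := hmono (Nat.succ_le_of_lt hlt)
    rw [Nat.succ_eq_add_one] at g1
    have g2 : (m : ℤ) * n ≤ (l' + 2) * (height a s t l' + 1) :=
      mul_le_mul (by have : (m : ℤ) ≤ l' := by exact_mod_cast hl.trans hlt.le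
                     linarith) (by linarith) hn0.le (by positivity)
    have g3 : 0 < ((l' : ℤ) + 2) * (height a s t l' + 1) := by positivity
    linarith
  · have g1 := lt_abs_mul_positions_sub (s := s) (t := t) ha hm hl (hma l hl) hk hq
    have g2 : |m * d - d'| ≤ m * |n - d| + |m * n - d'| := by
      have := abs_add_le (m * (d - n)) (m * n - d')
      rw [abs_mul, Nat.abs_cast, abs_sub_comm d n] at this
      refine le_trans (le_of_eq ?_) this
      congr 1; ring
    have g3 := mul_le_mul_of_nonneg_left hd (show (0 : ℤ) ≤ m by positivity)
    rw [← hd_def, ← hd'_def] at g1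
    linarith
  · have g1 := hmono (Nat.succ_le_of_lt hlt)
    rw [Nat.succ_eq_add_one] at g1
    have g3 : 0 ≤ (l : ℤ) * (height a s t l + 1) := by positivity
    linarith

/-- A choice of data in which every admissible triple occurs infinitely often. -/
theorem exists_data (M : Set ℕ) : ∃ (a : ℕ → ℕ) (s t : ℕ → ℤ), (∀ l, 2 ≤ a l) ∧
    (∀ m ∉ M, ∀ l, m ≤ l → m ≠ a l) ∧
    ∀ m ∈ M, 2 ≤ m → ∀ u v, ∃ᶠ l in atTop, a l = m ∧ s l = u ∧ t l = v := by
  classical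
  -- The discarded first coordinate makes every triple occur infinitely often.
  let e := (Denumerable.eqv (ℕ × (ℕ × ℤ × ℤ))).symm
  let p : ℕ → ℕ × ℤ × ℤ := fun l => (e l).2
  -- The default l + 2 is at least 2 and exceeds every m ≤ l, so it creates no unwanted ratio.
  refine ⟨fun l => if (p l).1 ∈ M ∧ 2 ≤ (p l).1 then (p l).1 else l + 2, fun l => (p l).2.1,
    fun l => (p l).2.2, fun l => ?_, fun m hm l hml => ?_, fun m hm hm2 u v => ?_⟩
  · dsimp only
    split_ifs with h
    · exact h.2
    · omega
  · dsimp only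
    split_ifs with h
    · rintro rfl; exact hm h.1
    · omega
  · rw [Nat.frequently_atTop_iff_infinite]
    refine Set.infinite_of_injective_forall_mem (f := fun i => e.symm (i, (m, u, v)))
      (fun i j hij => (Prod.ext_iff.1 (e.symm.injective hij)).1) fun i => ?_
    simp [p, hm, hm2]

end Parameters

end SpectralTensor

end

theorem mainTheorem7 (M : Set ℕ) :
    ∃ (X : Type) (_ : MeasurableSpace X) (_ : StandardBorelSpace X)
      (μ : MeasureTheory.Measure X) (_ : MeasureTheory.SigmaFinite μ)
      (_ : MeasureTheory.NullSingletonClass μ)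
      (T : X ≃ᵐ X) (hT : MeasureTheory.MeasurePreserving T μ μ),
      μ Set.univ = ⊤ ∧
      ∀ m : ℕ, 2 ≤ m →
        (m ∈ M → SpectralTensor.HasSimpleSpectrum (SpectralTensor.tensorKoopman T hT m) ∧
          SpectralTensor.HasSingularSpectrum (SpectralTensor.tensorKoopman T hT m)) ∧
        (m ∉ M →
          SpectralTensor.HasCountableLebesgueSpectrum
            (SpectralTensor.tensorKoopman T hT m)) := by
  obtain ⟨a, s, t, ha, hM, hfreq⟩ := SpectralTensor.exists_data M
  have ht := SpectralTensor.isTower (s := s) (t := t) ha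
  obtain ⟨μ, hμ⟩ := SpectralTensor.exists_isTowerMeasure ht
  have := hμ.sigmaFinite
  refine ⟨ℕ → ℤ → Bool, inferInstance, inferInstance, μ, inferInstance, hμ.nullSingleton,
    SpectralTensor.itineraryShift, hμ.pres, hμ.measure_univ, fun m hm => ⟨fun hmM => ?_,
    fun hmM => ?_⟩⟩
  · refine ⟨hμ.hasSimpleSpectrum ht fun u v => ?_, hμ.hasSingularSpectrum ht ?_⟩
    · refine (hfreq m hmM hm u v).mono ?_
      rintro l ⟨rfl, rfl, rfl⟩
      exact ⟨_, SpectralTensor.isReturnTime_fst ha l, SpectralTensor.isReturnTime_snd ha l⟩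
    · refine (hfreq m hmM hm 0 0).mono ?_
      rintro l ⟨rfl, hs, ht⟩
      refine ⟨SpectralTensor.returnTime a s t l, ?_, hs ▸ SpectralTensor.isReturnTime_fst ha l,
        ht ▸ SpectralTensor.isReturnTime_snd ha l⟩
      have := SpectralTensor.slack_pos (a := a) (s := s) (t := t) l
      rw [SpectralTensor.returnTime]
      nlinarith
  -- The bound on the return times is the height of tower m plus one.
  · exact hμ.hasCountableLebesgueSpectrum fun n hn x y =>
      SpectralTensor.correlation_mul_eq_zero ha hm (hM m hmM) (hμ.isCorrelation ht) n
        (Int.lt_of_add_one_le hn) x y
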